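/- Let $dA$ be Lebesgue measure on $\mathbb C$ and normalise $dd^c$ by $dd^c\log|z|^2=\delta_0$, so $dd^cu=\frac1{4\pi}\Delta u\,dA$. Let $\kappa:\mathbb C\to(0,\infty)$ be $C^\infty$ and such that, for every $z\in\mathbb C$, the function $\zeta\mapsto\log|z-\zeta|^2/\kappa(\zeta)$ is integrable on $\mathbb C$. Put $$\phi(z)=\int_{\mathbb C}\log|z-\zeta|^2\,\frac{dA_\zeta}{\kappa(\zeta)}-\log(1+|z|^2),\qquad \omega=dd^c\log(1+|z|^2),\qquad \omega_\phi=\omega+dd^c\phi .$$ Let $\{\Omega_t\}_{t\in(0,b)}$ be a strictly increasing family of bounded simply connected domains in $\mathbb C$ containing $0$, with smooth boundaries varying smoothly with $t$ (for $t$ near $t_0$, $\partial\Omega_t$ lies near $\partial\Omega_{t_0}$, and near each point of $\partial\Omega_{t_0}$ the domain $\Omega_t$ is, in suitable Euclidean coordinates, the region on one side of the graph of a function depending smoothly on position and on $t$). Suppose that $\Omega_t$ tends to $\{0\}$ as $t\to0$, i.e. for every neighbourhood $U$ of $0$ one has $\Omega_t\subset U$ for all sufficiently small $t>0$. Suppose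 moreover that $\{\Omega_t\}$ is the strong Hele-Shaw flow with permeability $\kappa$: for every $t\in(0,b)$, $$V_t=-\kappa\nabla p_t\quad\text{on }\partial\Omega_t,$$ where $V_t$ is the (outward) normal velocity of $\partial\Omega_t$ and $p_t$ is the function on $\overline{\Omega_t}\setminus\{0\}$ with $\Delta p_t=-\delta_0$ in $\Omega_t$ and $p_t=0$ on $\partial\Omega_t$. Then $\{\Omega_t\}_{t\in(0,b)}$ is the (weak) Hele-Shaw flow on $\mathbb C$ with respect to $\omega_\phi$. That is, $\phi$ is $C^\infty$, $\omega_\phi$ is a Kähler form, $b\le\int_{\mathbb C}\omega_\phi$, and for every $t\in(0,b)$ $$\Omega_t=\{z\in\mathbb C:\psi_t(z)<\phi(z)\},$$ where $\psi_t$ is the pointwise supremum of all upper semicontinuous $\psi:\mathbb C\to\mathbb R\cup\{-\infty\}$ such that $\psi\le\phi$, $\omega+dd^c\psi\ge0$ (i.e. $\psi+\log(1+|z|^2)$ is subharmonic), and $\psi(z)\le t\log|z|^2+O(1)$ near $0$. -/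

import Mathlib

open Set Filter Topology MeasureTheory
open scoped ContDiff

noncomputable section

namespace HeleShaw

/-! ### Envelopes and the (weak) Hele-Shaw flow on `X = ℂ` with origin `0`

A Kähler form `ω` on `ℂ` is given through a global potential `g`, that is `ω = dd^c g`. -/

/-- The density with respect to Lebesgue measure of `dd^c u`, normalised by
`dd^c log |z|² = δ₀`; thus `dd^c u = (1 / 4π) Δu dA`. -/
def ddcDensity (u : ℂ → ℝ) (z : ℂ) : ℝ :=
  (1 / (4 * Real.pi)) * Laplacian.laplacian u z

/-- Subharmonic functions `ℂ → [-∞, ∞)`: upper semicontinuous functions such that on each compact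
set `K`, each continuous function on `K` that is harmonic inside `K` and majorizes `u` on the
boundary of `K` majorizes `u` on `K`. The constant `-∞` is allowed. -/
structure IsSubharmonic (u : ℂ → EReal) : Prop where
  usc : UpperSemicontinuous u
  lt_top : ∀ z, u z < ⊤
  le_of_le_frontier : ∀ (K : Set ℂ) (h : ℂ → ℝ), IsCompact K → ContinuousOn h K →
    InnerProductSpace.HarmonicOnNhd h (interior K) →
    (∀ z ∈ frontier K, u z ≤ (h z : EReal)) → ∀ z ∈ K, u z ≤ (h z : EReal)

/-- `ν₀(ψ) ≥ t`: `ψ(z) ≤ t log |z|² + O(1)` near the origin. -/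
def LelongGE (ψ : ℂ → EReal) (t : ℝ) : Prop :=
  ∃ C : ℝ, ∀ᶠ z in 𝓝[≠] (0 : ℂ), ψ z ≤ ((t * Real.log (‖z‖ ^ 2) + C : ℝ) : EReal)

/-- The competitors `ψ` in the envelope at time `t`: `ψ` is usc, `ψ ≤ φ`, `ω + dd^c ψ ≥ 0`
(that is `g + ψ` is subharmonic, where `ω = dd^c g`) and `ν₀(ψ) ≥ t`. -/
structure IsCandidate (g φ : ℂ → ℝ) (t : ℝ) (ψ : ℂ → EReal) : Prop where
  usc : UpperSemicontinuous ψ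
  le : ∀ z, ψ z ≤ (φ z : EReal)
  subharmonic : IsSubharmonic fun z => (g z : EReal) + ψ z
  lelong : LelongGE ψ t

/-- The Hele-Shaw envelope `ψ_t`, the pointwise supremum of all candidates. -/
def envelope (g φ : ℂ → ℝ) (t : ℝ) (z : ℂ) : EReal :=
  ⨆ (ψ : ℂ → EReal) (_ : IsCandidate g φ t ψ), ψ z

/-- The Hele-Shaw domain `{ψ_t < φ}`. -/
def domain (g φ : ℂ → ℝ) (t : ℝ) : Set ℂ :=
  {z | envelope g φ t z < (φ z : EReal)}

/-- `{Ω_t}`, `t ∈ (0, b)`, is the (weak) Hele-Shaw flow for `ω_φ = dd^c (g + φ)`: the potential `φ`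
is smooth, `ω_φ` is a Kähler form, `b` does not exceed the total area of `ω_φ`, and
`Ω_t = {ψ_t < φ}` for all `t ∈ (0, b)`. -/
structure IsHeleShawFlow (g φ : ℂ → ℝ) (Ω : ℝ → Set ℂ) (b : ℝ) : Prop where
  smooth : ContDiff ℝ ∞ φ
  kahler : ∀ z, 0 < ddcDensity (fun w => g w + φ w) z
  time_le : ENNReal.ofReal b ≤ ∫⁻ z : ℂ, ENNReal.ofReal (ddcDensity (fun w => g w + φ w) z)
  eq_domain : ∀ t ∈ Ioo 0 b, Ω t = domain g φ t

/-- The potential `log (1 + |z|²)` of the Fubini-Study form. -/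
def fsPotential (z : ℂ) : ℝ := Real.log (1 + ‖z‖ ^ 2)

/-- `φ(z) = ∫ log |z - ζ|² dA_ζ / κ(ζ) - log (1 + |z|²)`. -/
def potential (κ : ℂ → ℝ) (z : ℂ) : ℝ :=
  (∫ ζ : ℂ, Real.log (‖z - ζ‖ ^ 2) / κ ζ) - Real.log (1 + ‖z‖ ^ 2)

/-! ### The strong Hele-Shaw flow -/

/-- A smoothly varying family of bounded open sets with smooth boundary: near each boundary point
`x₀` of `Ω_{t₀}`, and for `t` near `t₀`, in suitable rotated Euclidean coordinates `(p, q)` centred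
at `x₀` the set `Ω_t` is the subgraph `q < γ(p, t)` of a function `γ` smooth in `(p, t)`; moreover
for `t` near `t₀` the boundary of `Ω_t` lies near that of `Ω_{t₀}`. -/
structure IsSmoothFamily (Ω : ℝ → Set ℂ) (a b : ℝ) : Prop where
  isOpen : ∀ t ∈ Ioo a b, IsOpen (Ω t)
  isBounded : ∀ t ∈ Ioo a b, Bornology.IsBounded (Ω t)
  local_graph : ∀ t₀ ∈ Ioo a b, ∀ x₀ ∈ frontier (Ω t₀),
    ∃ (u : ℂ) (γ : ℝ × ℝ → ℝ) (ε : ℝ), ‖u‖ = 1 ∧ 0 < ε ∧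
      ContDiffOn ℝ ∞ γ (Ioo (-ε) ε ×ˢ Ioo (t₀ - ε) (t₀ + ε)) ∧
      ∀ p ∈ Ioo (-ε) ε, ∀ q ∈ Ioo (-ε) ε, ∀ t ∈ Ioo (t₀ - ε) (t₀ + ε),
        (x₀ + ((p : ℂ) + (q : ℂ) * Complex.I) * u ∈ Ω t ↔ q < γ (p, t))
  frontier_near : ∀ t₀ ∈ Ioo a b, ∀ U : Set ℂ, IsOpen U → frontier (Ω t₀) ⊆ U →
    ∀ᶠ t in 𝓝 t₀, frontier (Ω t) ⊆ U

/-- `n` is the outward unit normal of `D` at the boundary point `x`. (For `D` with smooth boundary,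
locally on one side of it, this determines `n`.) -/
structure IsOutwardUnitNormal (D : Set ℂ) (x n : ℂ) : Prop where
  norm_eq : ‖n‖ = 1
  inward : ∀ v : ℂ, inner ℝ v n < 0 → ∀ᶠ s : ℝ in 𝓝[>] 0, x + s • v ∈ D
  outward : ∀ v : ℂ, 0 < inner ℝ v n → ∀ᶠ s : ℝ in 𝓝[>] 0, x + s • v ∉ D

/-- `V` is the normal velocity of `∂Ω_{t₀}` at the boundary point `x`: if `n` is the outward unit
normal at `x` and `∂Ω_t` meets the normal line in `x + f(t) n` for `t` near `t₀`, `f(t₀) = 0`,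
then `V = f'(t₀) n`. -/
def HasNormalVelocity (Ω : ℝ → Set ℂ) (t₀ : ℝ) (x V : ℂ) : Prop :=
  ∃ (n : ℂ) (f : ℝ → ℝ) (v : ℝ), IsOutwardUnitNormal (Ω t₀) x n ∧ f t₀ = 0 ∧
    (∀ᶠ t in 𝓝 t₀, x + f t • n ∈ frontier (Ω t)) ∧ HasDerivAt f v t₀ ∧ V = v • n

/-- `p` is the Green potential of the bounded domain `D ∋ 0`: `Δp = -δ₀` in `D` (that is, `p` is
`-(1/2π) log |z|` plus a harmonic function on `D`) and `p` vanishes on the boundary of `D`.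
Only the values of `p` on `D \ {0}` matter. -/
structure IsGreenPotential (D : Set ℂ) (p : ℂ → ℝ) : Prop where
  laplacian_eq : ∃ h : ℂ → ℝ, InnerProductSpace.HarmonicOnNhd h D ∧
    ∀ z ∈ D, z ≠ 0 → p z = -(1 / (2 * Real.pi)) * Real.log ‖z‖ + h z
  boundary : ∀ x ∈ frontier D, Tendsto p (𝓝[D] x) (𝓝 0)

/-- Strong Hele-Shaw flow with permeability `κ`: `V_t = -κ ∇p_t` on `∂Ω_t` for `t ∈ (a, b)`. The
value of `∇p_t` at a boundary point is its limit `G` from inside `Ω_t`. -/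
def IsStrongHeleShawFlow (κ : ℂ → ℝ) (Ω : ℝ → Set ℂ) (a b : ℝ) : Prop :=
  ∀ t ∈ Ioo a b, ∃ p : ℂ → ℝ, IsGreenPotential (Ω t) p ∧
    ∀ x ∈ frontier (Ω t), ∃ V G : ℂ, HasNormalVelocity Ω t x V ∧
      Tendsto (gradient p) (𝓝[Ω t] x) (𝓝 G) ∧ V = -(κ x • G)

end HeleShaw

end

open Laplacian
open scoped Interval

namespace HeleShaw

/-! ### The Laplacian on the complex plane -/

/-! Write `U` for the logarithmic potential of `dA / κ`; since `φ = U - log (1 + |z|²)`, a candidate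
`ψ` gives the subharmonic function `g + ψ ≤ U` with a logarithmic pole of weight at least `t` at
`0`. The proof identifies the largest such function through the excess `Q_t`, the potential of `1 /
κ` on `Ω_t` minus `t log |z|²` (`excess`).

The dynamics enter once, in `hasDerivAt_setIntegral_div`: for a test function `F`, `d/dt ∫_{Ω_t} F /
κ = F(0) + ∫_{Ω_t} p_t ΔF`. The transport theorem gives `∫_{∂Ω_t} F V / κ` with `V` the normal
speed, the law `V = -κ ∇p` cancels `κ`, and Green's formula with `Δp = -δ₀` and `p = 0` on the
boundary gives the right side. Everything is done in local graph coordinates, with test functions of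
small support.

As `p_t ≥ 0`, the quantity `∫_{Ω_s} F / κ - s F(0)` is nondecreasing in `s ≤ t` when `F` is
subharmonic on `Ω_t`, and it tends to `0` as `s → 0` because the domains shrink to the origin. For
harmonic functions this becomes the quadrature identity `∫_{Ω_t} f / κ = t f(0)`
(`setIntegral_eq_of_harmonicOnNhd`); the case `f = 1` bounds `b` by the total area.

Taking for `F` the logarithmic kernel with pole `z` shows that, away from the origin, `Q_t(z)` is
nondecreasing in `t`, vanishes when `z` is outside `Ω_t`, and is nonnegative. It is strictly
positive in `Ω_t` off the origin (`excess_pos`): for `s < t` close to `t`, `Q_t - Q_s` is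
nonnegative and harmonic on the connected set `Ω_s` minus the origin, with a pole `+∞` at `0`.

Finally `U - Q_t` is the potential of `1 / κ` outside `Ω_t` plus `t log |z|²`. It is subharmonic, so
`φ - Q_t` is a candidate (`isCandidate`). It is harmonic in `Ω_t` off `0` and equals `U` on the
boundary, so the maximum principle makes it dominate every other candidate there
(`add_le_of_isCandidate`). Hence `{ψ_t < φ}` consists of the points where `Q_t > 0` together with
the origin, which is `Ω_t`. -/

theorem laplacian_eq_fderiv_fderiv {f : ℂ → ℝ} {z : ℂ} (hf : ContDiffAt ℝ 2 f z) :
    Δ f z = fderiv ℝ (fun w => fderiv ℝ f w 1) z 1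
      + fderiv ℝ (fun w => fderiv ℝ f w Complex.I) z Complex.I := by
  have hd : DifferentiableAt ℝ (fderiv ℝ f) z :=
    (hf.fderiv_right (m := 1) (by norm_num)).differentiableAt (by norm_num)
  have h : ∀ v : ℂ, fderiv ℝ (fun w => fderiv ℝ f w v) z v = fderiv ℝ (fderiv ℝ f) z v v := by
    intro v
    rw [fderiv_clm_apply hd (differentiableAt_const v)]
    simp
  rw [InnerProductSpace.laplacian_eq_iteratedFDeriv_complexPlane, h, h]
  simp [iteratedFDeriv_two_apply]

theorem norm_sub_sq_add (z w : ℂ) (ε : ℝ) :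
    ‖z - w‖ ^ 2 + ε = (w.re - z.re) ^ 2 + (w.im - z.im) ^ 2 + ε := by
  rw [← Complex.normSq_eq_norm_sq, Complex.normSq_apply]
  simp only [Complex.sub_re, Complex.sub_im]
  ring

theorem contDiff_log_norm_sub_sq_add (z : ℂ) {ε : ℝ} (hε : 0 < ε) {n : ℕ∞} :
    ContDiff ℝ n fun w : ℂ => Real.log (‖z - w‖ ^ 2 + ε) :=
  (((contDiff_const.sub contDiff_id).norm_sq ℝ).add contDiff_const).log
    fun w => by positivity

/-- The smooth regularisation of the logarithmic kernel has positive Laplacian, namely `4π` times an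
approximate identity as `ε → 0`. The second fact yields the fundamental solution, the first the
monotonicity of the excess. -/
theorem laplacian_log_norm_sub_sq_add (z : ℂ) {ε : ℝ} (hε : 0 < ε) (w : ℂ) :
    Δ (fun w : ℂ => Real.log (‖z - w‖ ^ 2 + ε)) w = 4 * ε / (‖z - w‖ ^ 2 + ε) ^ 2 := by
  have hre : ∀ w : ℂ, HasFDerivAt (fun w : ℂ => w.re - z.re) Complex.reCLM w := fun w =>
    Complex.reCLM.hasFDerivAt.sub_const _
  have him : ∀ w : ℂ, HasFDerivAt (fun w : ℂ => w.im - z.im) Complex.imCLM w := fun w =>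
    Complex.imCLM.hasFDerivAt.sub_const _
  have hpos : ∀ w : ℂ, 0 < (w.re - z.re) ^ 2 + (w.im - z.im) ^ 2 + ε := fun w => by positivity
  have hD : ∀ w : ℂ, HasFDerivAt (fun w : ℂ => (w.re - z.re) ^ 2 + (w.im - z.im) ^ 2 + ε)
      ((2 * (w.re - z.re)) • Complex.reCLM + (2 * (w.im - z.im)) • Complex.imCLM) w := by
    intro w
    have := (((hre w).pow 2).add ((him w).pow 2)).add_const ε
    simpa using this
  have hf : ∀ w : ℂ, fderiv ℝ (fun w : ℂ => Real.log (‖z - w‖ ^ 2 + ε)) w =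
      ((w.re - z.re) ^ 2 + (w.im - z.im) ^ 2 + ε)⁻¹ •
      ((2 * (w.re - z.re)) • Complex.reCLM + (2 * (w.im - z.im)) • Complex.imCLM) := by
    intro w
    simp_rw [norm_sub_sq_add]
    exact ((hD w).log (hpos w).ne').fderiv
  rw [laplacian_eq_fderiv_fderiv (contDiff_log_norm_sub_sq_add z hε (n := 2)).contDiffAt]
  simp_rw [hf]
  have h1 : HasFDerivAt (fun w : ℂ => (2 * (w.re - z.re)) *
      ((w.re - z.re) ^ 2 + (w.im - z.im) ^ 2 + ε)⁻¹) _ w :=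
    ((hre w).const_mul 2).mul ((hasDerivAt_inv (hpos w).ne').comp_hasFDerivAt w (hD w))
  have h2 : HasFDerivAt (fun w : ℂ => (2 * (w.im - z.im)) *
      ((w.re - z.re) ^ 2 + (w.im - z.im) ^ 2 + ε)⁻¹) _ w :=
    ((him w).const_mul 2).mul ((hasDerivAt_inv (hpos w).ne').comp_hasFDerivAt w (hD w))
  have e1 : (fun w : ℂ => (((w.re - z.re) ^ 2 + (w.im - z.im) ^ 2 + ε)⁻¹ •
      ((2 * (w.re - z.re)) • Complex.reCLM + (2 * (w.im - z.im)) • Complex.imCLM)) (1 : ℂ)) =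
      fun w : ℂ => (2 * (w.re - z.re)) * ((w.re - z.re) ^ 2 + (w.im - z.im) ^ 2 + ε)⁻¹ := by
    ext w; simp; ring
  have e2 : (fun w : ℂ => (((w.re - z.re) ^ 2 + (w.im - z.im) ^ 2 + ε)⁻¹ •
      ((2 * (w.re - z.re)) • Complex.reCLM + (2 * (w.im - z.im)) • Complex.imCLM)) Complex.I) =
      fun w : ℂ => (2 * (w.im - z.im)) * ((w.re - z.re) ^ 2 + (w.im - z.im) ^ 2 + ε)⁻¹ := by
    ext w; simp; ring
  rw [e1, e2, h1.fderiv, h2.fderiv, norm_sub_sq_add]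
  have := (hpos w).ne'
  simp
  field_simp
  ring

theorem contDiff_laplacian {F : ℂ → ℝ} (hF : ContDiff ℝ ∞ F) : ContDiff ℝ ∞ (Δ F) := by
  have h : Δ F = fun z => fderiv ℝ (fun w => fderiv ℝ F w 1) z 1
      + fderiv ℝ (fun w => fderiv ℝ F w Complex.I) z Complex.I := by
    ext z
    exact laplacian_eq_fderiv_fderiv (hF.contDiffAt.of_le ENat.LEInfty.out)
  rw [h]
  have h1 : ∀ v : ℂ, ContDiff ℝ ∞ fun w => fderiv ℝ F w v := fun v =>
    (hF.fderiv_right (m := ∞) (by simp)).clm_apply contDiff_const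
  exact (((h1 1).fderiv_right (m := ∞) (by simp)).clm_apply contDiff_const).add
    (((h1 Complex.I).fderiv_right (m := ∞) (by simp)).clm_apply contDiff_const)

theorem support_laplacian_subset (F : ℂ → ℝ) : Function.support (Δ F) ⊆ tsupport F := by
  intro z hz
  by_contra h
  rw [notMem_tsupport_iff_eventuallyEq] at h
  apply hz
  have := InnerProductSpace.laplacian_congr_nhds h
  rw [this.self_of_nhds]
  have e : (0 : ℂ → ℝ) = fun _ => 0 := rfl
  rw [e]; simp

theorem tsupport_laplacian_subset (F : ℂ → ℝ) : tsupport (Δ F) ⊆ tsupport F :=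
  closure_minimal (support_laplacian_subset F) (isClosed_tsupport F)

theorem hasCompactSupport_laplacian {F : ℂ → ℝ} (hF : HasCompactSupport F) :
    HasCompactSupport (Δ F) :=
  hF.mono' (support_laplacian_subset F)

theorem integrable_mul_of_continuousAt_tsupport {f g : ℂ → ℝ} (hg : Continuous g)
    (hgs : HasCompactSupport g) (hf : ∀ z ∈ tsupport g, ContinuousAt f z) :
    Integrable fun z => f z * g z := by
  refine Continuous.integrable_of_hasCompactSupport ?_ hgs.mul_left
  refine continuous_of_tsupport fun z hz => ?_
  exact (hf z (tsupport_mul_subset_right hz)).mul hg.continuousAt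

/-- The second Green identity, one of the functions having compact support. -/
theorem integral_mul_laplacian_comm {f F : ℂ → ℝ} (hF : ContDiff ℝ ∞ F) (hFs : HasCompactSupport F)
    (hf : ∀ z ∈ tsupport F, ContDiffAt ℝ 2 f z) :
    ∫ z, f z * Δ F z = ∫ z, Δ f z * F z := by
  have h1 : ∀ v : ℂ, ContDiff ℝ ∞ fun w => fderiv ℝ F w v := fun v =>
    (hF.fderiv_right (m := ∞) (by simp)).clm_apply contDiff_const
  have h2 : ∀ v : ℂ, ContDiff ℝ ∞ fun w => fderiv ℝ (fun w => fderiv ℝ F w v) w v := fun v =>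
    ((h1 v).fderiv_right (m := ∞) (by simp)).clm_apply contDiff_const
  have s1 : ∀ v : ℂ, tsupport (fun w => fderiv ℝ F w v) ⊆ tsupport F := fun v =>
    closure_minimal (fun z hz => by
      by_contra h
      rw [notMem_tsupport_iff_eventuallyEq] at h
      apply hz
      have := h.fderiv (𝕜 := ℝ)
      simp [this.self_of_nhds]) (isClosed_tsupport F)
  have s2 : ∀ v : ℂ, tsupport (fun w => fderiv ℝ (fun w => fderiv ℝ F w v) w v) ⊆ tsupport F :=
    fun v => closure_minimal (fun z hz => by
      by_contra h
      have h : z ∉ tsupport (fun w => fderiv ℝ F w v) := fun hh => h (s1 v hh)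
      rw [notMem_tsupport_iff_eventuallyEq] at h
      apply hz
      have := h.fderiv (𝕜 := ℝ)
      simp [this.self_of_nhds]) (isClosed_tsupport F)
  have c1 : ∀ v : ℂ, HasCompactSupport fun w => fderiv ℝ F w v := fun v =>
    hFs.mono' ((subset_tsupport _).trans (s1 v))
  have c2 : ∀ v : ℂ, HasCompactSupport fun w => fderiv ℝ (fun w => fderiv ℝ F w v) w v := fun v =>
    hFs.mono' ((subset_tsupport _).trans (s2 v))
  have hf' : ∀ z ∈ tsupport F, ∀ v, ContDiffAt ℝ 1 (fun w => fderiv ℝ f w v) z := fun z hz v =>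
    ((hf z hz).fderiv_right (m := 1) (by norm_num)).clm_apply contDiffAt_const
  have hf'' : ∀ z ∈ tsupport F, ∀ v,
      ContinuousAt (fun w => fderiv ℝ (fun w => fderiv ℝ f w v) w v) z := fun z hz v =>
    (((hf' z hz v).fderiv_right (m := 0) (by norm_num)).clm_apply contDiffAt_const).continuousAt
  -- Two integrations by parts in the direction `v`. Regularity of `f` is needed only on the support
  -- of `F`, since every product vanishes elsewhere.
  have key : ∀ v : ℂ, ∫ z, f z * fderiv ℝ (fun w => fderiv ℝ F w v) z v =
      ∫ z, fderiv ℝ (fun w => fderiv ℝ f w v) z v * F z := by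
    intro v
    rw [integral_mul_fderiv_eq_neg_fderiv_mul_of_integrable, ← integral_neg]
    · have := integral_mul_fderiv_eq_neg_fderiv_mul_of_integrable (μ := volume)
        (f := fun w => fderiv ℝ f w v) (g := F) (v := v) ?_ ?_ ?_ ?_ ?_
      · rw [integral_neg, this, neg_neg]
      · exact integrable_mul_of_continuousAt_tsupport hF.continuous hFs (fun z hz => hf'' z hz v)
      · exact integrable_mul_of_continuousAt_tsupport (h1 v).continuous (c1 v)
          (fun z hz => (hf' z (s1 v hz) v).continuousAt)
      · exact integrable_mul_of_continuousAt_tsupport hF.continuous hFs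
          (fun z hz => (hf' z hz v).continuousAt)
      · exact fun z hz => (hf' z hz v).differentiableAt (by norm_num)
      · exact fun z _ => hF.contDiffAt.differentiableAt (by simp)
    · exact integrable_mul_of_continuousAt_tsupport (h1 v).continuous (c1 v)
          (fun z hz => (hf' z (s1 v hz) v).continuousAt)
    · exact integrable_mul_of_continuousAt_tsupport (h2 v).continuous (c2 v)
          (fun z hz => (hf z (s2 v hz)).continuousAt)
    · exact integrable_mul_of_continuousAt_tsupport (h1 v).continuous (c1 v)
          (fun z hz => (hf z (s1 v hz)).continuousAt)
    · exact fun z hz => (hf z (s1 v hz)).differentiableAt (by norm_num)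
    · exact fun z _ => (h1 v).contDiffAt.differentiableAt (by simp)
  have eF : ∀ z, f z * Δ F z = f z * fderiv ℝ (fun w => fderiv ℝ F w 1) z 1 +
      f z * fderiv ℝ (fun w => fderiv ℝ F w Complex.I) z Complex.I := fun z => by
    rw [laplacian_eq_fderiv_fderiv (hF.contDiffAt.of_le ENat.LEInfty.out), mul_add]
  have ef : ∀ z, Δ f z * F z = fderiv ℝ (fun w => fderiv ℝ f w 1) z 1 * F z +
      fderiv ℝ (fun w => fderiv ℝ f w Complex.I) z Complex.I * F z := fun z => by
    by_cases hz : z ∈ tsupport F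
    · rw [laplacian_eq_fderiv_fderiv (hf z hz), add_mul]
    · simp [image_eq_zero_of_notMem_tsupport hz]
  simp_rw [eF, ef]
  rw [integral_add, integral_add, key, key]
  · exact integrable_mul_of_continuousAt_tsupport hF.continuous hFs (fun z hz => hf'' z hz _)
  · exact integrable_mul_of_continuousAt_tsupport hF.continuous hFs (fun z hz => hf'' z hz _)
  · exact integrable_mul_of_continuousAt_tsupport (h2 _).continuous (c2 _)
          (fun z hz => (hf z (s2 _ hz)).continuousAt)
  · exact integrable_mul_of_continuousAt_tsupport (h2 _).continuous (c2 _)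
          (fun z hz => (hf z (s2 _ hz)).continuousAt)

theorem integral_harmonic_mul_laplacian {f F : ℂ → ℝ} (hF : ContDiff ℝ ∞ F)
    (hFs : HasCompactSupport F) (hf : InnerProductSpace.HarmonicOnNhd f (tsupport F)) :
    ∫ z, f z * Δ F z = 0 := by
  rw [integral_mul_laplacian_comm hF hFs fun z hz => (hf z hz).1]
  have : ∀ z, Δ f z * F z = 0 := fun z => by
    by_cases hz : z ∈ tsupport F
    · have := (hf z hz).2.self_of_nhds
      simp only [Pi.zero_apply] at this
      simp [this]
    · simp [image_eq_zero_of_notMem_tsupport hz]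
  simp [this]

/-! ### The fundamental solution -/

/-- In polar coordinates the Jacobian turns the singularity into `2 y log y`, which is continuous at
`0`. -/
theorem locallyIntegrable_log_norm_sq : LocallyIntegrable fun z : ℂ => Real.log (‖z‖ ^ 2) := by
  have hb : ∀ r : ℝ, IntegrableOn (fun z : ℂ => Real.log (‖z‖ ^ 2)) (Metric.ball 0 r) := by
    intro r
    rw [integrableOn_fun_norm_addHaar volume (f := fun x => Real.log (x ^ 2))]
    have hc : Continuous fun y : ℝ => y * Real.log y := Real.continuous_mul_log
    refine (((hc.const_smul (2 : ℝ)).integrableOn_Icc (a := 0) (b := r)).mono_set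
      Ioo_subset_Icc_self).congr_fun (fun y hy => ?_) measurableSet_Ioo
    simp [Real.log_pow]
    ring
  intro z
  exact ⟨Metric.ball 0 (‖z‖ + 1), Metric.isOpen_ball.mem_nhds (by simp), hb _⟩

theorem integrable_log_norm_sub_sq_mul {g : ℂ → ℝ} (z : ℂ) (hg : Continuous g)
    (hgs : HasCompactSupport g) : Integrable fun ζ => Real.log (‖z - ζ‖ ^ 2) * g ζ := by
  have h : LocallyIntegrable fun ζ : ℂ => Real.log (‖z - ζ‖ ^ 2) := by
    rw [locallyIntegrable_iff]
    intro K hK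
    have h1 := (locallyIntegrable_iff.1 locallyIntegrable_log_norm_sq)
      ((fun ζ => z - ζ) '' K) (hK.image (by fun_prop))
    exact ((MeasurePreserving.integrableOn_image (Measure.measurePreserving_sub_left volume z)
      (MeasurableEquiv.subLeft z).measurableEmbedding).1 h1)
  simpa [mul_comm] using h.integrable_smul_left_of_hasCompactSupport hg hgs

/-- The integrand is `1 / 4π` times the Laplacian of `log (|z|² + 1)`: the profile of the
approximate identity. -/
theorem integral_inv_one_add_norm_sq_sq :
    ∫ z : ℂ, 1 / (Real.pi * (1 + ‖z‖ ^ 2) ^ 2) = 1 := by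
  rw [integral_fun_norm_addHaar volume (fun x : ℝ => 1 / (Real.pi * (1 + x ^ 2) ^ 2))]
  have hd : ∀ x ∈ Ici (0:ℝ), HasDerivAt (fun x : ℝ => -(1 / (2 * Real.pi)) * (1 + x ^ 2)⁻¹)
      (x * (1 / (Real.pi * (1 + x ^ 2) ^ 2))) x := by
    intro x _
    have h : HasDerivAt (fun x : ℝ => 1 + x ^ 2) (2 * x) x := by
      simpa using (hasDerivAt_pow 2 x).const_add 1
    have hne : 1 + x ^ 2 ≠ 0 := by positivity
    convert! (h.fun_inv hne).const_mul (-(1 / (2 * Real.pi))) using 1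
    have := Real.pi_ne_zero
    field_simp
  have ht : Tendsto (fun x : ℝ => -(1 / (2 * Real.pi)) * (1 + x ^ 2)⁻¹) atTop (𝓝 0) := by
    have : Tendsto (fun x : ℝ => (1 + x ^ 2)) atTop atTop :=
      tendsto_atTop_add_const_left _ _ (tendsto_pow_atTop (by norm_num))
    simpa using this.inv_tendsto_atTop.const_mul (-(1 / (2 * Real.pi)))
  have hI := integral_Ioi_of_hasDerivAt_of_nonneg' hd
    (fun x hx => mul_nonneg (le_of_lt hx) (by positivity)) ht
  have hv : (volume : Measure ℂ).real (Metric.ball 0 1) = Real.pi := by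
    simp [Measure.real, Complex.volume_ball]
  simp only [Complex.finrank_real_complex, smul_eq_mul, hv]
  norm_num at hI ⊢
  rw [hI]
  have := Real.pi_ne_zero
  field_simp

/-- A bound uniform in `ε`, used to dominate the regularised kernels as `ε → 0`. -/
theorem abs_log_add_le {x ε : ℝ} (hx : 0 < x) (hε : 0 ≤ ε) (hε1 : ε ≤ 1) :
    |Real.log (x + ε)| ≤ |Real.log x| + Real.log (1 + x) := by
  have h1 : Real.log x ≤ Real.log (x + ε) := Real.log_le_log hx (by linarith)
  have h2 : Real.log (x + ε) ≤ Real.log (1 + x) := Real.log_le_log (by linarith) (by linarith)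
  have h3 : 0 ≤ Real.log (1 + x) := Real.log_nonneg (by linarith)
  rw [abs_le]
  constructor
  · linarith [neg_abs_le (Real.log x)]
  · linarith [abs_nonneg (Real.log x)]

theorem tendsto_log_add_inv_sq (x : ℝ) (hx : 0 < x) :
    Tendsto (fun c : ℝ => Real.log (x + (c ^ 2)⁻¹)) atTop (𝓝 (Real.log x)) := by
  have h : Tendsto (fun c : ℝ => x + (c ^ 2)⁻¹) atTop (𝓝 (x + 0)) :=
    (tendsto_inv_atTop_zero.comp (tendsto_pow_atTop (by norm_num))).const_add x
  rw [add_zero] at h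
  exact h.log hx.ne'

theorem ae_norm_sub_sq_pos (z : ℂ) : ∀ᵐ ζ : ℂ, 0 < ‖z - ζ‖ ^ 2 := by
  have : ∀ᵐ ζ : ℂ, ζ ≠ z := by simp [ae_iff, measure_singleton]
  filter_upwards [this] with ζ hζ
  have : 0 < ‖z - ζ‖ := norm_pos_iff.2 (sub_ne_zero.2 hζ.symm)
  positivity

/-- `log |z|²` is `4π` times the fundamental solution of the Laplacian. -/
theorem integral_log_norm_sub_sq_mul_laplacian {F : ℂ → ℝ} (hF : ContDiff ℝ ∞ F)
    (hFs : HasCompactSupport F) (z : ℂ) :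
    ∫ ζ, Real.log (‖z - ζ‖ ^ 2) * Δ F ζ = 4 * Real.pi * F z := by
  have hL := (contDiff_laplacian hF).continuous
  have hLs := hasCompactSupport_laplacian hFs
  have lim1 : Tendsto (fun c : ℝ => ∫ ζ, Real.log (‖z - ζ‖ ^ 2 + (c ^ 2)⁻¹) * Δ F ζ) atTop
      (𝓝 (∫ ζ, Real.log (‖z - ζ‖ ^ 2) * Δ F ζ)) := by
    refine tendsto_integral_filter_of_dominated_convergence
      (fun ζ => |Real.log (‖z - ζ‖ ^ 2) * Δ F ζ| + |Real.log (1 + ‖z - ζ‖ ^ 2) * Δ F ζ|) ?_ ?_ ?_ ?_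
    · filter_upwards with c
      exact ((by fun_prop : Measurable fun ζ : ℂ => Real.log (‖z - ζ‖ ^ 2 + (c ^ 2)⁻¹)).mul
        hL.measurable).aestronglyMeasurable
    · filter_upwards [eventually_ge_atTop (1 : ℝ)] with c hc
      filter_upwards [ae_norm_sub_sq_pos z] with ζ hζ
      rw [norm_mul, abs_mul, abs_mul, ← add_mul, Real.norm_eq_abs, Real.norm_eq_abs]
      gcongr
      refine (abs_log_add_le hζ (by positivity) (inv_le_one_of_one_le₀ (one_le_pow₀ hc))).trans ?_
      gcongr
      exact le_abs_self _
    · refine (integrable_log_norm_sub_sq_mul z hL hLs).abs.add (Integrable.abs ?_)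
      refine integrable_mul_of_continuousAt_tsupport hL hLs fun ζ _ => ?_
      refine ContinuousAt.log (by fun_prop) (by positivity)
    · filter_upwards [ae_norm_sub_sq_pos z] with ζ hζ
      exact (tendsto_log_add_inv_sq _ hζ).mul_const _
  -- Green's identity moves the Laplacian onto the kernel; with `ε = c⁻²` the result is `4π` times
  -- the `L¹`-normalised dilation by `c` of the profile, so the integrals converge to `4π F z`.
  have lim2 : Tendsto (fun c : ℝ => ∫ ζ, Real.log (‖z - ζ‖ ^ 2 + (c ^ 2)⁻¹) * Δ F ζ) atTop
      (𝓝 (4 * Real.pi * F z)) := by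
    have hp := tendsto_integral_comp_smul_smul_of_integrable' (μ := (volume : Measure ℂ))
      (φ := fun x : ℂ => 1 / (Real.pi * (1 + ‖x‖ ^ 2) ^ 2)) (fun x => by positivity)
      integral_inv_one_add_norm_sq_sq ?_ (g := F) (x₀ := z)
      (hF.continuous.integrable_of_hasCompactSupport hFs) hF.continuous.continuousAt
    · refine (hp.const_mul (4 * Real.pi)).congr' ?_
      filter_upwards [eventually_gt_atTop (0 : ℝ)] with c hc
      rw [integral_mul_laplacian_comm hF hFs fun ζ _ =>
        (contDiff_log_norm_sub_sq_add z (by positivity) (n := 2)).contDiffAt,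
        ← integral_const_mul]
      refine integral_congr_ae (Eventually.of_forall fun ζ => ?_)
      simp only
      rw [laplacian_log_norm_sub_sq_add z (by positivity)]
      simp only [Complex.finrank_real_complex, norm_smul, Real.norm_eq_abs, abs_of_pos hc,
        smul_eq_mul]
      have : ‖z - ζ‖ ^ 2 + (c ^ 2)⁻¹ = (1 + (c * ‖z - ζ‖) ^ 2) / c ^ 2 := by
        field_simp
        ring
      rw [this]
      have := Real.pi_ne_zero
      field_simp
    · have h1 : Tendsto (fun x : ℂ => (Real.pi * ‖x‖ ^ 2)⁻¹) (Bornology.cobounded ℂ) (𝓝 0) := by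
        refine Tendsto.inv_tendsto_atTop ?_
        exact ((tendsto_pow_atTop (by norm_num)).comp
          tendsto_norm_cobounded_atTop).const_mul_atTop Real.pi_pos
      refine squeeze_zero (fun x => by positivity) (fun x => ?_) h1
      rw [Complex.finrank_real_complex]
      by_cases hx : ‖x‖ = 0
      · simp [hx]
      · have : 0 < ‖x‖ := lt_of_le_of_ne (norm_nonneg _) (Ne.symm hx)
        rw [mul_one_div, div_le_iff₀ (by positivity), inv_mul_eq_div, le_div_iff₀ (by positivity)]
        have := Real.pi_pos
        nlinarith [sq_nonneg (‖x‖ ^ 2), mul_pos this (pow_pos ‹0 < ‖x‖› 2)]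
  exact tendsto_nhds_unique lim1 lim2

/-! ### Logarithmic potentials -/

/-- Non-negative, locally bounded densities with finite logarithmic potential. -/
structure IsLogDensity (m : ℂ → ℝ) : Prop where
  measurable : Measurable m
  nonneg : ∀ z, 0 ≤ m z
  locally_bounded : ∀ R : ℝ, ∃ C, ∀ z ∈ Metric.closedBall (0 : ℂ) R, m z ≤ C
  integrable_log : ∀ z : ℂ, Integrable fun ζ : ℂ => Real.log (‖z - ζ‖ ^ 2) * m ζ

/-- The logarithmic potential of the measure with density `m`. -/
noncomputable def logPotential (m : ℂ → ℝ) (z : ℂ) : ℝ :=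
  ∫ ζ : ℂ, Real.log (‖z - ζ‖ ^ 2) * m ζ

theorem IsLogDensity.mono {m m' : ℂ → ℝ} (hm : IsLogDensity m) (hmeas : Measurable m')
    (h0 : ∀ z, 0 ≤ m' z) (hle : ∀ z, m' z ≤ m z) : IsLogDensity m' where
  measurable := hmeas
  nonneg := h0
  locally_bounded R := by
    obtain ⟨C, hC⟩ := hm.locally_bounded R
    exact ⟨C, fun z hz => (hle z).trans (hC z hz)⟩
  integrable_log z := by
    refine (hm.integrable_log z).mono ?_ (Eventually.of_forall fun ζ => ?_)
    · exact ((by fun_prop : Measurable fun ζ : ℂ => Real.log (‖z - ζ‖ ^ 2)).mul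
        hmeas).aestronglyMeasurable
    · rw [norm_mul, norm_mul, Real.norm_of_nonneg (h0 ζ), Real.norm_of_nonneg (hm.nonneg ζ)]
      gcongr
      exact hle ζ

theorem IsLogDensity.indicator {m : ℂ → ℝ} (hm : IsLogDensity m) {S : Set ℂ}
    (hS : MeasurableSet S) : IsLogDensity (S.indicator m) :=
  hm.mono (hm.measurable.indicator hS) (fun z => indicator_nonneg (fun x _ => hm.nonneg x) z)
    (fun z => indicator_le_self' (fun x _ => hm.nonneg x) z)

theorem IsLogDensity.exists_bound {m : ℂ → ℝ} (hm : IsLogDensity m) (c : ℂ) (R : ℝ) :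
    ∃ C, 0 ≤ C ∧ ∀ z ∈ Metric.ball c R, m z ≤ C := by
  obtain ⟨C, hC⟩ := hm.locally_bounded (‖c‖ + R)
  refine ⟨max C 0, le_max_right _ _, fun z hz => (hC z ?_).trans (le_max_left _ _)⟩
  rw [mem_closedBall_zero_iff]
  rw [mem_ball_iff_norm] at hz
  have := norm_sub_norm_le z c
  linarith

/-- Near the origin `m` is bounded; for `|ζ| ≥ 2` one has `log |ζ|² ≥ log 4 > 1`, so `m` is
dominated by the integrand of its potential at `0`. -/
theorem IsLogDensity.integrable {m : ℂ → ℝ} (hm : IsLogDensity m) : Integrable m := by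
  obtain ⟨C, hC0, hC⟩ := hm.exists_bound 0 2
  have h1 : IntegrableOn m (Metric.ball 0 2) :=
    Measure.integrableOn_of_bounded (M := C) measure_ball_lt_top.ne
      hm.measurable.aestronglyMeasurable (by
        filter_upwards [ae_restrict_mem Metric.isOpen_ball.measurableSet] with z hz
        rw [Real.norm_of_nonneg (hm.nonneg z)]
        exact hC z hz)
  have h2 : IntegrableOn m (Metric.ball 0 2)ᶜ := by
    refine Integrable.mono (hm.integrable_log 0).integrableOn hm.measurable.aestronglyMeasurable ?_
    filter_upwards [ae_restrict_mem Metric.isOpen_ball.measurableSet.compl] with z hz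
    have hz : 2 ≤ ‖z‖ := by simpa using hz
    rw [norm_mul]
    refine le_mul_of_one_le_left (norm_nonneg _) ?_
    rw [zero_sub, norm_neg]
    refine le_trans ?_ (le_abs_self _)
    rw [Real.le_log_iff_exp_le (by positivity)]
    have := Real.exp_one_lt_d9
    nlinarith
  simpa using h1.union h2

/-- The convolution of an integrable function and a bounded integrable one is continuous. -/
theorem continuous_integral_sub_mul_of_bounded {k m : ℂ → ℝ} (hk : Integrable k)
    (hm : Integrable m) {C : ℝ} (hC : ∀ z, |m z| ≤ C) :
    Continuous fun z => ∫ ζ, k (z - ζ) * m ζ := by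
  have hC0 : 0 ≤ C := (abs_nonneg _).trans (hC 0)
  refine continuous_of_uniform_approx_of_continuous fun u hu => ?_
  obtain ⟨ε, hε, hεu⟩ := Metric.mem_uniformity_dist.1 hu
  -- An `L¹` approximation of the kernel by a compactly supported continuous one changes the
  -- convolution uniformly by at most `C` times the error; `C + 1` avoids dividing by zero.
  obtain ⟨g, hgs, hgle, hgc, hgi⟩ :=
    hk.exists_hasCompactSupport_integral_sub_le (ε := ε / (2 * (C + 1))) (by positivity)
  have hi : ∀ {q : ℂ → ℝ}, Integrable q → ∀ z, Integrable fun ζ => q (z - ζ) * m ζ := by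
    intro q hq z
    exact (hq.comp_sub_left z).mul_bdd (c := C) hm.aestronglyMeasurable
      (Eventually.of_forall hC)
  refine ⟨fun z => ∫ ζ, g (z - ζ) * m ζ, ?_, fun z => hεu ?_⟩
  · have := hgs.continuous_convolution_right (ContinuousLinearMap.mul ℝ ℝ)
      hm.locallyIntegrable hgc
    refine this.congr fun z => ?_
    simp [convolution_def, mul_comm]
  · rw [Real.dist_eq, ← integral_sub (hi hk z) (hi hgi z)]
    calc |∫ ζ, k (z - ζ) * m ζ - g (z - ζ) * m ζ|
        ≤ ∫ ζ, |k (z - ζ) * m ζ - g (z - ζ) * m ζ| := abs_integral_le_integral_abs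
      _ ≤ ∫ ζ, ‖k (z - ζ) - g (z - ζ)‖ * C := by
        refine integral_mono ((hi hk z).sub (hi hgi z)).abs ?_ fun ζ => ?_
        · exact (((hk.sub hgi).norm).comp_sub_left z).mul_const C
        · rw [← sub_mul, abs_mul, Real.norm_eq_abs]
          gcongr
          exact hC ζ
      _ = (∫ ζ, ‖k ζ - g ζ‖) * C := by
        rw [integral_mul_const, integral_sub_left_eq_self (fun ζ => ‖k ζ - g ζ‖) volume z]
      _ ≤ ε / (2 * (C + 1)) * C := by gcongr
      _ < ε := by
        rw [div_mul_eq_mul_div, div_lt_iff₀ (by positivity)]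
        nlinarith

/-- The mass is split at distance `2` from the point. The near part is an integrable kernel
convolved with a bounded density, the far part is handled by dominated convergence. A general `k` is
allowed so that both `log` and `|log|` are covered. -/
theorem IsLogDensity.continuous_integral_kernel {m k : ℂ → ℝ} (hm : IsLogDensity m)
    (hk : Measurable k) (hkc : ∀ z ≠ 0, ContinuousAt k z)
    (hkb : ∀ z, |k z| ≤ |Real.log (‖z‖ ^ 2)|) :
    Continuous fun z => ∫ ζ, k (z - ζ) * m ζ := by
  have hint : ∀ {m' : ℂ → ℝ}, IsLogDensity m' → ∀ z, Integrable fun ζ => k (z - ζ) * m' ζ := by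
    intro m' hm' z
    refine (hm'.integrable_log z).mono ?_ (Eventually.of_forall fun ζ => ?_)
    · exact ((hk.comp (by fun_prop)).mul hm'.measurable).aestronglyMeasurable
    · rw [norm_mul, norm_mul]
      gcongr
      exact hkb _
  rw [continuous_iff_continuousAt]
  intro z₀
  have hB : MeasurableSet (Metric.ball z₀ 2) := Metric.isOpen_ball.measurableSet
  set m₁ := (Metric.ball z₀ 2).indicator m with hm₁
  set m₂ := (Metric.ball z₀ 2)ᶜ.indicator m with hm₂
  have d₁ : IsLogDensity m₁ := hm.indicator hB
  have d₂ : IsLogDensity m₂ := hm.indicator hB.compl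
  have hsplit : (fun z => ∫ ζ, k (z - ζ) * m ζ) =
      fun z => (∫ ζ, k (z - ζ) * m₁ ζ) + ∫ ζ, k (z - ζ) * m₂ ζ := by
    ext z
    rw [← integral_add (hint d₁ z) (hint d₂ z)]
    congr 1
    ext ζ
    rw [← mul_add, hm₁, hm₂, indicator_self_add_compl_apply]
  rw [hsplit]
  refine ContinuousAt.add ?_ ?_
  -- Truncating the kernel at radius `3 = 1 + 2` changes nothing for `z` within `1` and `ζ` within
  -- `2` of `z₀`.
  · set k₁ := (Metric.ball (0 : ℂ) 3).indicator k with hk₁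
    have hk₁i : Integrable k₁ := by
      rw [hk₁, integrable_indicator_iff Metric.isOpen_ball.measurableSet]
      have := (locallyIntegrable_iff.1 locallyIntegrable_log_norm_sq)
        (Metric.closedBall 0 3) (isCompact_closedBall _ _)
      exact Integrable.mono (this.mono_set Metric.ball_subset_closedBall) hk.aestronglyMeasurable
        (Eventually.of_forall hkb)
    obtain ⟨C, hC0, hC⟩ := hm.exists_bound z₀ 2
    have hc := continuous_integral_sub_mul_of_bounded hk₁i d₁.integrable (C := C) (fun z => by
      rw [abs_of_nonneg (d₁.nonneg z), hm₁]
      by_cases hz : z ∈ Metric.ball z₀ 2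
      · rw [indicator_of_mem hz]; exact hC z hz
      · rw [indicator_of_notMem hz]; exact hC0)
    refine hc.continuousAt.congr ?_
    filter_upwards [Metric.ball_mem_nhds z₀ one_pos] with z hz
    congr 1
    ext ζ
    by_cases hζ : ζ ∈ Metric.ball z₀ 2
    · rw [hk₁, indicator_of_mem]
      rw [Metric.mem_ball, dist_eq_norm, sub_zero, ← dist_eq_norm]
      rw [Metric.mem_ball] at hz hζ
      linarith [dist_triangle_right z ζ z₀]
    · simp [hm₁, indicator_of_notMem hζ]
  -- For far `ζ` and `|z - z₀| < 1` one has `1 ≤ |z - ζ| ≤ |z₀ - ζ|²`, so the logarithm at most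
  -- doubles.
  · refine continuousAt_of_dominated (bound := fun ζ => 2 * |Real.log (‖z₀ - ζ‖ ^ 2) * m ζ|)
      ?_ ?_ ?_ ?_
    · exact Eventually.of_forall fun z => (hint d₂ z).aestronglyMeasurable
    · filter_upwards [Metric.ball_mem_nhds z₀ one_pos] with z hz
      refine Eventually.of_forall fun ζ => ?_
      by_cases hζ : ζ ∈ (Metric.ball z₀ 2)ᶜ
      · rw [hm₂, indicator_of_mem hζ, norm_mul, abs_mul, ← mul_assoc, Real.norm_eq_abs,
          Real.norm_eq_abs]
        gcongr
        refine (hkb _).trans ?_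
        have ha : 2 ≤ ‖z₀ - ζ‖ := by
          simpa [dist_eq_norm, norm_sub_rev] using hζ
        rw [Metric.mem_ball, dist_eq_norm] at hz
        have hx1 : 1 ≤ ‖z - ζ‖ := by
          have := norm_sub_le_norm_sub_add_norm_sub z₀ z ζ
          rw [norm_sub_rev z₀ z] at this
          linarith
        have hx2 : ‖z - ζ‖ ≤ ‖z₀ - ζ‖ ^ 2 := by
          have := norm_sub_le_norm_sub_add_norm_sub z z₀ ζ
          nlinarith
        rw [abs_of_nonneg (Real.log_nonneg (one_le_pow₀ hx1)),
          abs_of_nonneg (Real.log_nonneg (one_le_pow₀ (by linarith))), Real.log_pow]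
        push_cast
        gcongr
      · rw [hm₂, indicator_of_notMem hζ, mul_zero, norm_zero]
        positivity
    · exact (hm.integrable_log z₀).abs.const_mul 2
    · refine Eventually.of_forall fun ζ => ?_
      by_cases hζ : ζ ∈ (Metric.ball z₀ 2)ᶜ
      · refine ContinuousAt.mul ?_ continuousAt_const
        refine ContinuousAt.comp (g := k) (hkc _ ?_) (by fun_prop)
        rintro h
        rw [sub_eq_zero] at h
        simp [← h] at hζ
      · rw [hm₂, indicator_of_notMem hζ]
        simp only [mul_zero]
        exact continuousAt_const

theorem continuousAt_log_norm_sq {z : ℂ} (hz : z ≠ 0) :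
    ContinuousAt (fun z : ℂ => Real.log (‖z‖ ^ 2)) z :=
  ContinuousAt.log (by fun_prop) (by simpa using hz)

theorem IsLogDensity.continuous_logPotential {m : ℂ → ℝ} (hm : IsLogDensity m) :
    Continuous (logPotential m) :=
  hm.continuous_integral_kernel (k := fun z => Real.log (‖z‖ ^ 2)) (by fun_prop)
    (fun _ hz => continuousAt_log_norm_sq hz) fun _ => le_rfl

/-- Justifies Fubini for circle averages of potentials: the potential of the absolute kernel is
continuous, hence integrable over the circle. -/
theorem IsLogDensity.integrable_prod_circle {m : ℂ → ℝ} (hm : IsLogDensity m) (c : ℂ) (R : ℝ) :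
    Integrable (fun p : ℝ × ℂ => Real.log (‖circleMap c R p.1 - p.2‖ ^ 2) * m p.2)
      ((volume.restrict (Ioc 0 (2 * Real.pi))).prod volume) := by
  have hmeas : Measurable fun p : ℝ × ℂ => Real.log (‖circleMap c R p.1 - p.2‖ ^ 2) * m p.2 := by
    have h1 : Measurable fun p : ℝ × ℂ => circleMap c R p.1 :=
      (continuous_circleMap c R).measurable.comp measurable_fst
    exact ((Real.measurable_log.comp ((h1.sub measurable_snd).norm.pow_const 2))).mul
      (hm.measurable.comp measurable_snd)
  rw [integrable_prod_iff hmeas.aestronglyMeasurable]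
  refine ⟨Eventually.of_forall fun θ => hm.integrable_log (circleMap c R θ), ?_⟩
  have hc : Continuous fun z => ∫ ζ, |Real.log (‖z - ζ‖ ^ 2)| * m ζ :=
    hm.continuous_integral_kernel (k := fun z => |Real.log (‖z‖ ^ 2)|) (by fun_prop)
      (fun z hz => (continuousAt_log_norm_sq hz).abs) (fun z => (abs_abs _).le)
  have e : (fun θ : ℝ => ∫ ζ : ℂ, ‖Real.log (‖circleMap c R θ - ζ‖ ^ 2) * m ζ‖) =
      fun θ => (fun z => ∫ ζ, |Real.log (‖z - ζ‖ ^ 2)| * m ζ) (circleMap c R θ) := by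
    ext θ
    refine integral_congr_ae (Eventually.of_forall fun ζ => ?_)
    simp only
    rw [norm_mul, Real.norm_eq_abs, Real.norm_of_nonneg (hm.nonneg ζ)]
  rw [e]
  generalize (fun z => ∫ ζ, |Real.log (‖z - ζ‖ ^ 2)| * m ζ) = q at hc
  exact (hc.comp (continuous_circleMap c R)).integrableOn_Ioc

/-- The average is explicit: `2 (log R + log⁺ (|c - ζ| / R))`. The case `c = ζ` is excluded because
`Real.log 0 = 0` would replace the value `-∞`. -/
theorem log_norm_sub_sq_le_circleAverage {c ζ : ℂ} (hne : c ≠ ζ) {R : ℝ} (hR : 0 < R) :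
    Real.log (‖c - ζ‖ ^ 2) ≤ Real.circleAverage (fun z => Real.log (‖z - ζ‖ ^ 2)) c R := by
  have h := circleAverage_log_norm_sub_const_eq_log_radius_add_posLog (a := ζ) (c := c) hR.ne'
  have h2 : (fun z : ℂ => Real.log (‖z - ζ‖ ^ 2)) =
      fun z => (2 : ℝ) • Real.log ‖z - ζ‖ := by
    ext z; simp [Real.log_pow]
  rw [h2, Real.circleAverage_fun_smul, h, Real.log_pow, smul_eq_mul]
  push_cast
  gcongr
  have hpos : 0 < ‖c - ζ‖ := norm_pos_iff.2 (sub_ne_zero.2 hne)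
  have h3 : Real.log (R⁻¹ * ‖c - ζ‖) ≤ Real.posLog (R⁻¹ * ‖c - ζ‖) := le_max_right _ _
  rw [Real.log_mul (by positivity) hpos.ne', Real.log_inv] at h3
  linarith

theorem IsLogDensity.logPotential_le_circleAverage {m : ℂ → ℝ} (hm : IsLogDensity m) (c : ℂ)
    {R : ℝ} (hR : 0 < R) :
    logPotential m c ≤ Real.circleAverage (logPotential m) c R := by
  have hp := hm.integrable_prod_circle c R
  have h1 : Real.circleAverage (logPotential m) c R =
      ∫ ζ, Real.circleAverage (fun z => Real.log (‖z - ζ‖ ^ 2)) c R * m ζ := by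
    simp only [Real.circleAverage, logPotential, smul_eq_mul]
    rw [intervalIntegral.integral_of_le Real.two_pi_pos.le, integral_integral_swap hp,
      ← integral_const_mul]
    congr 1
    ext ζ
    rw [intervalIntegral.integral_of_le Real.two_pi_pos.le, mul_assoc, integral_mul_const]
  rw [h1]
  refine integral_mono_ae (hm.integrable_log c) ?_ ?_
  · have := (hp.integral_prod_right).const_mul (2 * Real.pi)⁻¹
    refine this.congr (Eventually.of_forall fun ζ => ?_)
    simp only [Real.circleAverage, smul_eq_mul]
    rw [intervalIntegral.integral_of_le Real.two_pi_pos.le, mul_assoc, integral_mul_const]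
  · have : ∀ᵐ ζ : ℂ, ζ ≠ c := by simp [ae_iff, measure_singleton]
    filter_upwards [this] with ζ hζ
    exact mul_le_mul_of_nonneg_right (log_norm_sub_sq_le_circleAverage hζ.symm hR) (hm.nonneg ζ)

/-- Near `z₀` the kernel is `log |z₀ - ζ|² + 2 Re Log (1 + (z - z₀) / (z₀ - ζ))` where `m ζ ≠ 0`, so
the potential is a constant plus the real part of a holomorphic integral. -/
theorem IsLogDensity.harmonicOnNhd_logPotential {m : ℂ → ℝ} (hm : IsLogDensity m) {O : Set ℂ}
    (hO : IsOpen O) (h0 : ∀ z ∈ O, m z = 0) :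
    InnerProductSpace.HarmonicOnNhd (logPotential m) O := by
  intro z₀ hz₀
  obtain ⟨r, hr, hrO⟩ := Metric.isOpen_iff.1 hO z₀ hz₀
  have hfar : ∀ ζ, m ζ ≠ 0 → r ≤ ‖z₀ - ζ‖ := by
    intro ζ hζ
    by_contra! h
    exact hζ (h0 ζ (hrO (by rwa [mem_ball_iff_norm, norm_sub_rev])))
  -- The bound `1 / 2` keeps the argument in the slit plane and makes `|Log|` at most `3 / 4`, so
  -- `m` itself dominates.
  have hw : ∀ z ∈ Metric.ball z₀ (r / 2), ∀ ζ, m ζ ≠ 0 → ‖(z - z₀) / (z₀ - ζ)‖ ≤ 1 / 2 := by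
    intro z hz ζ hζ
    have h1 := hfar ζ hζ
    rw [mem_ball_iff_norm] at hz
    rw [norm_div, div_le_iff₀ (by linarith)]
    linarith
  set Φ : ℂ → ℂ := fun z => ∫ ζ, Complex.log (1 + (z - z₀) / (z₀ - ζ)) * (m ζ : ℂ) with hΦ
  have hmc : Measurable fun ζ => (m ζ : ℂ) := Complex.measurable_ofReal.comp hm.measurable
  have hmeas : ∀ z, AEStronglyMeasurable
      (fun ζ => Complex.log (1 + (z - z₀) / (z₀ - ζ)) * (m ζ : ℂ)) volume := fun z => by
    have : Measurable fun ζ : ℂ => Complex.log (1 + (z - z₀) / (z₀ - ζ)) := by fun_prop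
    exact (this.mul hmc).aestronglyMeasurable
  have hint : ∀ z ∈ Metric.ball z₀ (r / 2),
      Integrable fun ζ => Complex.log (1 + (z - z₀) / (z₀ - ζ)) * (m ζ : ℂ) := by
    intro z hz
    refine hm.integrable.mono (hmeas z) (Eventually.of_forall fun ζ => ?_)
    by_cases hζ : m ζ = 0
    · simp [hζ]
    · rw [norm_mul, Complex.norm_real]
      refine mul_le_of_le_one_left (norm_nonneg _) ?_
      have := hw z hz ζ hζ
      refine (Complex.norm_log_one_add_half_le_self this).trans ?_
      linarith
  have hderiv : ∀ z ∈ Metric.ball z₀ (r / 2), DifferentiableAt ℂ Φ z := by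
    intro z hz
    refine (hasDerivAt_integral_of_dominated_loc_of_deriv_le (𝕜 := ℂ)
      (F' := fun z ζ => (z - ζ)⁻¹ * (m ζ : ℂ)) (bound := fun ζ => 2 / r * m ζ)
      (Metric.isOpen_ball.mem_nhds hz) (Eventually.of_forall hmeas) (hint z hz) ?_ ?_ ?_
      ?_).2.differentiableAt
    · exact ((by fun_prop : Measurable fun ζ : ℂ => (z - ζ)⁻¹).mul hmc).aestronglyMeasurable
    · refine Eventually.of_forall fun ζ w hw' => ?_
      by_cases hζ : m ζ = 0
      · simp [hζ]
      · rw [norm_mul, Complex.norm_real, Real.norm_of_nonneg (hm.nonneg ζ), norm_inv]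
        have h1 := hfar ζ hζ
        rw [mem_ball_iff_norm] at hw'
        have h2 := norm_sub_le_norm_sub_add_norm_sub z₀ w ζ
        rw [norm_sub_rev z₀ w] at h2
        have h3 : r / 2 ≤ ‖w - ζ‖ := by linarith
        have : ‖w - ζ‖⁻¹ ≤ 2 / r := by
          rw [inv_le_comm₀ (by linarith) (by positivity), inv_div]
          exact h3
        exact mul_le_mul_of_nonneg_right this (hm.nonneg ζ)
    · exact hm.integrable.const_mul _
    · refine Eventually.of_forall fun ζ w hw' => ?_
      by_cases hζ : m ζ = 0
      · simp only [hζ, Complex.ofReal_zero, mul_zero]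
        exact hasDerivAt_const _ _
      · have h1 := hfar ζ hζ
        have hne : z₀ - ζ ≠ 0 := norm_pos_iff.1 (by linarith)
        have hlt := hw w hw' ζ hζ
        have hs : 1 + (w - z₀) / (z₀ - ζ) ∈ Complex.slitPlane :=
          Complex.mem_slitPlane_of_norm_lt_one (by linarith)
        have hd : HasDerivAt (fun w : ℂ => 1 + (w - z₀) / (z₀ - ζ)) (1 / (z₀ - ζ)) w :=
          (((hasDerivAt_id w).sub_const z₀).div_const _).const_add 1
        convert! (hd.clog hs).mul_const (m ζ : ℂ) using 1
        have hne' : 1 + (w - z₀) / (z₀ - ζ) ≠ 0 := Complex.slitPlane_ne_zero hs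
        have e : w - ζ = (z₀ - ζ) * (1 + (w - z₀) / (z₀ - ζ)) := by
          field_simp
          ring
        rw [e]
        congr 1
        rw [mul_inv]
        field_simp
  have han : AnalyticAt ℂ Φ z₀ := by
    refine DifferentiableOn.analyticAt (s := Metric.ball z₀ (r / 2))
      (fun z hz => (hderiv z hz).differentiableWithinAt) (Metric.ball_mem_nhds _ (by positivity))
  have heq : logPotential m =ᶠ[𝓝 z₀]
      (fun _ => logPotential m z₀) + (2 : ℝ) • fun z => (Φ z).re := by
    filter_upwards [Metric.ball_mem_nhds z₀ (by positivity : 0 < r / 2)] with z hz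
    have hre : (Φ z).re = ∫ ζ, Real.log ‖1 + (z - z₀) / (z₀ - ζ)‖ * m ζ := by
      rw [hΦ]
      have := Complex.reCLM.integral_comp_comm (hint z hz)
      simp only [Complex.reCLM_apply, Complex.re_mul_ofReal, Complex.log_re] at this
      exact this.symm
    have hi : Integrable fun ζ => Real.log ‖1 + (z - z₀) / (z₀ - ζ)‖ * m ζ := by
      have := Complex.reCLM.integrable_comp (hint z hz)
      simpa only [Complex.reCLM_apply, Complex.re_mul_ofReal, Complex.log_re] using this
    simp only [Pi.add_apply, Pi.smul_apply, smul_eq_mul, hre]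
    rw [logPotential, logPotential, ← integral_const_mul, ← integral_add (hm.integrable_log z₀)
      (hi.const_mul 2)]
    congr 1
    ext ζ
    by_cases hζ : m ζ = 0
    · simp [hζ]
    · have h1 := hfar ζ hζ
      have hne : z₀ - ζ ≠ 0 := norm_pos_iff.1 (by linarith)
      have hlt := hw z hz ζ hζ
      have hs : 1 + (z - z₀) / (z₀ - ζ) ∈ Complex.slitPlane :=
        Complex.mem_slitPlane_of_norm_lt_one (by linarith)
      have hne' : 1 + (z - z₀) / (z₀ - ζ) ≠ 0 := Complex.slitPlane_ne_zero hs
      have e : z - ζ = (z₀ - ζ) * (1 + (z - z₀) / (z₀ - ζ)) := by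
        field_simp
        ring
      rw [e, norm_mul, Real.log_pow, Real.log_pow, Real.log_mul (norm_ne_zero_iff.2 hne)
        (norm_ne_zero_iff.2 hne')]
      push_cast
      ring
  rw [InnerProductSpace.harmonicAt_congr_nhds heq]
  exact (InnerProductSpace.harmonicAt_const _).add (han.harmonicAt_re.const_smul)

/-! ### Potentials of smooth densities -/

theorem logPotential_eq_convolution (G : ℂ → ℝ) :
    logPotential G = convolution (fun z : ℂ => Real.log (‖z‖ ^ 2)) G
      (ContinuousLinearMap.mul ℝ ℝ) volume := by
  ext z
  rw [convolution_def, logPotential,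
    ← integral_sub_left_eq_self (fun ζ => Real.log (‖z - ζ‖ ^ 2) * G ζ) volume z]
  simp

theorem contDiff_logPotential_of_hasCompactSupport {G : ℂ → ℝ} (hG : ContDiff ℝ ∞ G)
    (hGs : HasCompactSupport G) : ContDiff ℝ ∞ (logPotential G) := by
  rw [logPotential_eq_convolution]
  exact hGs.contDiff_convolution_right _ locallyIntegrable_log_norm_sq (n := ⊤) hG

theorem fderiv_logPotential_of_hasCompactSupport {G : ℂ → ℝ} (hG : ContDiff ℝ ∞ G)
    (hGs : HasCompactSupport G) (z v : ℂ) :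
    fderiv ℝ (logPotential G) z v = logPotential (fun w => fderiv ℝ G w v) z := by
  have hG1 : ContDiff ℝ 1 G := hG.of_le ENat.LEInfty.out
  rw [logPotential_eq_convolution, logPotential_eq_convolution,
    (hGs.hasFDerivAt_convolution_right _ locallyIntegrable_log_norm_sq hG1 z).fderiv,
    convolution_precompR_apply _ locallyIntegrable_log_norm_sq (hGs.fderiv ℝ)
      (hG1.continuous_fderiv one_ne_zero)]

theorem laplacian_logPotential_of_hasCompactSupport {G : ℂ → ℝ} (hG : ContDiff ℝ ∞ G)
    (hGs : HasCompactSupport G) (z : ℂ) :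
    Δ (logPotential G) z = 4 * Real.pi * G z := by
  have h1 : ∀ v : ℂ, ContDiff ℝ ∞ fun w => fderiv ℝ G w v := fun v =>
    (hG.fderiv_right (m := ∞) (by simp)).clm_apply contDiff_const
  have h1s : ∀ v : ℂ, HasCompactSupport fun w => fderiv ℝ G w v := fun v => hGs.fderiv_apply ℝ v
  have h2 : ∀ v : ℂ, ContDiff ℝ ∞ fun w => fderiv ℝ (fun w => fderiv ℝ G w v) w v := fun v =>
    ((h1 v).fderiv_right (m := ∞) (by simp)).clm_apply contDiff_const
  have h2s : ∀ v : ℂ, HasCompactSupport fun w => fderiv ℝ (fun w => fderiv ℝ G w v) w v :=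
    fun v => (h1s v).fderiv_apply ℝ v
  rw [laplacian_eq_fderiv_fderiv ((contDiff_logPotential_of_hasCompactSupport hG hGs).contDiffAt.of_le
    ENat.LEInfty.out)]
  simp_rw [fderiv_logPotential_of_hasCompactSupport hG hGs]
  have e : ∀ v : ℂ, (fun w => logPotential (fun w => fderiv ℝ G w v) w) =
      logPotential (fun w => fderiv ℝ G w v) := fun v => rfl
  rw [e, e, fderiv_logPotential_of_hasCompactSupport (h1 1) (h1s 1),
    fderiv_logPotential_of_hasCompactSupport (h1 Complex.I) (h1s Complex.I),
    ← integral_log_norm_sub_sq_mul_laplacian hG hGs z, logPotential, logPotential,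
    ← integral_add (integrable_log_norm_sub_sq_mul z (h2 _).continuous (h2s _))
      (integrable_log_norm_sub_sq_mul z (h2 _).continuous (h2s _))]
  congr 1
  ext ζ
  rw [laplacian_eq_fderiv_fderiv (hG.contDiffAt.of_le ENat.LEInfty.out), mul_add]

/-- A cutoff splits `m` into a compactly supported smooth part, whose potential is a convolution,
and a part vanishing near `z`, whose potential is harmonic there. -/
theorem IsLogDensity.contDiffAt_logPotential_and_laplacian {m : ℂ → ℝ} (hm : IsLogDensity m)
    (hs : ContDiff ℝ ∞ m) (z : ℂ) :
    ContDiffAt ℝ ∞ (logPotential m) z ∧ Δ (logPotential m) z = 4 * Real.pi * m z := by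
  let χ : ContDiffBump z := ⟨1, 2, one_pos, one_lt_two⟩
  have hG : ContDiff ℝ ∞ fun w => χ w * m w := χ.contDiff.mul hs
  have hGs : HasCompactSupport fun w => χ w * m w := χ.hasCompactSupport.mul_right
  have hm' : IsLogDensity fun w => (1 - χ w) * m w := by
    refine hm.mono ?_ (fun w => mul_nonneg (sub_nonneg.2 χ.le_one) (hm.nonneg w))
      (fun w => mul_le_of_le_one_left (hm.nonneg w) (by linarith [χ.nonneg' w]))
    exact ((measurable_const.sub χ.continuous.measurable).mul hm.measurable)
  have hsum : logPotential m =
      logPotential (fun w => χ w * m w) + logPotential fun w => (1 - χ w) * m w := by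
    ext w
    rw [Pi.add_apply, logPotential, logPotential, logPotential,
      ← integral_add (integrable_log_norm_sub_sq_mul w hG.continuous hGs) (hm'.integrable_log w)]
    congr 1
    ext ζ
    ring
  have hh : InnerProductSpace.HarmonicAt (logPotential fun w => (1 - χ w) * m w) z := by
    refine hm'.harmonicOnNhd_logPotential (O := Metric.ball z 1) Metric.isOpen_ball (fun w hw => ?_)
      z (Metric.mem_ball_self one_pos)
    rw [χ.one_of_mem_closedBall (Metric.ball_subset_closedBall hw)]
    ring
  have hc := contDiff_logPotential_of_hasCompactSupport hG hGs
  rw [hsum]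
  refine ⟨hc.contDiffAt.add (HarmonicAt.analyticAt hh).contDiffAt, ?_⟩
  have hh2 : Δ (logPotential fun w => (1 - χ w) * m w) z = 0 := hh.2.self_of_nhds
  rw [ContDiffAt.laplacian_add (hc.contDiffAt.of_le ENat.LEInfty.out) hh.1, hh2,
    laplacian_logPotential_of_hasCompactSupport hG hGs,
    χ.one_of_mem_closedBall (Metric.mem_closedBall_self χ.rIn_pos.le)]
  ring

/-! ### The maximum principle -/

/-- A function which is continuous on the circle of radius `r`, at most `M` there, and less than
`M` somewhere on it has circle average less than `M`. -/
theorem circleAverage_lt_of_le_of_exists_lt {v : ℂ → ℝ} {c : ℂ} {r M : ℝ} (hr : 0 < r)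
    (hv : ContinuousOn v (Metric.sphere c r)) (hle : ∀ z ∈ Metric.sphere c r, v z ≤ M)
    (hlt : ∃ z ∈ Metric.sphere c r, v z < M) : Real.circleAverage v c r < M := by
  obtain ⟨z, hz, hzM⟩ := hlt
  obtain ⟨θ, hθ, rfl⟩ : ∃ θ ∈ Ioc (0 : ℝ) (2 * Real.pi), circleMap c r θ = z := by
    have := image_circleMap_Ioc c r
    rw [abs_of_pos hr] at this
    rw [← this] at hz
    exact hz
  rw [Real.circleAverage, smul_eq_mul, inv_mul_lt_iff₀ Real.two_pi_pos]
  have h := intervalIntegral.integral_lt_integral_of_continuousOn_of_le_of_exists_lt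
    (f := fun θ => v (circleMap c r θ)) (g := fun _ => M) Real.two_pi_pos ?_ continuousOn_const
    (fun θ _ => hle _ (circleMap_mem_sphere c hr.le θ)) ⟨θ, Ioc_subset_Icc_self hθ, hzM⟩
  · simpa using h
  · exact hv.comp (continuous_circleMap c r).continuousOn
      fun θ _ => circleMap_mem_sphere c hr.le θ

/-- The maximum principle, from a local sub-mean value property at the points where the function
is positive. -/
theorem nonpos_of_submean {K : Set ℂ} (hK : IsCompact K) {v : ℂ → ℝ} (hv : ContinuousOn v K)
    (hsub : ∀ z ∈ interior K, 0 < v z → ∀ᶠ r in 𝓝[>] (0 : ℝ), v z ≤ Real.circleAverage v z r)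
    (hf : ∀ z ∈ frontier K, v z ≤ 0) : ∀ z ∈ K, v z ≤ 0 := by
  by_contra! hcon
  obtain ⟨z₁, hz₁, hpos⟩ := hcon
  obtain ⟨z₀, hz₀, hmax⟩ := hK.exists_isMaxOn ⟨z₁, hz₁⟩ hv
  have hM : 0 < v z₀ := hpos.trans_le (hmax hz₁)
  have hE : IsCompact (K ∩ v ⁻¹' {v z₀}) := by
    refine hK.of_isClosed_subset ?_ inter_subset_left
    exact hv.preimage_isClosed_of_isClosed hK.isClosed isClosed_singleton
  -- Among the maximum points the rightmost is taken: on every small circle about it the point `z₂ +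
  -- r` lies strictly below the maximum, which contradicts the submean inequality without any
  -- connectedness argument.
  obtain ⟨z₂, hz₂, hre⟩ := hE.exists_isMaxOn ⟨z₀, hz₀, rfl⟩ Complex.continuous_re.continuousOn
  have hv₂ : v z₂ = v z₀ := hz₂.2
  have hint : z₂ ∈ interior K := by
    by_contra h
    have := hf z₂ (by rw [hK.isClosed.frontier_eq]; exact ⟨hz₂.1, h⟩)
    linarith
  obtain ⟨ε, hε, hball⟩ := Metric.isOpen_iff.1 isOpen_interior z₂ hint
  obtain ⟨r, ⟨hr1, hr0⟩, hr2⟩ := ((hsub z₂ hint (by rw [hv₂]; exact hM)).and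
    (Ioo_mem_nhdsGT hε)).exists.imp fun r h => (⟨⟨h.1, h.2.1⟩, h.2.2⟩ : (_ ∧ _) ∧ _)
  have hsph : Metric.sphere z₂ r ⊆ K := fun z hz => interior_subset (hball (by
    rw [Metric.mem_ball, Metric.mem_sphere.1 hz]; exact hr2))
  refine absurd hr1 (not_le.2 ?_)
  rw [hv₂]
  refine circleAverage_lt_of_le_of_exists_lt hr0 (hv.mono hsph) (fun z hz => hmax (hsph hz)) ?_
  have hmem : z₂ + (r : ℂ) ∈ Metric.sphere z₂ r := by
    simp [abs_of_pos hr0]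
  refine ⟨z₂ + r, hmem, lt_of_le_of_ne (hmax (hsph hmem)) fun h => ?_⟩
  have : (z₂ + (r : ℂ)).re ≤ z₂.re := hre ⟨hsph hmem, h⟩
  simp at this
  linarith

theorem circleAverage_eq_of_harmonicAt {h : ℂ → ℝ} {z : ℂ}
    (hh : InnerProductSpace.HarmonicAt h z) :
    ∀ᶠ r in 𝓝[>] (0 : ℝ), Real.circleAverage h z r = h z := by
  obtain ⟨ε, hε, hball⟩ := Metric.isOpen_iff.1
    (InnerProductSpace.isOpen_setOfPred_harmonicAt (f := h)) z hh
  filter_upwards [Ioo_mem_nhdsGT hε] with r hr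
  refine InnerProductSpace.HarmonicOnNhd.circleAverage_eq fun w hw => hball ?_
  rw [abs_of_pos hr.1] at hw
  exact lt_of_le_of_lt hw hr.2

/-! ### Graph coordinates near the moving boundary -/

/-- Euclidean coordinates centred at `x₀` with first axis in the direction `u`. -/
noncomputable def boxMap (x₀ u : ℂ) (q : ℝ × ℝ) : ℂ :=
  x₀ + ((q.1 : ℂ) + (q.2 : ℂ) * Complex.I) * u

/-- The open rectangle with half-sides `δ` and `ε` in the coordinates `boxMap x₀ u`. -/
def box (x₀ u : ℂ) (δ ε : ℝ) : Set ℂ :=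
  {z | ((z - x₀) * (starRingEnd ℂ) u).re ∈ Ioo (-δ) δ ∧
    ((z - x₀) * (starRingEnd ℂ) u).im ∈ Ioo (-ε) ε}

theorem isOpen_box (x₀ u : ℂ) (δ ε : ℝ) : IsOpen (box x₀ u δ ε) :=
  (isOpen_Ioo.preimage (by fun_prop)).inter (isOpen_Ioo.preimage (by fun_prop))

theorem mul_conj_of_norm_eq_one {u : ℂ} (hu : ‖u‖ = 1) : u * (starRingEnd ℂ) u = 1 := by
  rw [Complex.mul_conj, Complex.normSq_eq_norm_sq, hu]
  simp

theorem boxMap_sub_mul_conj {x₀ u : ℂ} (hu : ‖u‖ = 1) (q : ℝ × ℝ) :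
    (boxMap x₀ u q - x₀) * (starRingEnd ℂ) u = (q.1 : ℂ) + (q.2 : ℂ) * Complex.I := by
  rw [boxMap, add_sub_cancel_left, mul_assoc, mul_conj_of_norm_eq_one hu, mul_one]

theorem boxMap_mem_box {x₀ u : ℂ} (hu : ‖u‖ = 1) {δ ε : ℝ} {q : ℝ × ℝ} :
    boxMap x₀ u q ∈ box x₀ u δ ε ↔ q.1 ∈ Ioo (-δ) δ ∧ q.2 ∈ Ioo (-ε) ε := by
  simp only [box, mem_ofPred_eq, boxMap_sub_mul_conj hu]
  simp

theorem boxMap_re_im {x₀ u : ℂ} (hu : ‖u‖ = 1) (z : ℂ) :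
    boxMap x₀ u (((z - x₀) * (starRingEnd ℂ) u).re, ((z - x₀) * (starRingEnd ℂ) u).im) = z := by
  rw [boxMap, Complex.re_add_im, mul_assoc, mul_comm _ u, mul_conj_of_norm_eq_one hu]
  ring

theorem exists_boxMap_eq_of_mem_box {x₀ u : ℂ} (hu : ‖u‖ = 1) {δ ε : ℝ} {z : ℂ}
    (hz : z ∈ box x₀ u δ ε) :
    ∃ x ∈ Ioo (-δ) δ, ∃ y ∈ Ioo (-ε) ε, boxMap x₀ u (x, y) = z :=
  ⟨_, hz.1, _, hz.2, boxMap_re_im hu z⟩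

@[fun_prop]
theorem continuous_boxMap (x₀ u : ℂ) : Continuous (boxMap x₀ u) := by
  unfold boxMap
  fun_prop

/-- Near `x₀` and for `t` near `t₀`, the set `Ω t` is the subgraph of `γ (·, t)` in the coordinates
`boxMap x₀ u`. -/
structure IsGraphBox (Ω : ℝ → Set ℂ) (t₀ : ℝ) (x₀ u : ℂ) (γ : ℝ × ℝ → ℝ) (δ ε : ℝ) : Prop where
  norm_eq : ‖u‖ = 1
  delta_pos : 0 < δ
  eps_pos : 0 < ε
  smooth : ContDiffOn ℝ ∞ γ (Ioo (-δ) δ ×ˢ Ioo (t₀ - δ) (t₀ + δ))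
  mem_Ioo : ∀ x ∈ Ioo (-δ) δ, ∀ t ∈ Ioo (t₀ - δ) (t₀ + δ), γ (x, t) ∈ Ioo (-ε) ε
  mem_iff : ∀ x ∈ Ioo (-δ) δ, ∀ y ∈ Ioo (-ε) ε, ∀ t ∈ Ioo (t₀ - δ) (t₀ + δ),
    (boxMap x₀ u (x, y) ∈ Ω t ↔ y < γ (x, t))

namespace IsGraphBox

variable {Ω : ℝ → Set ℂ} {t₀ : ℝ} {x₀ u : ℂ} {γ : ℝ × ℝ → ℝ} {δ ε : ℝ}

theorem contDiffAt (h : IsGraphBox Ω t₀ x₀ u γ δ ε) {x t : ℝ} (hx : x ∈ Ioo (-δ) δ)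
    (ht : t ∈ Ioo (t₀ - δ) (t₀ + δ)) : ContDiffAt ℝ ∞ γ (x, t) :=
  h.smooth.contDiffAt ((isOpen_Ioo.prod isOpen_Ioo).mem_nhds ⟨hx, ht⟩)

theorem time_mem (h : IsGraphBox Ω t₀ x₀ u γ δ ε) : t₀ ∈ Ioo (t₀ - δ) (t₀ + δ) :=
  ⟨by linarith [h.delta_pos], by linarith [h.delta_pos]⟩

theorem center_mem (h : IsGraphBox Ω t₀ x₀ u γ δ ε) : x₀ ∈ box x₀ u δ ε := by
  simp [box, h.delta_pos, h.eps_pos]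

theorem mem_closure (h : IsGraphBox Ω t₀ x₀ u γ δ ε) {x y t : ℝ} (hx : x ∈ Ioo (-δ) δ)
    (hy : y ∈ Ioo (-ε) ε) (ht : t ∈ Ioo (t₀ - δ) (t₀ + δ)) (hle : y ≤ γ (x, t)) :
    boxMap x₀ u (x, y) ∈ closure (Ω t) := by
  have hc : Tendsto (fun s : ℝ => boxMap x₀ u (x, s)) (𝓝[<] y) (𝓝 (boxMap x₀ u (x, y))) :=
    (((continuous_boxMap x₀ u).comp (by fun_prop : Continuous fun s : ℝ => (x, s))).tendsto
      y).mono_left nhdsWithin_le_nhds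
  refine mem_closure_of_tendsto hc ?_
  filter_upwards [Ioo_mem_nhdsLT hy.1] with s hs
  exact (h.mem_iff x hx s ⟨hs.1, hs.2.trans hy.2⟩ t ht).2 (hs.2.trans_le hle)

theorem mem_frontier (h : IsGraphBox Ω t₀ x₀ u γ δ ε) {x t : ℝ} (hx : x ∈ Ioo (-δ) δ)
    (ht : t ∈ Ioo (t₀ - δ) (t₀ + δ)) :
    boxMap x₀ u (x, γ (x, t)) ∈ frontier (Ω t) := by
  refine ⟨h.mem_closure hx (h.mem_Ioo x hx t ht) ht le_rfl, fun hi => ?_⟩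
  have := (h.mem_iff x hx _ (h.mem_Ioo x hx t ht) t ht).1 (interior_subset hi)
  exact lt_irrefl _ this

theorem mem_closure_compl_closure (h : IsGraphBox Ω t₀ x₀ u γ δ ε) {x y t : ℝ}
    (hx : x ∈ Ioo (-δ) δ) (hy : y ∈ Ioo (-ε) ε) (ht : t ∈ Ioo (t₀ - δ) (t₀ + δ))
    (hlt : γ (x, t) < y) : boxMap x₀ u (x, y) ∉ closure (Ω t) := by
  have hu := h.norm_eq
  have hc : ContinuousAt (fun z : ℂ => γ (((z - x₀) * (starRingEnd ℂ) u).re, t))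
      (boxMap x₀ u (x, y)) := by
    refine ContinuousAt.comp (g := γ)
      (f := fun z : ℂ => (((z - x₀) * (starRingEnd ℂ) u).re, t)) ?_ (by fun_prop)
    simp only [boxMap_sub_mul_conj hu]
    simpa using (h.contDiffAt hx ht).continuousAt
  have hc2 : ContinuousAt (fun z : ℂ => ((z - x₀) * (starRingEnd ℂ) u).im)
      (boxMap x₀ u (x, y)) := by fun_prop
  have hev := hc.eventually_lt hc2 (by simpa [boxMap_sub_mul_conj hu] using hlt)
  have hb := (isOpen_box x₀ u δ ε).mem_nhds ((boxMap_mem_box (q := (x, y)) hu).2 ⟨hx, hy⟩)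
  rw [_root_.mem_closure_iff_nhds]
  push Not
  refine ⟨_, inter_mem hev hb, ?_⟩
  rw [Set.eq_empty_iff_forall_notMem]
  rintro z ⟨⟨hz1, hz2⟩, hz3⟩
  rw [← boxMap_re_im hu (x₀ := x₀) z, h.mem_iff _ hz2.1 _ hz2.2 t ht] at hz3
  exact lt_asymm hz1 hz3

theorem eq_of_mem_frontier (h : IsGraphBox Ω t₀ x₀ u γ δ ε) {x y t : ℝ} (hx : x ∈ Ioo (-δ) δ)
    (hy : y ∈ Ioo (-ε) ε) (ht : t ∈ Ioo (t₀ - δ) (t₀ + δ)) (ho : IsOpen (Ω t))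
    (hf : boxMap x₀ u (x, y) ∈ frontier (Ω t)) : y = γ (x, t) := by
  rw [ho.frontier_eq] at hf
  rcases lt_trichotomy y (γ (x, t)) with hlt | heq | hgt
  · exact absurd ((h.mem_iff x hx y hy t ht).2 hlt) hf.2
  · exact heq
  · exact absurd hf.1 (h.mem_closure_compl_closure hx hy ht hgt)

end IsGraphBox

theorem box_subset_ball {x₀ u : ℂ} (hu : ‖u‖ = 1) {δ ε η : ℝ} (h : δ + ε ≤ η) :
    box x₀ u δ ε ⊆ Metric.ball x₀ η := by
  intro z hz
  obtain ⟨x, hx, y, hy, rfl⟩ := exists_boxMap_eq_of_mem_box hu hz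
  rw [mem_ball_iff_norm, boxMap, add_sub_cancel_left, norm_mul, hu, mul_one]
  refine (norm_add_le _ _).trans_lt ?_
  rw [norm_mul, Complex.norm_I, mul_one, Complex.norm_real, Complex.norm_real, Real.norm_eq_abs,
    Real.norm_eq_abs]
  have := abs_lt.2 hx
  have := abs_lt.2 hy
  linarith

/-- Since `x₀` lies on the boundary, `γ (0, t₀) = 0`; continuity then allows `δ` to be shrunk, after
the height `ε` is fixed, so that the graph does not leave through the top or the bottom of the box.
-/
theorem IsSmoothFamily.exists_isGraphBox {Ω : ℝ → Set ℂ} {a b : ℝ} (hΩ : IsSmoothFamily Ω a b)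
    {t₀ : ℝ} (ht₀ : t₀ ∈ Ioo a b) {x₀ : ℂ} (hx₀ : x₀ ∈ frontier (Ω t₀)) {η : ℝ} (hη : 0 < η) :
    ∃ (u : ℂ) (γ : ℝ × ℝ → ℝ) (δ ε : ℝ), IsGraphBox Ω t₀ x₀ u γ δ ε ∧
      box x₀ u δ ε ⊆ Metric.ball x₀ η ∧ Ioo (t₀ - δ) (t₀ + δ) ⊆ Ioo a b := by
  obtain ⟨u, γ, ε₀, hu, hε₀, hγ, hiff⟩ := hΩ.local_graph t₀ ht₀ x₀ hx₀
  have h0 : (0 : ℝ) ∈ Ioo (-ε₀) ε₀ := ⟨by linarith, hε₀⟩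
  have ht : t₀ ∈ Ioo (t₀ - ε₀) (t₀ + ε₀) := ⟨by linarith, by linarith⟩
  have hcont : ContinuousAt γ (0, t₀) :=
    (hγ.contDiffAt ((isOpen_Ioo.prod isOpen_Ioo).mem_nhds ⟨h0, ht⟩)).continuousAt
  rw [(hΩ.isOpen t₀ ht₀).frontier_eq] at hx₀
  have hle : γ (0, t₀) ≤ 0 := by
    by_contra! hlt
    exact hx₀.2 (by simpa using (hiff 0 h0 0 h0 t₀ ht).2 hlt)
  have hge : 0 ≤ γ (0, t₀) := by
    by_contra! hlt
    have hc : ContinuousAt (fun z : ℂ => γ (((z - x₀) * (starRingEnd ℂ) u).re, t₀)) x₀ := by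
      refine ContinuousAt.comp (g := γ)
        (f := fun z : ℂ => (((z - x₀) * (starRingEnd ℂ) u).re, t₀)) ?_ (by fun_prop)
      simpa using hcont
    have hc2 : ContinuousAt (fun z : ℂ => ((z - x₀) * (starRingEnd ℂ) u).im) x₀ := by fun_prop
    have hev := hc.eventually_lt hc2 (by simpa using hlt)
    have hb := (isOpen_box x₀ u ε₀ ε₀).mem_nhds (x := x₀) (by simp [box, hε₀])
    obtain ⟨z, ⟨hz1, hz2⟩, hz3⟩ := mem_closure_iff_nhds.1 hx₀.1 _ (inter_mem hev hb)
    rw [← boxMap_re_im hu (x₀ := x₀) z, boxMap, hiff _ hz2.1 _ hz2.2 t₀ ht] at hz3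
    exact lt_asymm hz1 hz3
  have hγ0 : γ (0, t₀) = 0 := le_antisymm hle hge
  set ε := min ε₀ (η / 2) with hε
  have hεpos : 0 < ε := lt_min hε₀ (by linarith)
  have hmem : Ioo (-ε) ε ∈ 𝓝 (γ (0, t₀)) := by
    rw [hγ0]
    exact Ioo_mem_nhds (by linarith) hεpos
  have hab : Ioo a b ∈ 𝓝 t₀ := Ioo_mem_nhds ht₀.1 ht₀.2
  have hnh : γ ⁻¹' Ioo (-ε) ε ∩ (univ ×ˢ Ioo a b) ∈ 𝓝 ((0 : ℝ), t₀) :=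
    inter_mem (hcont hmem) (prod_mem_nhds univ_mem hab)
  obtain ⟨δ₁, hδ₁, hball⟩ := Metric.mem_nhds_iff.1 hnh
  set δ := min δ₁ ε with hδ
  have hδpos : 0 < δ := lt_min hδ₁ hεpos
  have hδε : δ ≤ ε := min_le_right _ _
  have hεε : ε ≤ ε₀ := min_le_left _ _
  have hεη : ε ≤ η / 2 := min_le_right _ _
  have hmem2 : ∀ x ∈ Ioo (-δ) δ, ∀ t ∈ Ioo (t₀ - δ) (t₀ + δ),
      γ (x, t) ∈ Ioo (-ε) ε ∧ t ∈ Ioo a b := by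
    intro x hx t ht
    have : (x, t) ∈ Metric.ball ((0 : ℝ), t₀) δ₁ := by
      rw [Metric.mem_ball, Prod.dist_eq, max_lt_iff, Real.dist_eq, Real.dist_eq]
      have : δ ≤ δ₁ := min_le_left _ _
      constructor
      · rw [sub_zero, abs_lt]; constructor <;> linarith [hx.1, hx.2]
      · rw [abs_lt]; constructor <;> linarith [ht.1, ht.2]
    exact ⟨(hball this).1, (hball this).2.2⟩
  have sub1 : Ioo (-δ) δ ⊆ Ioo (-ε₀) ε₀ := Ioo_subset_Ioo (by linarith) (by linarith)
  have sub2 : Ioo (t₀ - δ) (t₀ + δ) ⊆ Ioo (t₀ - ε₀) (t₀ + ε₀) :=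
    Ioo_subset_Ioo (by linarith) (by linarith)
  refine ⟨u, γ, δ, ε, ⟨hu, hδpos, hεpos, hγ.mono (prod_mono sub1 sub2),
    fun x hx t ht => (hmem2 x hx t ht).1, fun x hx y hy t ht => ?_⟩, box_subset_ball hu (by linarith),
    fun t ht => (hmem2 0 ⟨by linarith, hδpos⟩ t ht).2⟩
  exact hiff x (sub1 hx) y (Ioo_subset_Ioo (by linarith) hεε hy) t (sub2 ht)

/-! ### Stability of the domains in time -/

theorem subset_or_disjoint_of_disjoint_frontier {K D : Set ℂ}
    (hK : IsPreconnected K) (hd : Disjoint K (frontier D)) : K ⊆ D ∨ Disjoint K D := by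
  by_contra! h
  obtain ⟨h1, h2⟩ := h
  obtain ⟨z, hz, hzD⟩ := not_subset.1 h1
  obtain ⟨w, hw, hwD⟩ := not_disjoint_iff.1 h2
  have hcov : K ⊆ interior D ∪ (closure D)ᶜ := by
    intro v hv
    by_contra hcon
    simp only [mem_union, mem_compl_iff, not_or, not_not] at hcon
    exact disjoint_left.1 hd hv ⟨hcon.2, hcon.1⟩
  have hwi : w ∈ interior D := (hcov hw).resolve_right fun h => h (subset_closure hwD)
  have hzi : z ∈ (closure D)ᶜ := (hcov hz).resolve_left fun h => hzD (interior_subset h)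
  obtain ⟨v, -, hv1, hv2⟩ := hK _ _ isOpen_interior isClosed_closure.isOpen_compl hcov
    ⟨w, hw, hwi⟩ ⟨z, hz, hzi⟩
  exact hv2 (subset_closure (interior_subset hv1))

/-- Closeness of the boundaries prevents `∂Ω_t` from meeting a fixed ball `K` off `∂Ω_{t₀}`, but
does not decide on which side `K` lies. For this `K` is chosen large enough to enter a graph box at
a nearest boundary point; there membership of a single point is a strict inequality, stable in `t`,
and connectedness carries it over to `K`. -/
theorem IsSmoothFamily.eventually_subset_or_disjoint {Ω : ℝ → Set ℂ} {a b : ℝ}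
    (hΩ : IsSmoothFamily Ω a b) {t₀ : ℝ} (ht₀ : t₀ ∈ Ioo a b) (hne : (Ω t₀).Nonempty) {z : ℂ}
    (hz : z ∉ frontier (Ω t₀)) :
    ∃ K ∈ 𝓝 z, ∀ᶠ t in 𝓝 t₀, (z ∈ Ω t₀ → K ⊆ Ω t) ∧ (z ∉ Ω t₀ → Disjoint K (Ω t)) := by
  have hfne : (frontier (Ω t₀)).Nonempty := by
    rw [nonempty_frontier_iff]
    refine ⟨hne, fun h => ?_⟩
    have := hΩ.isBounded t₀ ht₀
    rw [h] at this
    exact NormedSpace.unbounded_univ ℝ ℂ this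
  obtain ⟨x₁, hx₁, hdist⟩ := isClosed_frontier.exists_infDist_eq_dist hfne z
  have hd : 0 < dist z x₁ := by
    rw [← hdist]
    exact (isClosed_frontier.notMem_iff_infDist_pos hfne).1 hz
  obtain ⟨u, γ, δ, ε, hbox, -, -⟩ := hΩ.exists_isGraphBox ht₀ hx₁ one_pos
  have hcl : Tendsto (fun s : ℝ => AffineMap.lineMap x₁ z s) (𝓝[>] 0) (𝓝 x₁) := by
    have : Continuous fun s : ℝ => AffineMap.lineMap x₁ z s := AffineMap.lineMap_continuous
    have h := this.tendsto 0
    rw [AffineMap.lineMap_apply_zero] at h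
    exact h.mono_left nhdsWithin_le_nhds
  obtain ⟨s, hs, hs0, hs1⟩ := ((hcl.eventually ((isOpen_box x₁ u δ ε).mem_nhds
    hbox.center_mem)).and (Ioo_mem_nhdsGT one_pos)).exists
  -- This test point is in the graph box and strictly closer to `z` than the boundary is.
  set y : ℂ := AffineMap.lineMap x₁ z s with hy
  have hyz : dist y z = (1 - s) * dist z x₁ := by
    rw [hy, dist_lineMap_right, Real.norm_of_nonneg (by linarith), dist_comm x₁ z]
  have hylt : dist y z < dist z x₁ := by rw [hyz]; nlinarith
  set K := Metric.closedBall z (dist y z) with hK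
  have hyz0 : 0 < dist y z := by rw [hyz]; exact mul_pos (by linarith) hd
  have hKc : IsPreconnected K := (convex_closedBall z _).isPreconnected
  have hyK : y ∈ K := by rw [hK, Metric.mem_closedBall]
  have hzK : z ∈ K := Metric.mem_closedBall_self dist_nonneg
  have hKf : Disjoint K (frontier (Ω t₀)) := by
    rw [disjoint_left]
    intro w hw hwf
    have := Metric.infDist_le_dist_of_mem (x := z) hwf
    rw [hdist, dist_comm z w] at this
    exact absurd (this.trans hw) (not_le.2 hylt)
  have hnear := hΩ.frontier_near t₀ ht₀ Kᶜ Metric.isClosed_closedBall.isOpen_compl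
    (fun w hw hwK => disjoint_left.1 hKf hwK hw)
  obtain ⟨p, hp, q, hq, hpq⟩ := exists_boxMap_eq_of_mem_box hbox.norm_eq hs
  have hpq : boxMap x₁ u (p, q) = y := hpq
  have hcont : ContinuousAt (fun t => γ (p, t)) t₀ :=
    (hbox.contDiffAt hp hbox.time_mem).continuousAt.comp (f := fun t => (p, t)) (by fun_prop)
  have hqne : q ≠ γ (p, t₀) := fun h => by
    have := hbox.mem_frontier hp hbox.time_mem
    rw [← h, hpq] at this
    exact disjoint_left.1 hKf hyK this
  have hstat : ∀ᶠ t in 𝓝 t₀, (y ∈ Ω t ↔ y ∈ Ω t₀) := by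
    have hev : ∀ᶠ t in 𝓝 t₀, (q < γ (p, t) ↔ q < γ (p, t₀)) := by
      rcases lt_or_gt_of_ne hqne with h | h
      · filter_upwards [hcont.eventually (lt_mem_nhds h)] with t ht
        exact ⟨fun _ => h, fun _ => ht⟩
      · filter_upwards [hcont.eventually (gt_mem_nhds h)] with t ht
        exact ⟨fun h' => absurd h' (not_lt.2 ht.le), fun h' => absurd h' (not_lt.2 h.le)⟩
    filter_upwards [hev, Ioo_mem_nhds hbox.time_mem.1 hbox.time_mem.2] with t ht ht'
    rw [← hpq, hbox.mem_iff p hp q hq t ht', hbox.mem_iff p hp q hq t₀ hbox.time_mem, ht]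
  refine ⟨K, Metric.closedBall_mem_nhds z hyz0, ?_⟩
  filter_upwards [hnear, hstat] with t ht hty
  have h0 := subset_or_disjoint_of_disjoint_frontier hKc hKf
  have ht := subset_or_disjoint_of_disjoint_frontier hKc
    (disjoint_left.2 fun w hw hwf => ht hwf hw)
  constructor
  · intro hzt
    have hyt : y ∈ Ω t := hty.2 ((h0.resolve_right
      fun h => disjoint_left.1 h hzK hzt) hyK)
    exact ht.resolve_right fun h => disjoint_left.1 h hyK hyt
  · intro hzt
    have hyt : y ∉ Ω t := fun h' => disjoint_left.1
      (h0.resolve_left fun h => hzt (h hzK)) hyK (hty.1 h')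
    exact ht.resolve_left fun h => hyt (h hyK)

/-! ### Integration in graph coordinates -/

theorem measurePreserving_boxMap {x₀ u : ℂ} (hu : ‖u‖ = 1) :
    MeasurePreserving (boxMap x₀ u) := by
  have h1 : MeasurePreserving (fun q : ℝ × ℝ => (q.1 : ℂ) + (q.2 : ℂ) * Complex.I) := by
    have := Complex.volume_preserving_equiv_real_prod.symm
    convert this using 1
    ext q
    exact (Complex.mk_eq_add_mul_I q.1 q.2).symm
  have h2 : MeasurePreserving fun z : ℂ => z * u := by
    have := (rotation (⟨u, by simpa [Submonoid.unitSphere] using hu⟩ : Circle)).measurePreserving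
    convert this using 1
    ext z
    exact mul_comm z u
  exact (measurePreserving_add_left volume x₀).comp (h2.comp h1)

theorem measurableEmbedding_boxMap {x₀ u : ℂ} (hu : ‖u‖ = 1) :
    MeasurableEmbedding (boxMap x₀ u) := by
  refine (continuous_boxMap x₀ u).measurableEmbedding fun q q' h => ?_
  have := congrArg (fun z => (z - x₀) * (starRingEnd ℂ) u) h
  simp only [boxMap_sub_mul_conj hu] at this
  have h1 := congrArg Complex.re this
  have h2 := congrArg Complex.im this
  simp at h1 h2
  exact Prod.ext h1 h2

theorem integral_eq_integral_boxMap {x₀ u : ℂ} (hu : ‖u‖ = 1) {f : ℂ → ℝ} (hf : Integrable f) :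
    ∫ z, f z = ∫ x : ℝ, ∫ y : ℝ, f (boxMap x₀ u (x, y)) := by
  rw [← (measurePreserving_boxMap (x₀ := x₀) hu).integral_comp (measurableEmbedding_boxMap hu) f]
  exact integral_prod _ ((measurePreserving_boxMap (x₀ := x₀) hu).integrable_comp_emb
    (measurableEmbedding_boxMap hu) |>.2 hf)

/-- Integration over a subgraph of a function supported in a rectangle. -/
theorem setIntegral_eq_integral_shear {x₀ u : ℂ} (hu : ‖u‖ = 1) {D : Set ℂ} (hDm : MeasurableSet D)
    {c : ℝ → ℝ} {r ε : ℝ} (hr : 0 < r) (hε : 0 < ε)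
    (hc : ∀ x ∈ Ioo (-r) r, c x ∈ Ioo (-ε) ε)
    (hD : ∀ x ∈ Ioo (-r) r, ∀ y ∈ Ioo (-ε) ε, (boxMap x₀ u (x, y) ∈ D ↔ y < c x))
    {f : ℂ → ℝ} (hf : ∀ z, f z ≠ 0 → z ∈ box x₀ u r ε) (hint : IntegrableOn f D) :
    ∫ z in D, f z =
      ∫ x in (-r)..r, ∫ s in (-(2 * ε))..0, f (boxMap x₀ u (x, c x + s)) := by
  have hf' : ∀ x y, f (boxMap x₀ u (x, y)) ≠ 0 → x ∈ Ioo (-r) r ∧ y ∈ Ioo (-ε) ε :=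
    fun x y h => (boxMap_mem_box hu).1 (hf _ h)
  rw [← integral_indicator hDm, integral_eq_integral_boxMap (x₀ := x₀) hu (hint.integrable_indicator hDm),
    intervalIntegral.integral_of_le (by linarith), integral_Ioc_eq_integral_Ioo,
    ← setIntegral_eq_integral_of_forall_compl_eq_zero (s := Ioo (-r) r)]
  · refine setIntegral_congr_fun measurableSet_Ioo fun x hx => ?_
    -- The vertical shift by `c x` turns the subgraph into `s < 0`. As `|y|, |c x| < ε` on the
    -- support, `s = y - c x` never falls below `-2ε`.
    rw [← integral_add_left_eq_self (fun y => D.indicator f (boxMap x₀ u (x, y))) (c x),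
      intervalIntegral.integral_of_le (by linarith), integral_Ioc_eq_integral_Ioo,
      ← setIntegral_eq_integral_of_ae_compl_eq_zero (s := Ioo (-(2 * ε)) 0)]
    · refine setIntegral_congr_fun measurableSet_Ioo fun s hs => ?_
      by_cases h0 : f (boxMap x₀ u (x, c x + s)) = 0
      · by_cases hm : boxMap x₀ u (x, c x + s) ∈ D
        · rw [indicator_of_mem hm]
        · rw [indicator_of_notMem hm, h0]
      · rw [indicator_of_mem]
        exact (hD x hx _ (hf' _ _ h0).2).2 (by linarith [hs.2])
    · have hne : ∀ᵐ s : ℝ, s ≠ 0 := by simp [ae_iff, measure_singleton]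
      filter_upwards [hne] with s hs0 hs
      by_contra h
      have hm : boxMap x₀ u (x, c x + s) ∈ D := mem_of_indicator_ne_zero h
      rw [indicator_of_mem hm] at h
      have hy := (hf' _ _ h).2
      have hlt := (hD x hx _ hy).1 hm
      have hcx := hc x hx
      refine hs ⟨?_, ?_⟩
      · linarith [hy.1, hcx.2]
      · linarith
  · intro x hx
    have : ∀ y, D.indicator f (boxMap x₀ u (x, y)) = 0 := fun y => by
      by_contra h
      have hm := mem_of_indicator_ne_zero h
      rw [indicator_of_mem hm] at h
      exact hx (hf' _ _ h).1
    simp [this]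

/-! ### Differentiation of integrals over the moving domain -/

/-- Integrals over a moving subgraph are differentiable in time. -/
theorem IsGraphBox.hasDerivAt_setIntegral {Ω : ℝ → Set ℂ} {t₀ : ℝ} {x₀ u : ℂ} {γ : ℝ × ℝ → ℝ}
    {δ ε : ℝ} (h : IsGraphBox Ω t₀ x₀ u γ δ ε) (hΩ : ∀ t ∈ Ioo (t₀ - δ) (t₀ + δ), IsOpen (Ω t))
    {H : ℂ → ℝ} (hH : Continuous H) (hHs : HasCompactSupport H)
    (hHb : tsupport H ⊆ box x₀ u (δ / 2) ε) :
    HasDerivAt (fun t => ∫ z in Ω t, H z)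
      (∫ x in (-(δ / 2))..(δ / 2), H (boxMap x₀ u (x, γ (x, t₀))) * fderiv ℝ γ (x, t₀) (0, 1)) t₀ := by
  have hδ := h.delta_pos
  have hε := h.eps_pos
  have hu := h.norm_eq
  set r := δ / 2 with hr
  have hrδ : Ioo (-r) r ⊆ Ioo (-δ) δ := Ioo_subset_Ioo (by linarith) (by linarith)
  have hrδ' : Icc (-r) r ⊆ Ioo (-δ) δ := Icc_subset_Ioo (by linarith) (by linarith)
  have htδ' : Icc (t₀ - r) (t₀ + r) ⊆ Ioo (t₀ - δ) (t₀ + δ) :=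
    Icc_subset_Ioo (by linarith) (by linarith)
  have hH0 : ∀ x y, H (boxMap x₀ u (x, y)) ≠ 0 → x ∈ Ioo (-r) r ∧ y ∈ Ioo (-ε) ε := fun x y hxy =>
    (boxMap_mem_box hu).1 (hHb (subset_tsupport _ hxy))
  -- `A x` is a vertical primitive of `H`, so the moving integral becomes `∫ A x (γ (x, t)) dx` over
  -- a fixed interval. The base point `-3ε` lies below `γ - 2ε`, and `H` vanishes between the two.
  obtain ⟨A, hA⟩ : ∃ A : ℝ → ℝ → ℝ,
      A = fun x c => ∫ y in (-(3 * ε))..c, H (boxMap x₀ u (x, y)) := ⟨_, rfl⟩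
  have hHc : Continuous fun q : ℝ × ℝ => H (boxMap x₀ u (q.1, q.2)) :=
    hH.comp (continuous_boxMap x₀ u)
  have hHx : ∀ x, Continuous fun y : ℝ => H (boxMap x₀ u (x, y)) := fun x =>
    hHc.comp (by fun_prop : Continuous fun y : ℝ => (x, y))
  have hAd : ∀ x c, HasDerivAt (A x) (H (boxMap x₀ u (x, c))) c := fun x c => by
    rw [hA]
    exact intervalIntegral.integral_hasDerivAt_right ((hHx x).intervalIntegrable _ _)
      ((hHx x).stronglyMeasurableAtFilter _ _) (hHx x).continuousAt
  have hAc : Continuous fun q : ℝ × ℝ => A q.1 q.2 := by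
    rw [hA]
    exact intervalIntegral.continuous_parametric_primitive_of_continuous (f := fun x y =>
      H (boxMap x₀ u (x, y))) (μ := volume) (a₀ := -(3 * ε)) hHc
  have heq : (fun t => ∫ z in Ω t, H z) =ᶠ[𝓝 t₀] fun t => ∫ x in (-r)..r, A x (γ (x, t)) := by
    filter_upwards [Ioo_mem_nhds h.time_mem.1 h.time_mem.2] with t ht
    rw [setIntegral_eq_integral_shear hu (hΩ t ht).measurableSet (c := fun x => γ (x, t))
      (r := r) (ε := ε) (by positivity) hε (fun x hx => h.mem_Ioo x (hrδ hx) t ht)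
      (fun x hx y hy => h.mem_iff x (hrδ hx) y hy t ht)
      (fun z hz => hHb (subset_tsupport _ hz))
      (hH.integrable_of_hasCompactSupport hHs).integrableOn]
    rw [intervalIntegral.integral_of_le (by linarith), intervalIntegral.integral_of_le (by linarith),
      integral_Ioc_eq_integral_Ioo, integral_Ioc_eq_integral_Ioo]
    refine setIntegral_congr_fun measurableSet_Ioo fun x hx => ?_
    simp only [hA]
    rw [intervalIntegral.integral_comp_add_left (fun y => H (boxMap x₀ u (x, y))), add_zero,
      ← intervalIntegral.integral_add_adjacent_intervals (a := -(3 * ε)) (b := γ (x, t) + -(2 * ε))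
      ((hHx x).intervalIntegrable _ _) ((hHx x).intervalIntegrable _ _), eq_comm, add_eq_right]
    have hγ := h.mem_Ioo x (hrδ hx) t ht
    refine intervalIntegral.integral_zero_ae (Eventually.of_forall fun y hy => ?_)
    by_contra h0
    have hy' := (hH0 _ _ h0).2
    rw [uIoc_of_le (by linarith [hγ.1])] at hy
    linarith [hy.2, hy'.1, hγ.2]
  refine HasDerivAt.congr_of_eventuallyEq ?_ heq
  have hγt : ∀ x ∈ Ioo (-δ) δ, ∀ t ∈ Ioo (t₀ - δ) (t₀ + δ),
      HasDerivAt (fun t => γ (x, t)) (fderiv ℝ γ (x, t) (0, 1)) t := by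
    intro x hx t ht
    have h1 : HasFDerivAt γ (fderiv ℝ γ (x, t)) (x, t) :=
      ((h.contDiffAt hx ht).differentiableAt (by simp)).hasFDerivAt
    exact h1.comp_hasDerivAt t ((hasDerivAt_const t x).prodMk (hasDerivAt_id t))
  have hfc : ContinuousOn (fun q : ℝ × ℝ => fderiv ℝ γ q (0, 1))
      (Ioo (-δ) δ ×ˢ Ioo (t₀ - δ) (t₀ + δ)) :=
    (h.smooth.continuousOn_fderiv_of_isOpen (isOpen_Ioo.prod isOpen_Ioo) (by simp)).clm_apply
      continuousOn_const
  obtain ⟨C, hC⟩ := (isCompact_Icc.prod isCompact_Icc).exists_bound_of_continuousOn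
    (hfc.mono (prod_mono hrδ' htδ'))
  obtain ⟨M, hM⟩ := hH.bounded_above_of_compact_support hHs
  have hγc : ∀ t ∈ Ioo (t₀ - δ) (t₀ + δ), ContinuousOn (fun x => γ (x, t)) (Icc (-r) r) :=
    fun t ht => h.smooth.continuousOn.comp (by fun_prop) fun x hx => ⟨hrδ' hx, ht⟩
  have hpair : ∀ t ∈ Ioo (t₀ - δ) (t₀ + δ),
      ContinuousOn (fun x => (x, γ (x, t))) (Icc (-r) r) := fun t ht =>
    continuousOn_id.prodMk (hγc t ht)
  have hFc : ∀ t ∈ Ioo (t₀ - δ) (t₀ + δ), ContinuousOn (fun x => A x (γ (x, t))) (Icc (-r) r) :=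
    fun t ht => hAc.comp_continuousOn (hpair t ht)
  have huIoc : Ι (-r) r ⊆ Icc (-r) r := by
    rw [uIoc_of_le (by linarith)]
    exact Ioc_subset_Icc_self
  have hmeas : ∀ {g : ℝ → ℝ}, ContinuousOn g (Icc (-r) r) →
      AEStronglyMeasurable g (volume.restrict (Ι (-r) r)) := fun hg =>
    (hg.aestronglyMeasurable measurableSet_Icc).mono_measure (Measure.restrict_mono huIoc le_rfl)
  refine (intervalIntegral.hasDerivAt_integral_of_dominated_loc_of_deriv_le
    (F := fun t x => A x (γ (x, t)))
    (F' := fun t x => H (boxMap x₀ u (x, γ (x, t))) * fderiv ℝ γ (x, t) (0, 1))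
    (s := Icc (t₀ - r) (t₀ + r)) (bound := fun _ => M * C) ?_ ?_ ?_ ?_ ?_ ?_ ?_).2
  · exact Icc_mem_nhds (by linarith) (by linarith)
  · filter_upwards [Ioo_mem_nhds h.time_mem.1 h.time_mem.2] with t ht
    exact hmeas (hFc t ht)
  · refine ContinuousOn.intervalIntegrable ?_
    rw [uIcc_of_le (by linarith)]
    exact hFc t₀ h.time_mem
  · refine hmeas (ContinuousOn.mul ?_ ?_)
    · exact (hH.comp (continuous_boxMap x₀ u)).comp_continuousOn (hpair t₀ h.time_mem)
    · exact hfc.comp (by fun_prop) fun x hx => ⟨hrδ' hx, h.time_mem⟩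
  · refine Eventually.of_forall fun x hx t ht => ?_
    rw [norm_mul]
    have h1 := hM (boxMap x₀ u (x, γ (x, t)))
    have h2 := hC (x, t) ⟨huIoc hx, ht⟩
    exact mul_le_mul h1 h2 (norm_nonneg _) ((norm_nonneg _).trans h1)
  · exact intervalIntegrable_const
  · refine Eventually.of_forall fun x hx t ht => ?_
    exact (hAd x (γ (x, t))).comp t (hγt x (hrδ' (huIoc hx)) t (htδ' ht))

/-! ### The normal velocity in graph coordinates -/

theorem inner_eq_re_mul_conj (w u : ℂ) : inner ℝ w u = (w * (starRingEnd ℂ) u).re := by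
  rw [Complex.inner]
  simp
  ring

theorem inner_mul_I_eq_im_mul_conj (w u : ℂ) :
    inner ℝ w (u * Complex.I) = (w * (starRingEnd ℂ) u).im := by
  rw [Complex.inner]
  simp
  ring

/-- Writing `n₁, n₂` for the coordinates of `n`, the moving point satisfies `γ (x, t₀) + f n₂ = γ (x
+ f n₁, t)`; the identity is the time derivative of this equation at `t₀`. -/
theorem IsGraphBox.inner_normalVelocity {Ω : ℝ → Set ℂ} {t₀ : ℝ} {x₀ u : ℂ} {γ : ℝ × ℝ → ℝ}
    {δ ε : ℝ} (h : IsGraphBox Ω t₀ x₀ u γ δ ε) (hΩ : ∀ t ∈ Ioo (t₀ - δ) (t₀ + δ), IsOpen (Ω t))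
    {x : ℝ} (hx : x ∈ Ioo (-δ) δ) {V : ℂ}
    (hV : HasNormalVelocity Ω t₀ (boxMap x₀ u (x, γ (x, t₀))) V) :
    inner ℝ V (u * Complex.I) - fderiv ℝ γ (x, t₀) (1, 0) * inner ℝ V u =
      fderiv ℝ γ (x, t₀) (0, 1) := by
  obtain ⟨n, f, v, -, hf0, hfr, hfd, rfl⟩ := hV
  have hu := h.norm_eq
  set n₁ := (n * (starRingEnd ℂ) u).re with hn₁
  set n₂ := (n * (starRingEnd ℂ) u).im with hn₂
  have hn : n = ((n₁ : ℂ) + (n₂ : ℂ) * Complex.I) * u := by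
    rw [hn₁, hn₂, Complex.re_add_im, mul_assoc, mul_comm _ u, mul_conj_of_norm_eq_one hu, mul_one]
  have hpt : ∀ t, boxMap x₀ u (x, γ (x, t₀)) + f t • n =
      boxMap x₀ u (x + f t * n₁, γ (x, t₀) + f t * n₂) := by
    intro t
    rw [boxMap, boxMap, Complex.real_smul]
    conv_lhs => rw [hn]
    push_cast
    ring
  have hfc : ContinuousAt f t₀ := hfd.continuousAt
  have hin : ∀ᶠ t in 𝓝 t₀, x + f t * n₁ ∈ Ioo (-δ) δ ∧ γ (x, t₀) + f t * n₂ ∈ Ioo (-ε) ε := by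
    have h1 : ContinuousAt (fun t => x + f t * n₁) t₀ := by fun_prop
    have h2 : ContinuousAt (fun t => γ (x, t₀) + f t * n₂) t₀ := by fun_prop
    have hγ := h.mem_Ioo x hx t₀ h.time_mem
    refine (h1.eventually (p := fun y => y ∈ Ioo (-δ) δ) ?_).and
      (h2.eventually (p := fun y => y ∈ Ioo (-ε) ε) ?_)
    · change _ ∈ 𝓝 (x + f t₀ * n₁)
      rw [hf0, zero_mul, add_zero]
      exact Ioo_mem_nhds hx.1 hx.2
    · change _ ∈ 𝓝 (γ (x, t₀) + f t₀ * n₂)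
      rw [hf0, zero_mul, add_zero]
      exact Ioo_mem_nhds hγ.1 hγ.2
  have heq : (fun t => γ (x, t₀) + f t * n₂) =ᶠ[𝓝 t₀] fun t => γ (x + f t * n₁, t) := by
    filter_upwards [hfr, hin, Ioo_mem_nhds h.time_mem.1 h.time_mem.2] with t ht1 ht2 ht3
    rw [hpt] at ht1
    exact h.eq_of_mem_frontier ht2.1 ht2.2 ht3 (hΩ t ht3) ht1
  have hd1 : HasDerivAt (fun t => γ (x, t₀) + f t * n₂) (v * n₂) t₀ :=
    (hfd.mul_const n₂).const_add _
  have hγd : HasFDerivAt γ (fderiv ℝ γ (x, t₀)) (x + f t₀ * n₁, t₀) := by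
    simpa [hf0] using ((h.contDiffAt hx h.time_mem).differentiableAt (by simp)).hasFDerivAt
  have hd2 : HasDerivAt (fun t => γ (x + f t * n₁, t)) (fderiv ℝ γ (x, t₀) (v * n₁, 1)) t₀ :=
    hγd.comp_hasDerivAt (f := fun t => (x + f t * n₁, t)) t₀ (((hfd.mul_const n₁).const_add x).prodMk (hasDerivAt_id t₀))
  have := hd1.unique (hd2.congr_of_eventuallyEq heq)
  have hlin : fderiv ℝ γ (x, t₀) (v * n₁, 1) =
      (v * n₁) * fderiv ℝ γ (x, t₀) (1, 0) + fderiv ℝ γ (x, t₀) (0, 1) := by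
    have e : ((v * n₁, 1) : ℝ × ℝ) = (v * n₁) • ((1, 0) : ℝ × ℝ) + (0, 1) := by simp
    rw [e, map_add, map_smul, smul_eq_mul]
  rw [hlin] at this
  rw [inner_smul_left, inner_smul_left, inner_mul_I_eq_im_mul_conj, inner_eq_re_mul_conj]
  simp only [conj_trivial]
  linarith

/-! ### The Green formula in graph coordinates -/

theorem laplacian_eq_fderiv_rotated {f : ℂ → ℝ} {z u : ℂ} (hu : ‖u‖ = 1)
    (hf : ContDiffAt ℝ 2 f z) :
    Δ f z = fderiv ℝ (fun w => fderiv ℝ f w u) z u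
      + fderiv ℝ (fun w => fderiv ℝ f w (u * Complex.I)) z (u * Complex.I) := by
  have hd : DifferentiableAt ℝ (fderiv ℝ f) z :=
    (hf.fderiv_right (m := 1) (by norm_num)).differentiableAt (by norm_num)
  have h : ∀ v : ℂ, fderiv ℝ (fun w => fderiv ℝ f w v) z v = fderiv ℝ (fderiv ℝ f) z v v := by
    intro v
    rw [fderiv_clm_apply hd (differentiableAt_const v)]
    simp
  have hu2 : u.re * u.re + u.im * u.im = 1 := by
    rw [← Complex.normSq_apply, Complex.normSq_eq_norm_sq, hu]
    norm_num
  have e1 : u = u.re • (1 : ℂ) + u.im • Complex.I := by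
    simp [Complex.re_add_im]
  have e2 : u * Complex.I = (-u.im) • (1 : ℂ) + u.re • Complex.I := by
    apply Complex.ext <;> simp
  rw [laplacian_eq_fderiv_fderiv hf, h, h, h, h]
  generalize fderiv ℝ (fderiv ℝ f) z = T
  rw [e2]
  conv_rhs => enter [1]; rw [e1]
  simp only [map_add, map_smul, add_apply, FunLike.coe_smul,
    Pi.smul_apply, smul_eq_mul]
  linear_combination (-(T 1 1) - T Complex.I Complex.I) * hu2

/-- The flux of `p ∇F - F ∇p` in the direction `v`; here `g` stands for `∇p`. -/
noncomputable def greenFlux (p : ℂ → ℝ) (g : ℂ → ℂ) (F : ℂ → ℝ) (v z : ℂ) : ℝ :=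
  p z * fderiv ℝ F z v - F z * inner ℝ (g z) v

theorem greenFlux_eventuallyEq_zero (p : ℂ → ℝ) (g : ℂ → ℂ) {F : ℂ → ℝ} (v : ℂ) {z : ℂ}
    (hz : z ∉ tsupport F) : greenFlux p g F v =ᶠ[𝓝 z] 0 := by
  rw [notMem_tsupport_iff_eventuallyEq] at hz
  filter_upwards [hz, hz.fderiv (𝕜 := ℝ)] with w h1 h2
  simp [greenFlux, h1, h2]

theorem differentiableAt_greenFlux {p : ℂ → ℝ} {g : ℂ → ℂ} {F : ℂ → ℝ} {z : ℂ}
    (hF : ContDiff ℝ ∞ F) (hp : ContDiffAt ℝ 2 p z) (hg : g =ᶠ[𝓝 z] gradient p) (v : ℂ) :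
    DifferentiableAt ℝ (greenFlux p g F v) z ∧
    fderiv ℝ (greenFlux p g F v) z v =
      p z * fderiv ℝ (fun w => fderiv ℝ F w v) z v - F z * fderiv ℝ (fun w => fderiv ℝ p w v) z v := by
  have he : greenFlux p g F v =ᶠ[𝓝 z] fun z => p z * fderiv ℝ F z v - F z * fderiv ℝ p z v := by
    filter_upwards [hg] with w hw
    rw [greenFlux, hw]
    have : inner ℝ (gradient p w) v = fderiv ℝ p w v :=
      inner_gradient_left
    rw [this]
  have d1 : DifferentiableAt ℝ p z := hp.differentiableAt (by norm_num)
  have d2 : DifferentiableAt ℝ F z := hF.contDiffAt.differentiableAt (by simp)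
  have d3 : DifferentiableAt ℝ (fun w => fderiv ℝ p w v) z :=
    ((hp.fderiv_right (m := 1) (by norm_num)).clm_apply contDiffAt_const).differentiableAt
      (by norm_num)
  have d4 : DifferentiableAt ℝ (fun w => fderiv ℝ F w v) z :=
    ((hF.fderiv_right (m := ∞) (by simp)).clm_apply contDiff_const).contDiffAt.differentiableAt
      (by simp)
  have hh : HasFDerivAt (fun z => p z * fderiv ℝ F z v - F z * fderiv ℝ p z v) _ z :=
    (d1.hasFDerivAt.mul d4.hasFDerivAt).sub (d2.hasFDerivAt.mul d3.hasFDerivAt)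
  refine ⟨hh.differentiableAt.congr_of_eventuallyEq he, ?_⟩
  rw [he.fderiv_eq, hh.fderiv]
  simp
  ring

/-- `div (p ∇F - F ∇p) = p ΔF - F Δp` and `Δp = 0`. Off the support of `F` the flux vanishes
identically, whatever `p` is. -/
theorem divergence_greenFlux {p : ℂ → ℝ} {g : ℂ → ℂ} {F : ℂ → ℝ} {z u : ℂ} (hu : ‖u‖ = 1)
    (hF : ContDiff ℝ ∞ F)
    (hz : z ∈ tsupport F → InnerProductSpace.HarmonicAt p z ∧ g =ᶠ[𝓝 z] gradient p) :
    (∀ v, DifferentiableAt ℝ (greenFlux p g F v) z) ∧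
    fderiv ℝ (greenFlux p g F u) z u
      + fderiv ℝ (greenFlux p g F (u * Complex.I)) z (u * Complex.I) = p z * Δ F z := by
  by_cases hzF : z ∈ tsupport F
  · obtain ⟨hp, hg⟩ := hz hzF
    refine ⟨fun v => (differentiableAt_greenFlux hF hp.1 hg v).1, ?_⟩
    have hlap : Δ p z = 0 := hp.2.self_of_nhds
    rw [laplacian_eq_fderiv_rotated hu hp.1] at hlap
    rw [(differentiableAt_greenFlux hF hp.1 hg _).2, (differentiableAt_greenFlux hF hp.1 hg _).2,
      laplacian_eq_fderiv_rotated hu (hF.contDiffAt.of_le ENat.LEInfty.out)]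
    linear_combination -(F z) * hlap
  · have h := fun v => greenFlux_eventuallyEq_zero p g v hzF
    refine ⟨fun v => (differentiableAt_const (0 : ℝ)).congr_of_eventuallyEq (h v), ?_⟩
    have hL : Δ F z = 0 := by
      by_contra hne
      exact hzF (support_laplacian_subset F hne)
    rw [(h u).fderiv_eq, (h (u * Complex.I)).fderiv_eq, hL]
    have e : (0 : ℂ → ℝ) = fun _ => 0 := rfl
    rw [e]
    simp

theorem hasFDerivAt_boxMap (x₀ u : ℂ) (q : ℝ × ℝ) :
    ∃ L : ℝ × ℝ →L[ℝ] ℂ, HasFDerivAt (boxMap x₀ u) L q ∧ L (1, 0) = u ∧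
      L (0, 1) = u * Complex.I := by
  have h1 : HasFDerivAt (fun q : ℝ × ℝ => (q.1 : ℂ))
      (Complex.ofRealCLM.comp (ContinuousLinearMap.fst ℝ ℝ ℝ)) q :=
    (Complex.ofRealCLM.comp (ContinuousLinearMap.fst ℝ ℝ ℝ)).hasFDerivAt
  have h2 : HasFDerivAt (fun q : ℝ × ℝ => (q.2 : ℂ))
      (Complex.ofRealCLM.comp (ContinuousLinearMap.snd ℝ ℝ ℝ)) q :=
    (Complex.ofRealCLM.comp (ContinuousLinearMap.snd ℝ ℝ ℝ)).hasFDerivAt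
  have h3 : HasFDerivAt (boxMap x₀ u) _ q :=
    ((h1.add (h2.mul_const Complex.I)).mul_const u).const_add x₀
  refine ⟨_, h3, ?_, ?_⟩
  · simp
  · simp

/-- The graph coordinates which flatten the graph of `c`. -/
noncomputable def shearMap (x₀ u : ℂ) (c : ℝ → ℝ) (q : ℝ × ℝ) : ℂ :=
  boxMap x₀ u (q.1, c q.1 + q.2)

theorem hasFDerivAt_shearMap (x₀ u : ℂ) {c : ℝ → ℝ} {q : ℝ × ℝ} (hc : DifferentiableAt ℝ c q.1) :
    ∃ L : ℝ × ℝ →L[ℝ] ℂ, HasFDerivAt (shearMap x₀ u c) L q ∧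
      L (1, 0) = u + deriv c q.1 • (u * Complex.I) ∧ L (0, 1) = u * Complex.I := by
  obtain ⟨L, hL, hL1, hL2⟩ := hasFDerivAt_boxMap x₀ u (q.1, c q.1 + q.2)
  have h1 : HasFDerivAt (fun q : ℝ × ℝ => c q.1)
      (deriv c q.1 • ContinuousLinearMap.fst ℝ ℝ ℝ) q :=
    hc.hasDerivAt.comp_hasFDerivAt q hasFDerivAt_fst
  have h2 := hL.comp (f := fun q : ℝ × ℝ => (q.1, c q.1 + q.2)) q
    (hasFDerivAt_fst.prodMk (h1.add hasFDerivAt_snd))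
  refine ⟨_, h2, ?_, ?_⟩
  · have e : ((1 : ℝ), deriv c q.1) = ((1 : ℝ), (0 : ℝ)) + deriv c q.1 • ((0 : ℝ), (1 : ℝ)) := by
      simp
    simp only [ContinuousLinearMap.comp_apply, ContinuousLinearMap.prod_apply, add_apply,
      FunLike.coe_smul, Pi.smul_apply,
      ContinuousLinearMap.coe_fst', ContinuousLinearMap.coe_snd', smul_eq_mul, mul_one, add_zero]
    rw [e, map_add, map_smul, hL1, hL2]
  · simp [hL2]

/-- The Green formula for a function `p` which is harmonic in a subgraph, vanishes on the graph and
is continuously differentiable up to it, and a test function supported near the graph. -/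
theorem setIntegral_mul_laplacian_eq_boundary {x₀ u : ℂ} (hu : ‖u‖ = 1) {D : Set ℂ}
    (hDo : IsOpen D) {c : ℝ → ℝ} {δ r ε : ℝ} (hr : 0 < r) (hrδ : r < δ) (hε : 0 < ε)
    (hcs : ContDiffOn ℝ ∞ c (Ioo (-δ) δ)) (hc : ∀ x ∈ Ioo (-δ) δ, c x ∈ Ioo (-ε) ε)
    (hD : ∀ x ∈ Ioo (-δ) δ, ∀ y ∈ Ioo (-ε) ε, (boxMap x₀ u (x, y) ∈ D ↔ y < c x))
    (hcl : ∀ x ∈ Ioo (-δ) δ, ∀ y ∈ Ioo (-ε) ε, y ≤ c x → boxMap x₀ u (x, y) ∈ closure D)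
    {p : ℂ → ℝ} {g : ℂ → ℂ} (hp0 : ∀ z ∉ D, p z = 0)
    (hpc : ∀ z ∈ box x₀ u δ ε, ContinuousAt p z)
    (hpD : ∀ z ∈ D ∩ box x₀ u δ ε, InnerProductSpace.HarmonicAt p z)
    (hg : ∀ z ∈ D ∩ box x₀ u δ ε, g z = gradient p z)
    (hgc : ContinuousOn g (closure D ∩ box x₀ u δ ε))
    {F : ℂ → ℝ} (hF : ContDiff ℝ ∞ F) (hFs : HasCompactSupport F)
    (hFb : tsupport F ⊆ box x₀ u r ε) :
    ∫ z in D, p z * Δ F z = -∫ x in (-r)..r, F (boxMap x₀ u (x, c x)) *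
      (inner ℝ (g (boxMap x₀ u (x, c x))) (u * Complex.I) -
        deriv c x * inner ℝ (g (boxMap x₀ u (x, c x))) u) := by
  have hbox : box x₀ u r ε ⊆ box x₀ u δ ε := fun z hz =>
    ⟨Ioo_subset_Ioo (by linarith) hrδ.le hz.1, hz.2⟩
  have hIcc : Icc (-r) r ⊆ Ioo (-δ) δ := Icc_subset_Ioo (by linarith) hrδ
  have hIoo : Ioo (-r) r ⊆ Ioo (-δ) δ := Ioo_subset_Icc_self.trans hIcc
  have hcd : ∀ x ∈ Ioo (-δ) δ, ContDiffAt ℝ ∞ c x := fun x hx =>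
    hcs.contDiffAt (isOpen_Ioo.mem_nhds hx)
  have hLs : tsupport (Δ F) ⊆ box x₀ u r ε := (tsupport_laplacian_subset F).trans hFb
  have hLc := (contDiff_laplacian hF).continuous
  have hint : Integrable fun z => p z * Δ F z :=
    integrable_mul_of_continuousAt_tsupport hLc (hasCompactSupport_laplacian hFs)
      fun z hz => hpc z (hbox (hLs hz))
  have hpLc : Continuous fun z => p z * Δ F z :=
    continuous_of_tsupport fun z hz =>
      (hpc z (hbox (hLs (tsupport_mul_subset_right hz)))).mul hLc.continuousAt
  rw [setIntegral_eq_integral_shear hu hDo.measurableSet hr hε (fun x hx => hc x (hIoo hx))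
    (fun x hx => hD x (hIoo hx))
    (fun z hz => hLs (subset_tsupport _ (right_ne_zero_of_mul hz))) hint.integrableOn]
  set R : Set (ℝ × ℝ) := Icc (-r) r ×ˢ Icc (-(2 * ε)) 0 with hR
  have hshc : ContinuousOn (shearMap x₀ u c) R := by
    refine (continuous_boxMap x₀ u).comp_continuousOn ?_
    have h1 : ContinuousOn (fun q : ℝ × ℝ => c q.1) R :=
      hcs.continuousOn.comp continuous_fst.continuousOn fun q hq => hIcc hq.1
    exact continuous_fst.continuousOn.prodMk (h1.add continuous_snd.continuousOn)
  have hmaps : ∀ q ∈ R, shearMap x₀ u c q ∈ box x₀ u δ ε → shearMap x₀ u c q ∈ closure D := by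
    intro q hq hqb
    have := (boxMap_mem_box hu).1 hqb
    exact hcl _ this.1 _ this.2 (by have := hq.2.2; simp only; linarith)
  -- Continuity up to the graph uses that `g` is continuous on the closure of `D`; outside the box
  -- the flux is locally zero.
  have hfluxc : ∀ v, ContinuousOn (fun q => greenFlux p g F v (shearMap x₀ u c q)) R := by
    intro v q hq
    by_cases hb : shearMap x₀ u c q ∈ box x₀ u δ ε
    · have hcw : ContinuousWithinAt (greenFlux p g F v) (closure D ∩ box x₀ u δ ε)
          (shearMap x₀ u c q) := by
        have h1 := (hpc _ hb).continuousWithinAt (s := closure D ∩ box x₀ u δ ε)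
        have h2 : Continuous fun z => fderiv ℝ F z v :=
          ((hF.fderiv_right (m := ∞) (by simp)).clm_apply contDiff_const).continuous
        have h3 := hgc _ ⟨hmaps q hq hb, hb⟩
        exact (h1.mul h2.continuousWithinAt).sub
          (hF.continuous.continuousWithinAt.mul (h3.inner continuousWithinAt_const))
      refine ContinuousWithinAt.comp_of_mem_nhdsWithin_image hcw (hshc q hq) ?_
      have hnb := (isOpen_box x₀ u δ ε).mem_nhds hb
      refine mem_nhdsWithin.2 ⟨box x₀ u δ ε, isOpen_box _ _ _ _, hb, ?_⟩
      rintro _ ⟨hz, q', hq', rfl⟩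
      exact ⟨hmaps q' hq' hz, hz⟩
    · have h0 := greenFlux_eventuallyEq_zero p g v (fun h => hb (hbox (hFb h)))
      have h1 : ContinuousAt (greenFlux p g F v) (shearMap x₀ u c q) :=
        (continuousAt_const (y := (0 : ℝ))).congr h0.symm
      exact h1.comp_continuousWithinAt (hshc q hq)
  have hdc : ContinuousOn (fun q : ℝ × ℝ => deriv c q.1) R := by
    refine ContinuousOn.comp (g := deriv c) (t := Ioo (-δ) δ) ?_ continuous_fst.continuousOn
      fun q hq => hIcc hq.1
    exact (hcs.continuousOn_deriv_of_isOpen isOpen_Ioo (by simp))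
  -- The components of the flux in the sheared coordinates; the shear preserves area, so the
  -- divergence is unchanged and the second derivative of `c` cancels against the mixed terms.
  set f₁ : ℝ × ℝ → ℝ := fun q => greenFlux p g F u (shearMap x₀ u c q) with hf₁
  set f₂ : ℝ × ℝ → ℝ := fun q => greenFlux p g F (u * Complex.I) (shearMap x₀ u c q) -
    deriv c q.1 * greenFlux p g F u (shearMap x₀ u c q) with hf₂
  have hint_pt : ∀ q ∈ Ioo (-r) r ×ˢ Ioo (-(2 * ε)) 0, shearMap x₀ u c q ∈ tsupport F →
      InnerProductSpace.HarmonicAt p (shearMap x₀ u c q) ∧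
        g =ᶠ[𝓝 (shearMap x₀ u c q)] gradient p := by
    intro q hq hz
    have hb := hbox (hFb hz)
    have hbm := (boxMap_mem_box hu).1 hb
    have hzD : shearMap x₀ u c q ∈ D :=
      (hD _ hbm.1 _ hbm.2).2 (by have := hq.2.2; simp only; linarith)
    refine ⟨hpD _ ⟨hzD, hb⟩, ?_⟩
    filter_upwards [(hDo.inter (isOpen_box x₀ u δ ε)).mem_nhds ⟨hzD, hb⟩] with w hw
    exact hg w hw
  have hder : ∀ q ∈ Ioo (-r) r ×ˢ Ioo (-(2 * ε)) 0, DifferentiableAt ℝ f₁ q ∧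
      DifferentiableAt ℝ f₂ q ∧ fderiv ℝ f₁ q (1, 0) + fderiv ℝ f₂ q (0, 1) =
        p (shearMap x₀ u c q) * Δ F (shearMap x₀ u c q) := by
    intro q hq
    obtain ⟨hdiff, hdiv⟩ := divergence_greenFlux hu hF (hint_pt q hq)
    have hcq := hcd q.1 (hIoo hq.1)
    obtain ⟨L, hL, hL1, hL2⟩ := hasFDerivAt_shearMap x₀ u (hcq.differentiableAt (by simp))
    have g1 : HasFDerivAt f₁ _ q := (hdiff u).hasFDerivAt.comp q hL
    have g2 : HasFDerivAt (fun q => greenFlux p g F (u * Complex.I) (shearMap x₀ u c q)) _ q :=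
      (hdiff (u * Complex.I)).hasFDerivAt.comp q hL
    have hdd : DifferentiableAt ℝ (deriv c) q.1 := by
      have := (hcs.deriv_of_isOpen (m := ∞) isOpen_Ioo (by simp)).contDiffAt
        (isOpen_Ioo.mem_nhds (hIoo hq.1))
      exact this.differentiableAt (by simp)
    have g3 : HasFDerivAt (fun q : ℝ × ℝ => deriv c q.1)
        (deriv (deriv c) q.1 • ContinuousLinearMap.fst ℝ ℝ ℝ) q :=
      hdd.hasDerivAt.comp_hasFDerivAt q hasFDerivAt_fst
    have g4 : HasFDerivAt f₂ _ q := g2.sub (g3.mul g1)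
    refine ⟨g1.differentiableAt, g4.differentiableAt, ?_⟩
    rw [g1.fderiv, g4.fderiv, ← hdiv]
    simp [hL1, hL2, -Complex.real_smul]
  -- On the bottom and the sides of the rectangle `F` vanishes; the top `s = 0` is the graph, where
  -- `p = 0` leaves only the term `-F ∇p`.
  have hdivth := integral2_divergence_prod_of_hasFDerivAt f₁ f₂ (fderiv ℝ f₁) (fderiv ℝ f₂)
    (-r) (-(2 * ε)) r 0 ?_ ?_ ?_ ?_ ?_
  · have hL : (∫ x in (-r)..r, ∫ s in (-(2 * ε))..0,
        p (boxMap x₀ u (x, c x + s)) * Δ F (boxMap x₀ u (x, c x + s))) =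
        ∫ x in (-r)..r, ∫ s in (-(2 * ε))..0, fderiv ℝ f₁ (x, s) (1, 0) + fderiv ℝ f₂ (x, s) (0, 1) := by
      rw [intervalIntegral.integral_of_le (by linarith),
        intervalIntegral.integral_of_le (by linarith), integral_Ioc_eq_integral_Ioo,
        integral_Ioc_eq_integral_Ioo]
      refine setIntegral_congr_fun measurableSet_Ioo fun x hx => ?_
      rw [intervalIntegral.integral_of_le (by linarith),
        intervalIntegral.integral_of_le (by linarith), integral_Ioc_eq_integral_Ioo,
        integral_Ioc_eq_integral_Ioo]
      refine setIntegral_congr_fun measurableSet_Ioo fun s hs => ?_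
      exact ((hder (x, s) ⟨hx, hs⟩).2.2).symm
    rw [hL, hdivth]
    have hz0 : ∀ v q, shearMap x₀ u c q ∉ box x₀ u r ε →
        greenFlux p g F v (shearMap x₀ u c q) = 0 := fun v q hq =>
      (greenFlux_eventuallyEq_zero p g v (fun h => hq (hFb h))).self_of_nhds
    have hside : ∀ x, x ∉ Ioo (-r) r → ∀ s, f₁ (x, s) = 0 := by
      intro x hx s
      refine hz0 _ _ fun h => hx ((boxMap_mem_box hu).1 h).1
    have hbot : ∀ x ∈ [[-r, r]], f₂ (x, -(2 * ε)) = 0 := by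
      intro x hx
      rw [uIcc_of_le (by linarith)] at hx
      have : shearMap x₀ u c (x, -(2 * ε)) ∉ box x₀ u r ε := fun h => by
        have h1 := ((boxMap_mem_box hu).1 h).2.1
        have h2 := (hc x (hIcc hx)).2
        simp only at h1
        linarith
      simp only [hf₂, hz0 _ _ this]
      ring
    rw [intervalIntegral.integral_congr hbot]
    simp only [hside r (by simp), hside (-r) (by simp), intervalIntegral.integral_zero, sub_zero,
      add_zero]
    rw [← intervalIntegral.integral_neg]
    refine intervalIntegral.integral_congr fun x hx => ?_
    rw [uIcc_of_le (by linarith)] at hx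
    have hnot : boxMap x₀ u (x, c x) ∉ D := fun h =>
      lt_irrefl _ ((hD x (hIcc hx) _ (hc x (hIcc hx))).1 h)
    simp only [hf₂, greenFlux, shearMap, add_zero, hp0 _ hnot]
    ring
  · rw [uIcc_of_le (by linarith), uIcc_of_le (by linarith)]
    exact hfluxc u
  · rw [uIcc_of_le (by linarith), uIcc_of_le (by linarith)]
    exact (hfluxc (u * Complex.I)).sub (hdc.mul (hfluxc u))
  · intro q hq
    rw [min_eq_left (by linarith), max_eq_right (by linarith), min_eq_left (by linarith),
      max_eq_right (by linarith)] at hq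
    exact (hder q hq).1.hasFDerivAt
  · intro q hq
    rw [min_eq_left (by linarith), max_eq_right (by linarith), min_eq_left (by linarith),
      max_eq_right (by linarith)] at hq
    exact (hder q hq).2.1.hasFDerivAt
  · rw [uIcc_of_le (by linarith), uIcc_of_le (by linarith)]
    have hci : IntegrableOn (fun q => p (shearMap x₀ u c q) * Δ F (shearMap x₀ u c q)) R :=
      (hpLc.comp_continuousOn hshc).integrableOn_compact (isCompact_Icc.prod isCompact_Icc)
    have hae : (Ioo (-r) r ×ˢ Ioo (-(2 * ε)) 0 : Set (ℝ × ℝ)) =ᵐ[volume] R :=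
      Measure.set_prod_ae_eq Ioo_ae_eq_Icc Ioo_ae_eq_Icc
    refine IntegrableOn.congr_set_ae ?_ hae.symm
    exact (hci.congr_set_ae hae).congr_fun (fun q hq => ((hder q hq).2.2).symm)
      (measurableSet_Ioo.prod measurableSet_Ioo)

/-! ### Test functions and Green potentials -/

theorem exists_contDiff_cutoff {K U : Set ℂ} (hK : IsCompact K) (hU : IsOpen U) (hKU : K ⊆ U) :
    ∃ χ : ℂ → ℝ, ContDiff ℝ ∞ χ ∧ HasCompactSupport χ ∧ tsupport χ ⊆ U ∧
      (∀ z ∈ K, ∀ᶠ w in 𝓝 z, χ w = 1) ∧ ∀ z, χ z ∈ Icc 0 1 := by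
  obtain ⟨L, hL, hKL, hLU⟩ := exists_compact_between hK hU hKU
  obtain ⟨f, hf1, hf0, hf⟩ := exists_contMDiffMap_one_nhds_of_subset_interior (n := ⊤)
    (modelWithCornersSelf ℝ ℂ) hK.isClosed hKL
  have hts : tsupport f ⊆ L := closure_minimal
    (fun z hz => by by_contra h; exact hz (hf0 z h)) hL.isClosed
  refine ⟨f, f.contMDiff.contDiff, hL.of_isClosed_subset (isClosed_tsupport _) hts, hts.trans hLU,
    fun z hz => ?_, hf⟩
  exact hf1.filter_mono (nhds_le_nhdsSet hz)

/-- An additive property of test functions which holds locally holds for all test functions. -/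
theorem forall_testFunction_of_locally {P : (ℂ → ℝ) → Prop} (h0 : P 0)
    (hadd : ∀ F G : ℂ → ℝ, ContDiff ℝ ∞ F → HasCompactSupport F → ContDiff ℝ ∞ G →
      HasCompactSupport G → P F → P G → P (F + G))
    (hloc : ∀ z, ∃ N : Set ℂ, IsOpen N ∧ z ∈ N ∧
      ∀ F : ℂ → ℝ, ContDiff ℝ ∞ F → HasCompactSupport F → tsupport F ⊆ N → P F)
    {F : ℂ → ℝ} (hF : ContDiff ℝ ∞ F) (hFs : HasCompactSupport F) : P F := by
  suffices h : ∃ U : Set ℂ, IsOpen U ∧ tsupport F ⊆ U ∧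
      ∀ F : ℂ → ℝ, ContDiff ℝ ∞ F → HasCompactSupport F → tsupport F ⊆ U → P F by
    obtain ⟨U, -, hFU, hU⟩ := h
    exact hU F hF hFs hFU
  refine IsCompact.induction_on hFs (p := fun s => ∃ U : Set ℂ, IsOpen U ∧ s ⊆ U ∧
      ∀ F : ℂ → ℝ, ContDiff ℝ ∞ F → HasCompactSupport F → tsupport F ⊆ U → P F) ?_ ?_ ?_ ?_
  · refine ⟨∅, isOpen_empty, subset_rfl, fun F _ _ h => ?_⟩
    rw [subset_empty_iff, tsupport_eq_empty_iff] at h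
    exact h ▸ h0
  · rintro s t hst ⟨U, hU, htU, h⟩
    exact ⟨U, hU, hst.trans htU, h⟩
  · rintro s t ⟨U, hU, hsU, h⟩ ⟨V, hV, htV, h'⟩
    refine ⟨U ∪ V, hU.union hV, union_subset_union hsU htV, fun F hF hFs hFUV => ?_⟩
    -- `χ` is `1` near the part of the support not covered by `V`, so `χ F` lives in `U` and `(1 -
    -- χ) F` in `V`.
    obtain ⟨χ, hχ, hχs, hχU, hχ1, -⟩ := exists_contDiff_cutoff (K := tsupport F \ V)
      (hFs.isCompact.diff hV) hU fun z hz => (hFUV hz.1).resolve_right hz.2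
    have h1 : ContDiff ℝ ∞ (χ * F) := hχ.mul hF
    have h1s : HasCompactSupport (χ * F) := hχs.mul_right
    have h2 : ContDiff ℝ ∞ ((1 - χ) * F) := (contDiff_const.sub hχ).mul hF
    have h2s : HasCompactSupport ((1 - χ) * F) := hFs.mul_left
    have e : F = χ * F + (1 - χ) * F := by ring
    rw [e]
    refine hadd _ _ h1 h1s h2 h2s (h _ h1 h1s ((tsupport_mul_subset_left).trans hχU))
      (h' _ h2 h2s fun z hz => ?_)
    by_contra hzV
    have := hχ1 z ⟨tsupport_mul_subset_right hz, hzV⟩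
    refine (notMem_tsupport_iff_eventuallyEq.2 ?_) hz
    filter_upwards [this] with w hw
    simp [hw]
  · intro z _
    obtain ⟨N, hN, hzN, h⟩ := hloc z
    exact ⟨N, mem_nhdsWithin_of_mem_nhds (hN.mem_nhds hzN), N, hN, subset_rfl, h⟩

theorem harmonicAt_log_norm_sub_sq {z ζ : ℂ} (hz : z ≠ ζ) :
    InnerProductSpace.HarmonicAt (fun w : ℂ => Real.log (‖w - ζ‖ ^ 2)) z := by
  have h := (AnalyticAt.harmonicAt_log_norm (f := fun w : ℂ => w - ζ) (z := z) (by fun_prop)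
    (sub_ne_zero.2 hz)).const_smul (c := (2 : ℝ))
  have e : (fun w : ℂ => Real.log (‖w - ζ‖ ^ 2)) = (2 : ℝ) • fun w : ℂ => Real.log ‖w - ζ‖ := by
    ext w; simp [Real.log_pow]
  rwa [e]

theorem harmonicAt_log_norm_sq {z : ℂ} (hz : z ≠ 0) :
    InnerProductSpace.HarmonicAt (fun w : ℂ => Real.log (‖w‖ ^ 2)) z := by
  simpa using harmonicAt_log_norm_sub_sq hz

theorem tendsto_log_norm_sq_nhdsNE_zero :
    Tendsto (fun w : ℂ => Real.log (‖w‖ ^ 2)) (𝓝[≠] 0) atBot := by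
  refine Real.tendsto_log_nhdsGT_zero.comp (tendsto_nhdsWithin_iff.2 ⟨?_, ?_⟩)
  · have : Tendsto (fun w : ℂ => ‖w‖ ^ 2) (𝓝 0) (𝓝 (‖(0 : ℂ)‖ ^ 2)) := by
      apply Continuous.tendsto; fun_prop
    exact (by simpa using this : Tendsto (fun w : ℂ => ‖w‖ ^ 2) (𝓝 0) (𝓝 0)).mono_left
      nhdsWithin_le_nhds
  · filter_upwards [self_mem_nhdsWithin] with w hw
    exact pow_pos (norm_pos_iff.2 hw) 2

namespace IsGreenPotential

variable {D : Set ℂ} {p : ℂ → ℝ}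

theorem exists_harmonicOnNhd (hp : IsGreenPotential D p) :
    ∃ h : ℂ → ℝ, InnerProductSpace.HarmonicOnNhd h D ∧
      ∀ z ∈ D, z ≠ 0 → D.indicator p z = -(1 / (4 * Real.pi)) * Real.log (‖z‖ ^ 2) + h z := by
  obtain ⟨h, hh, hph⟩ := hp.laplacian_eq
  refine ⟨h, hh, fun z hz hz0 => ?_⟩
  rw [indicator_of_mem hz, hph z hz hz0, Real.log_pow]
  field_simp
  push_cast
  ring

theorem harmonicAt_indicator (hp : IsGreenPotential D p) (hD : IsOpen D) {z : ℂ} (hz : z ∈ D)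
    (hz0 : z ≠ 0) : InnerProductSpace.HarmonicAt (D.indicator p) z := by
  obtain ⟨h, hh, hph⟩ := hp.exists_harmonicOnNhd
  have e : D.indicator p =ᶠ[𝓝 z]
      (-(1 / (4 * Real.pi)) : ℝ) • (fun w : ℂ => Real.log (‖w‖ ^ 2)) + h := by
    filter_upwards [hD.mem_nhds hz, isOpen_ne.mem_nhds hz0] with w hw hw0
    rw [hph w hw hw0]; rfl
  rw [InnerProductSpace.harmonicAt_congr_nhds e]
  exact (harmonicAt_log_norm_sq hz0).const_smul.add (hh z hz)

theorem continuousAt_indicator (hp : IsGreenPotential D p) (hD : IsOpen D) {z : ℂ} (hz0 : z ≠ 0) :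
    ContinuousAt (D.indicator p) z := by
  by_cases hz : z ∈ D
  · exact (hp.harmonicAt_indicator hD hz hz0).1.continuousAt
  by_cases hzc : z ∈ closure D
  · have hzf : z ∈ frontier D := by rw [hD.frontier_eq]; exact ⟨hzc, hz⟩
    have h1 : Tendsto (D.indicator p) (𝓝[D] z) (𝓝 0) :=
      (hp.boundary z hzf).congr' (by
        filter_upwards [self_mem_nhdsWithin] with w hw
        rw [indicator_of_mem hw])
    have h2 : Tendsto (D.indicator p) (𝓝[Dᶜ] z) (𝓝 0) :=
      tendsto_const_nhds.congr' (by
        filter_upwards [self_mem_nhdsWithin] with w hw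
        rw [indicator_of_notMem hw])
    have h3 := h1.sup h2
    rw [← nhdsWithin_union, union_compl_self, nhdsWithin_univ] at h3
    rwa [ContinuousAt, indicator_of_notMem hz]
  · refine (continuousAt_const (y := (0 : ℝ))).congr ?_
    filter_upwards [isClosed_closure.isOpen_compl.mem_nhds hzc] with w hw
    rw [indicator_of_notMem fun h => hw (subset_closure h)]

theorem locallyIntegrable_indicator (hp : IsGreenPotential D p) (hD : IsOpen D)
    (h0 : (0 : ℂ) ∈ D) : LocallyIntegrable (D.indicator p) := by
  intro z
  by_cases hz : z = 0
  · subst hz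
    obtain ⟨h, hh, hph⟩ := hp.exists_harmonicOnNhd
    have hh1 : IntegrableAtFilter h (𝓝 0) volume := by
      refine Measure.FiniteAtFilter.integrableAtFilter_of_tendsto ?_
        (volume.finiteAt_nhds 0) (hh 0 h0).1.continuousAt
      exact hh.continuousOn.stronglyMeasurableAtFilter hD 0 h0
    have h1 : IntegrableAtFilter
        (fun z => -(1 / (4 * Real.pi)) * Real.log (‖z‖ ^ 2) + h z) (𝓝 0) volume :=
      ((locallyIntegrable_log_norm_sq 0).smul (-(1 / (4 * Real.pi)) : ℝ)).add hh1
    obtain ⟨s, hs, hint⟩ := h1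
    obtain ⟨t, hts, hto, h0t⟩ := mem_nhds_iff.1 hs
    refine ⟨t ∩ D, (hto.inter hD).mem_nhds ⟨h0t, h0⟩, ?_⟩
    refine (hint.mono_set (inter_subset_left.trans hts)).congr ?_
    have hne : ∀ᵐ w : ℂ, w ≠ 0 := by simp [ae_iff, measure_singleton]
    filter_upwards [ae_restrict_of_ae hne, ae_restrict_mem (hto.inter hD).measurableSet]
      with w hw hwD
    exact (hph w hwD.2 hw).symm
  · refine Measure.FiniteAtFilter.integrableAtFilter_of_tendsto ?_
        (volume.finiteAt_nhds z) (hp.continuousAt_indicator hD hz)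
    exact ContinuousOn.stronglyMeasurableAtFilter isOpen_ne
      (fun w hw => (hp.continuousAt_indicator hD hw).continuousWithinAt) z hz

theorem integrable_indicator_mul (hp : IsGreenPotential D p) (hD : IsOpen D) (h0 : (0 : ℂ) ∈ D)
    {g : ℂ → ℝ} (hg : Continuous g) (hgs : HasCompactSupport g) :
    Integrable fun z => D.indicator p z * g z :=
  (hp.locallyIntegrable_indicator hD h0).integrable_smul_right_of_hasCompactSupport hg hgs

/-- `p → +∞` at the pole, so `p ≥ 0` on a small punctured disc; the maximum principle for `-p`,
extended by zero, covers the rest. -/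
theorem indicator_nonneg (hp : IsGreenPotential D p) (hD : IsOpen D) (h0 : (0 : ℂ) ∈ D)
    (hb : Bornology.IsBounded D) {z : ℂ} (hz : z ≠ 0) : 0 ≤ D.indicator p z := by
  by_cases hzD : z ∈ D
  swap
  · rw [indicator_of_notMem hzD]
  obtain ⟨h, hh, hph⟩ := hp.exists_harmonicOnNhd
  have hlim : Tendsto (fun w : ℂ => -(1 / (4 * Real.pi)) * Real.log (‖w‖ ^ 2) + h w)
      (𝓝[≠] 0) atTop := by
    refine Tendsto.atTop_add (C := h 0) ?_
      ((hh 0 h0).1.continuousAt.tendsto.mono_left nhdsWithin_le_nhds)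
    exact tendsto_log_norm_sq_nhdsNE_zero.const_mul_atBot_of_neg (by
      have := Real.pi_pos
      simp [this])
  have hev : ∀ᶠ w in 𝓝[≠] (0 : ℂ), 0 ≤ D.indicator p w := by
    filter_upwards [hlim.eventually_ge_atTop 0, self_mem_nhdsWithin,
      mem_nhdsWithin_of_mem_nhds (hD.mem_nhds h0)] with w hw hw0 hwD
    rw [hph w hwD hw0]
    exact hw
  rw [eventually_nhdsWithin_iff, Metric.eventually_nhds_iff] at hev
  obtain ⟨r, hr, hball⟩ := hev
  by_cases hzr : dist z 0 < r
  · exact hball hzr hz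
  have hK : IsCompact (closure D \ Metric.ball 0 (r / 2)) := hb.isCompact_closure.diff Metric.isOpen_ball
  have hne : ∀ w ∈ closure D \ Metric.ball 0 (r / 2), w ≠ 0 := by
    rintro w hw rfl
    exact hw.2 (Metric.mem_ball_self (half_pos hr))
  have := nonpos_of_submean hK (v := fun w => -D.indicator p w)
    (fun w hw => (hp.continuousAt_indicator hD (hne w hw)).neg.continuousWithinAt) ?_ ?_ z
    ⟨subset_closure hzD, fun h => hzr (lt_trans h (half_lt_self hr))⟩
  · linarith
  · intro w hw hpos
    have hwD : w ∈ D := by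
      by_contra hcon
      rw [indicator_of_notMem hcon] at hpos
      simp at hpos
    filter_upwards [circleAverage_eq_of_harmonicAt
      (hp.harmonicAt_indicator hD hwD (hne w (interior_subset hw))).neg] with s hs
    exact hs.ge
  · intro w hw
    by_cases hwD : w ∈ D
    · have hwr : dist w 0 ≤ r / 2 := by
        by_contra! hcon
        apply hw.2
        rw [mem_interior_iff_mem_nhds]
        filter_upwards [hD.mem_nhds hwD, Metric.isClosed_closedBall.isOpen_compl.mem_nhds
          (show w ∈ (Metric.closedBall 0 (r / 2))ᶜ by simpa using hcon)] with v hv hv2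
        exact ⟨subset_closure hv, fun h => hv2 (Metric.ball_subset_closedBall h)⟩
      exact neg_nonpos.2 (hball (by linarith) (hne w (hK.isClosed.frontier_subset hw)))
    · simp [indicator_of_notMem hwD]

end IsGreenPotential

/-! ### Transport along the strong flow -/

theorem ae_ne_zero : ∀ᵐ w : ℂ, w ≠ 0 := by simp [ae_iff, measure_singleton]

theorem laplacian_eq_zero_of_notMem_tsupport {F : ℂ → ℝ} {z : ℂ} (hz : z ∉ tsupport F) :
    Δ F z = 0 :=
  Function.notMem_support.1 fun h => hz (support_laplacian_subset F h)

theorem IsGreenPotential.integral_indicator_mul_laplacian_of_tsupport_subset {D : Set ℂ} {p : ℂ → ℝ}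
    (hp : IsGreenPotential D p) {F : ℂ → ℝ} (hF : ContDiff ℝ ∞ F)
    (hFs : HasCompactSupport F) (hFD : tsupport F ⊆ D) :
    ∫ z, D.indicator p z * Δ F z = -F 0 := by
  obtain ⟨h, hh, hph⟩ := hp.exists_harmonicOnNhd
  have hL := (contDiff_laplacian hF).continuous
  have hLs := hasCompactSupport_laplacian hFs
  have e : (fun z => D.indicator p z * Δ F z) =ᵐ[volume] fun z =>
      -(1 / (4 * Real.pi)) * (Real.log (‖0 - z‖ ^ 2) * Δ F z) + h z * Δ F z := by
    filter_upwards [ae_ne_zero] with z hz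
    by_cases hzF : z ∈ tsupport F
    · rw [hph z (hFD hzF) hz, zero_sub, norm_neg]
      ring
    · simp [laplacian_eq_zero_of_notMem_tsupport hzF]
  rw [integral_congr_ae e, integral_add ((integrable_log_norm_sub_sq_mul 0 hL hLs).const_mul _)
    (integrable_mul_of_continuousAt_tsupport hL hLs fun z hz =>
      (hh z (hFD (tsupport_laplacian_subset F hz))).1.continuousAt),
    integral_const_mul, integral_log_norm_sub_sq_mul_laplacian hF hFs,
    integral_harmonic_mul_laplacian hF hFs (hh.mono hFD)]
  have := Real.pi_pos
  field_simp
  ring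

theorem integrable_div_of_hasCompactSupport {F κ : ℂ → ℝ} (hF : Continuous F)
    (hFs : HasCompactSupport F) (hκ : Continuous κ) (hκ_pos : ∀ z, 0 < κ z) :
    Integrable fun z => F z / κ z :=
  (hF.div hκ fun z => (hκ_pos z).ne').integrable_of_hasCompactSupport (by
    simp_rw [div_eq_mul_inv]; exact hFs.mul_right)

/-- The transport of `∫ F / κ` along a strong Hele-Shaw flow, in terms of the Green potential. -/
theorem hasDerivAt_setIntegral_div {κ : ℂ → ℝ} (hκ : ContDiff ℝ ∞ κ) (hκ_pos : ∀ z, 0 < κ z)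
    {Ω : ℝ → Set ℂ} {a b : ℝ} (hΩ : IsSmoothFamily Ω a b) {t₀ : ℝ} (ht₀ : t₀ ∈ Ioo a b)
    (h0 : (0 : ℂ) ∈ Ω t₀) {p : ℂ → ℝ} (hp : IsGreenPotential (Ω t₀) p)
    (hV : ∀ x ∈ frontier (Ω t₀), ∃ V G : ℂ, HasNormalVelocity Ω t₀ x V ∧
      Tendsto (gradient p) (𝓝[Ω t₀] x) (𝓝 G) ∧ V = -(κ x • G))
    {F : ℂ → ℝ} (hF : ContDiff ℝ ∞ F) (hFs : HasCompactSupport F) :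
    HasDerivAt (fun t => ∫ z in Ω t, F z / κ z)
      (F 0 + ∫ z, (Ω t₀).indicator p z * Δ F z) t₀ := by
  have hD := hΩ.isOpen t₀ ht₀
  -- The claim is additive in `F`, so it suffices to treat supports in a graph box at a boundary
  -- point or in a small neighbourhood of a point off the boundary.
  refine forall_testFunction_of_locally (P := fun F => HasDerivAt (fun t => ∫ z in Ω t, F z / κ z)
      (F 0 + ∫ z, (Ω t₀).indicator p z * Δ F z) t₀) ?_ ?_ ?_ hF hFs
  · have : Δ (0 : ℂ → ℝ) = 0 := by
      ext z; exact laplacian_eq_zero_of_notMem_tsupport (by simp)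
    simp [this, hasDerivAt_const]
  · intro F G hF hFs hG hGs h1 h2
    have e1 : (fun t => ∫ z in Ω t, (F + G) z / κ z) =
        (fun t => ∫ z in Ω t, F z / κ z) + fun t => ∫ z in Ω t, G z / κ z := by
      ext t
      rw [Pi.add_apply, ← integral_add
        (integrable_div_of_hasCompactSupport hF.continuous hFs hκ.continuous hκ_pos).integrableOn
        (integrable_div_of_hasCompactSupport hG.continuous hGs hκ.continuous hκ_pos).integrableOn]
      simp [add_div]
    have e2 : ∫ z, (Ω t₀).indicator p z * Δ (F + G) z =
        (∫ z, (Ω t₀).indicator p z * Δ F z) + ∫ z, (Ω t₀).indicator p z * Δ G z := by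
      rw [← integral_add
        (hp.integrable_indicator_mul hD h0 (contDiff_laplacian hF).continuous
          (hasCompactSupport_laplacian hFs))
        (hp.integrable_indicator_mul hD h0 (contDiff_laplacian hG).continuous
          (hasCompactSupport_laplacian hGs))]
      congr 1
      ext z
      rw [(hF.contDiffAt.of_le ENat.LEInfty.out).laplacian_add
        (hG.contDiffAt.of_le ENat.LEInfty.out)]
      ring
    rw [e1, e2]
    have e3 : (F + G) 0 = F 0 + G 0 := rfl
    rw [e3, add_add_add_comm]
    exact h1.add h2
  · intro z
    by_cases hzf : z ∈ frontier (Ω t₀)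
    · have hz0 : z ≠ 0 := by
        rintro rfl
        rw [hD.frontier_eq] at hzf
        exact hzf.2 h0
      obtain ⟨u, γ, δ, ε, hB, hball, htab⟩ := hΩ.exists_isGraphBox ht₀ hzf (norm_pos_iff.2 hz0)
      have hδ := hB.delta_pos
      have hbox0 : ∀ w ∈ box z u δ ε, w ≠ 0 := by
        rintro w hw rfl
        simpa using hball hw
      have hrδ : δ / 2 < δ := by linarith
      refine ⟨box z u (δ / 2) ε, isOpen_box _ _ _ _, ?_, fun F hF hFs hFb => ?_⟩
      · simp [box, hδ, hB.eps_pos]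
      have hsub : box z u (δ / 2) ε ⊆ box z u δ ε := fun w hw =>
        ⟨Ioo_subset_Ioo (by linarith) hrδ.le hw.1, hw.2⟩
      have hF0 : F 0 = 0 := image_eq_zero_of_notMem_tsupport fun h => hbox0 _ (hsub (hFb h)) rfl
      -- The boundary limits of `∇p` provided by the strong flow make this extension continuous up
      -- to the boundary inside the box.
      set g := extendFrom (Ω t₀) (gradient p) with hg
      have hgrad : ∀ w ∈ Ω t₀, w ≠ 0 → ContinuousAt (gradient p) w ∧
          gradient p w = gradient ((Ω t₀).indicator p) w := by
        intro w hw hw0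
        have e : (Ω t₀).indicator p =ᶠ[𝓝 w] p := by
          filter_upwards [hD.mem_nhds hw] with v hv
          rw [indicator_of_mem hv]
        have hharm := hp.harmonicAt_indicator hD hw hw0
        rw [InnerProductSpace.harmonicAt_congr_nhds e] at hharm
        refine ⟨?_, ?_⟩
        · have := (hharm.1.fderiv_right (m := 1) (by norm_num)).continuousAt
          exact (InnerProductSpace.toDual ℝ ℂ).symm.continuous.continuousAt.comp this
        · rw [gradient, gradient, e.fderiv_eq]
      have hglim : ∀ w ∈ closure (Ω t₀) ∩ box z u δ ε,
          ∃ y, Tendsto (gradient p) (𝓝[Ω t₀] w) (𝓝 y) := by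
        intro w hw
        by_cases hwD : w ∈ Ω t₀
        · exact ⟨_, (hgrad w hwD (hbox0 w hw.2)).1.continuousWithinAt⟩
        · obtain ⟨V, G, -, hG, -⟩ := hV w (by rw [hD.frontier_eq]; exact ⟨hw.1, hwD⟩)
          exact ⟨G, hG⟩
      have hder := hB.hasDerivAt_setIntegral (fun t ht => hΩ.isOpen t (htab ht))
        (H := fun z => F z / κ z)
        (hF.continuous.div hκ.continuous fun z => (hκ_pos z).ne')
        (by simp_rw [div_eq_mul_inv]; exact hFs.mul_right)
        (by simp_rw [div_eq_mul_inv]; exact tsupport_mul_subset_left.trans hFb)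
      have hcs : ContDiffOn ℝ ∞ (fun x => γ (x, t₀)) (Ioo (-δ) δ) := fun x hx =>
        ((hB.contDiffAt hx hB.time_mem).comp x (by fun_prop)).contDiffWithinAt
      have hflux := setIntegral_mul_laplacian_eq_boundary hB.norm_eq hD (half_pos hδ) hrδ hB.eps_pos
        (c := fun x => γ (x, t₀)) hcs
        (fun x hx => hB.mem_Ioo x hx t₀ hB.time_mem)
        (fun x hx y hy => hB.mem_iff x hx y hy t₀ hB.time_mem)
        (fun x hx y hy hle => hB.mem_closure hx hy hB.time_mem hle)
        (p := (Ω t₀).indicator p) (g := g)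
        (fun w hw => indicator_of_notMem hw _)
        (fun w hw => hp.continuousAt_indicator hD (hbox0 w hw))
        (fun w hw => hp.harmonicAt_indicator hD hw.1 (hbox0 w hw.2))
        (fun w hw => by
          rw [hg, extendFrom_eq (subset_closure hw.1)
            (hgrad w hw.1 (hbox0 w hw.2)).1.continuousWithinAt]
          exact (hgrad w hw.1 (hbox0 w hw.2)).2)
        (continuousOn_extendFrom inter_subset_left hglim) hF hFs hFb
      rw [setIntegral_eq_integral_of_forall_compl_eq_zero (fun w hw => by
        rw [indicator_of_notMem hw, zero_mul])] at hflux
      rw [hF0, zero_add, hflux, ← intervalIntegral.integral_neg]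
      convert hder using 1
      -- The integrands agree pointwise: the graph velocity is expressed through `V = -κ G`, and `κ`
      -- cancels against the weight `1 / κ`.
      refine intervalIntegral.integral_congr fun x hx => ?_
      rw [uIcc_of_le (by linarith)] at hx
      have hx' : x ∈ Ioo (-δ) δ := ⟨by linarith [hx.1], by linarith [hx.2]⟩
      set w := boxMap z u (x, γ (x, t₀)) with hw
      have hwf : w ∈ frontier (Ω t₀) := hB.mem_frontier hx' hB.time_mem
      obtain ⟨V, G, hVw, hG, rfl⟩ := hV w hwf
      have hn := hB.inner_normalVelocity (fun t ht => hΩ.isOpen t (htab ht)) hx' hVw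
      have hgw : g w = G := extendFrom_eq (frontier_subset_closure hwf) hG
      have hdc : deriv (fun x => γ (x, t₀)) x = fderiv ℝ γ (x, t₀) (1, 0) := by
        have h1 : HasFDerivAt γ (fderiv ℝ γ (x, t₀)) (x, t₀) :=
          ((hB.contDiffAt hx' hB.time_mem).differentiableAt (by simp)).hasFDerivAt
        have h2 : HasDerivAt (fun x : ℝ => (x, t₀)) (1, 0) x :=
          (hasDerivAt_id x).prodMk (hasDerivAt_const x t₀)
        exact (h1.comp_hasDerivAt x h2).deriv
      rw [hgw, hdc, ← hn, inner_neg_left, inner_neg_left, real_inner_smul_left,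
        real_inner_smul_left]
      have := (hκ_pos w).ne'
      field_simp
      ring
    -- Off the boundary `Ω_t` is stationary on `K`, so the derivative is `0`. Inside, the Green
    -- integral is `-F 0`; outside, both `F 0` and the integral vanish.
    · obtain ⟨K, hK, hKt⟩ := hΩ.eventually_subset_or_disjoint ht₀ ⟨0, h0⟩ hzf
      obtain ⟨N, hNK, hN, hzN⟩ := mem_nhds_iff.1 hK
      refine ⟨N, hN, hzN, fun F hF hFs hFN => ?_⟩
      have hoff : ∀ w ∉ K, F w / κ w = 0 := fun w hw => by
        rw [image_eq_zero_of_notMem_tsupport fun h => hw (hNK (hFN h)), zero_div]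
      by_cases hzD : z ∈ Ω t₀
      · have hKΩ : K ⊆ Ω t₀ := hKt.self_of_nhds.1 hzD
        rw [hp.integral_indicator_mul_laplacian_of_tsupport_subset hF hFs
          (hFN.trans (hNK.trans hKΩ)), add_neg_cancel]
        refine (hasDerivAt_const t₀ (∫ z, F z / κ z)).congr_of_eventuallyEq ?_
        filter_upwards [hKt] with t ht
        exact setIntegral_eq_integral_of_forall_compl_eq_zero fun w hw =>
          hoff w fun h => hw (ht.1 hzD h)
      · have hKΩ : Disjoint K (Ω t₀) := hKt.self_of_nhds.2 hzD
        have hF0 : F 0 = 0 := image_eq_zero_of_notMem_tsupport fun h =>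
          disjoint_left.1 hKΩ (hNK (hFN h)) h0
        have e : ∀ w, (Ω t₀).indicator p w * Δ F w = 0 := by
          intro w
          by_cases hw : w ∈ tsupport F
          · rw [indicator_of_notMem (disjoint_left.1 hKΩ (hNK (hFN hw))), zero_mul]
          · rw [laplacian_eq_zero_of_notMem_tsupport hw, mul_zero]
        simp_rw [e, hF0]
        simp only [integral_zero, add_zero]
        refine (hasDerivAt_const t₀ (0 : ℝ)).congr_of_eventuallyEq ?_
        filter_upwards [hKt] with t ht
        exact setIntegral_eq_zero_of_forall_eq_zero fun w hw =>
          hoff w fun h => disjoint_left.1 (ht.2 hzD) h hw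

/-! ### Quadrature along the strong flow -/

/-- Points just above the graph are exterior, so the domain has no slits. This extends identities
from the exterior to the boundary by continuity. -/
theorem IsSmoothFamily.frontier_subset_closure_compl_closure {Ω : ℝ → Set ℂ} {a b : ℝ}
    (hΩ : IsSmoothFamily Ω a b) {t : ℝ} (ht : t ∈ Ioo a b) :
    frontier (Ω t) ⊆ closure (closure (Ω t))ᶜ := by
  intro z hzf
  obtain ⟨u, γ, δ, ε, hB, -, -⟩ := hΩ.exists_isGraphBox ht hzf one_pos
  have h0δ : (0 : ℝ) ∈ Ioo (-δ) δ := by simp [hB.delta_pos]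
  have h0ε : (0 : ℝ) ∈ Ioo (-ε) ε := by simp [hB.eps_pos]
  have hbz : boxMap z u (0, 0) = z := by simp [boxMap]
  have hγ : 0 = γ (0, t) := hB.eq_of_mem_frontier h0δ h0ε hB.time_mem
    (hΩ.isOpen t ht) (by rwa [hbz])
  have hc : Tendsto (fun y : ℝ => boxMap z u (0, y)) (𝓝[>] 0) (𝓝 z) := by
    have := ((continuous_boxMap z u).comp
      (by fun_prop : Continuous fun s : ℝ => ((0 : ℝ), s))).tendsto 0
    simp only [Function.comp_apply, hbz] at this
    exact this.mono_left nhdsWithin_le_nhds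
  refine mem_closure_of_tendsto hc ?_
  filter_upwards [Ioo_mem_nhdsGT hB.eps_pos] with y hy
  exact hB.mem_closure_compl_closure h0δ ⟨by linarith [hy.1, hB.eps_pos], hy.2⟩
    hB.time_mem (hγ ▸ hy.1)

theorem IsSmoothFamily.interior_closure_subset {Ω : ℝ → Set ℂ} {a b : ℝ}
    (hΩ : IsSmoothFamily Ω a b) {t : ℝ} (ht : t ∈ Ioo a b) :
    interior (closure (Ω t)) ⊆ Ω t := by
  intro z hz
  by_contra hzt
  have hzf : z ∈ frontier (Ω t) := by
    rw [(hΩ.isOpen t ht).frontier_eq]; exact ⟨interior_subset hz, hzt⟩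
  have := hΩ.frontier_subset_closure_compl_closure ht hzf
  rw [closure_compl] at this
  exact this hz

/-- A strong Hele-Shaw flow emanating from the origin, with the standing assumptions on the
permeability. -/
structure IsInjectionFlow (κ : ℂ → ℝ) (Ω : ℝ → Set ℂ) (b : ℝ) : Prop where
  contDiff : ContDiff ℝ ∞ κ
  pos : ∀ z, 0 < κ z
  integrable : ∀ z : ℂ, Integrable (fun ζ : ℂ => Real.log (‖z - ζ‖ ^ 2) / κ ζ)
  smoothFamily : IsSmoothFamily Ω 0 b
  preconnected : ∀ t ∈ Ioo 0 b, IsPreconnected (Ω t)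
  zero_mem : ∀ t ∈ Ioo 0 b, (0 : ℂ) ∈ Ω t
  monotoneOn : MonotoneOn Ω (Ioo 0 b)
  strong : IsStrongHeleShawFlow κ Ω 0 b
  shrinks : ∀ U ∈ 𝓝 (0 : ℂ), ∀ᶠ t in 𝓝[>] (0 : ℝ), Ω t ⊆ U

namespace IsInjectionFlow

variable {κ : ℂ → ℝ} {Ω : ℝ → Set ℂ} {b : ℝ}

theorem isLogDensity (h : IsInjectionFlow κ Ω b) : IsLogDensity fun z => (κ z)⁻¹ where
  measurable := h.contDiff.continuous.measurable.inv
  nonneg z := (inv_pos.2 (h.pos z)).le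
  locally_bounded R := by
    have hc : Continuous fun z => (κ z)⁻¹ := h.contDiff.continuous.inv₀ fun z => (h.pos z).ne'
    obtain ⟨C, hC⟩ := (isCompact_closedBall (0 : ℂ) R).bddAbove_image hc.continuousOn
    exact ⟨C, fun z hz => hC (mem_image_of_mem _ hz)⟩
  integrable_log z := by simpa only [div_eq_mul_inv] using h.integrable z

theorem isLogDensity_indicator (h : IsInjectionFlow κ Ω b) {t : ℝ} (ht : t ∈ Ioo 0 b) :
    IsLogDensity ((Ω t).indicator fun z => (κ z)⁻¹) :=
  h.isLogDensity.indicator (h.smoothFamily.isOpen t ht).measurableSet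

theorem tendsto_volume (h : IsInjectionFlow κ Ω b) :
    Tendsto (volume ∘ Ω) (𝓝[>] 0) (𝓝 0) := by
  rw [ENNReal.tendsto_nhds_zero]
  intro ε hε
  obtain ⟨U, hU, hUo, hUε⟩ := ({0} : Set ℂ).exists_isOpen_lt_of_lt ε (μ := volume) (by simpa)
  filter_upwards [h.shrinks U (hUo.mem_nhds (hU rfl))] with t ht
  exact (measure_mono ht).trans hUε.le

/-- The derivative is `∫ p_t ΔF`, nonnegative because both factors are so on `Ω_t`. -/
theorem exists_hasDerivAt (h : IsInjectionFlow κ Ω b) {t : ℝ} (ht : t ∈ Ioo 0 b) {F : ℂ → ℝ}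
    (hF : ContDiff ℝ ∞ F) (hFs : HasCompactSupport F) (hΔ : ∀ z ∈ Ω t, 0 ≤ Δ F z) :
    ∃ d, 0 ≤ d ∧ HasDerivAt (fun s => (∫ z in Ω s, F z / κ z) - s * F 0) d t := by
  obtain ⟨p, hp, hV⟩ := h.strong t ht
  have hd := hasDerivAt_setIntegral_div h.contDiff h.pos h.smoothFamily ht (h.zero_mem t ht) hp hV
    hF hFs
  refine ⟨∫ z, (Ω t).indicator p z * Δ F z, ?_, ?_⟩
  · refine integral_nonneg_of_ae ?_
    filter_upwards [ae_ne_zero] with z hz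
    by_cases hzt : z ∈ Ω t
    · exact mul_nonneg (hp.indicator_nonneg (h.smoothFamily.isOpen t ht) (h.zero_mem t ht)
        (h.smoothFamily.isBounded t ht) hz) (hΔ z hzt)
    · rw [indicator_of_notMem hzt, zero_mul]; rfl
  · have := hd.sub ((hasDerivAt_id t).mul_const (F 0))
    rw [one_mul, add_sub_cancel_left] at this
    exact this

theorem setIntegral_sub_le_of_hasCompactSupport (h : IsInjectionFlow κ Ω b) {t : ℝ}
    (ht : t ∈ Ioo 0 b) {F : ℂ → ℝ} (hF : ContDiff ℝ ∞ F) (hFs : HasCompactSupport F)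
    (hΔ : ∀ z ∈ Ω t, 0 ≤ Δ F z) {s : ℝ} (hs : s ∈ Ioc 0 t) :
    (∫ z in Ω s, F z / κ z) - s * F 0 ≤ (∫ z in Ω t, F z / κ z) - t * F 0 := by
  have hsub : Icc s t ⊆ Ioo 0 b := fun r hr => ⟨hs.1.trans_le hr.1, hr.2.trans_lt ht.2⟩
  have hd : ∀ r ∈ Icc s t, ∃ d, 0 ≤ d ∧
      HasDerivAt (fun s => (∫ z in Ω s, F z / κ z) - s * F 0) d r := fun r hr =>
    h.exists_hasDerivAt (hsub hr) hF hFs fun z hz =>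
      hΔ z (h.monotoneOn (hsub hr) ht hr.2 hz)
  refine monotoneOn_of_deriv_nonneg (convex_Icc s t)
    (f := fun s => (∫ z in Ω s, F z / κ z) - s * F 0) ?_ ?_ ?_
    (left_mem_Icc.2 hs.2) (right_mem_Icc.2 hs.2) hs.2
  · intro r hr
    obtain ⟨d, -, hd⟩ := hd r hr
    exact hd.continuousAt.continuousWithinAt
  · intro r hr
    obtain ⟨d, -, hd⟩ := hd r (interior_subset hr)
    exact hd.differentiableAt.differentiableWithinAt
  · intro r hr
    obtain ⟨d, hd0, hd⟩ := hd r (interior_subset hr)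
    rwa [hd.deriv]

/-- The monotone quantity is compared with its limit as `s → 0`, which is `0` because the area of
`Ω_s` tends to `0`. -/
theorem mul_le_setIntegral_of_hasCompactSupport (h : IsInjectionFlow κ Ω b) {t : ℝ}
    (ht : t ∈ Ioo 0 b) {F : ℂ → ℝ} (hF : ContDiff ℝ ∞ F) (hFs : HasCompactSupport F)
    (hΔ : ∀ z ∈ Ω t, 0 ≤ Δ F z) : t * F 0 ≤ ∫ z in Ω t, F z / κ z := by
  have h1 : Tendsto (fun s => (∫ z in Ω s, F z / κ z) - s * F 0) (𝓝[>] 0) (𝓝 (0 - 0 * F 0)) := by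
    refine Tendsto.sub ?_ ?_
    · exact (integrable_div_of_hasCompactSupport hF.continuous hFs h.contDiff.continuous
        h.pos).tendsto_setIntegral_nhds_zero h.tendsto_volume
    · exact ((continuous_id.mul continuous_const).tendsto 0).mono_left nhdsWithin_le_nhds
  have h2 : 0 - 0 * F 0 ≤ (∫ z in Ω t, F z / κ z) - t * F 0 := by
    refine le_of_tendsto h1 ?_
    filter_upwards [Ioc_mem_nhdsGT ht.1] with s hs
    exact h.setIntegral_sub_le_of_hasCompactSupport ht hF hFs hΔ hs
  linarith

theorem exists_testFunction (h : IsInjectionFlow κ Ω b) {t : ℝ} (ht : t ∈ Ioo 0 b) {O : Set ℂ}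
    (hO : IsOpen O) (htO : closure (Ω t) ⊆ O) {f : ℂ → ℝ} (hf : ContDiffOn ℝ ∞ f O) :
    ∃ F : ℂ → ℝ, ContDiff ℝ ∞ F ∧ HasCompactSupport F ∧ ∀ z ∈ closure (Ω t), F =ᶠ[𝓝 z] f := by
  obtain ⟨χ, hχ, hχs, hχO, hχ1, -⟩ := exists_contDiff_cutoff
    (h.smoothFamily.isBounded t ht).isCompact_closure hO htO
  refine ⟨fun z => χ z * f z, ?_, hχs.mul_right, fun z hz => ?_⟩
  · refine contDiff_iff_contDiffAt.2 fun z => ?_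
    by_cases hz : z ∈ tsupport χ
    · exact hχ.contDiffAt.mul (hf.contDiffAt (hO.mem_nhds (hχO hz)))
    · refine (contDiffAt_const (c := (0 : ℝ))).congr_of_eventuallyEq ?_
      filter_upwards [notMem_tsupport_iff_eventuallyEq.1 hz] with w hw
      rw [hw, Pi.zero_apply, zero_mul]
  · filter_upwards [hχ1 z hz] with w hw
    rw [hw, one_mul]

/-- Along the flow, `∫ f / κ - s f(0)` increases if `f` is subharmonic. -/
theorem setIntegral_sub_le (h : IsInjectionFlow κ Ω b) {t : ℝ} (ht : t ∈ Ioo 0 b) {O : Set ℂ}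
    (hO : IsOpen O) (htO : closure (Ω t) ⊆ O) {f : ℂ → ℝ} (hf : ContDiffOn ℝ ∞ f O)
    (hΔ : ∀ z ∈ Ω t, 0 ≤ Δ f z) {s : ℝ} (hs : s ∈ Ioc 0 t) :
    (∫ z in Ω s, f z / κ z) - s * f 0 ≤ (∫ z in Ω t, f z / κ z) - t * f 0 := by
  obtain ⟨F, hF, hFs, he⟩ := h.exists_testFunction ht hO htO hf
  have hs' : s ∈ Ioo 0 b := ⟨hs.1, hs.2.trans_lt ht.2⟩
  have he' : ∀ z ∈ Ω t, F z = f z := fun z hz => (he z (subset_closure hz)).self_of_nhds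
  have := h.setIntegral_sub_le_of_hasCompactSupport ht hF hFs (fun z hz => by
    rw [(InnerProductSpace.laplacian_congr_nhds (he z (subset_closure hz))).self_of_nhds]
    exact hΔ z hz) hs
  rw [he' 0 (h.zero_mem t ht)] at this
  have e1 : ∫ z in Ω s, F z / κ z = ∫ z in Ω s, f z / κ z :=
    setIntegral_congr_fun (h.smoothFamily.isOpen s hs').measurableSet fun z hz =>
      congrArg (· / κ z) (he' z (h.monotoneOn hs' ht hs.2 hz))
  have e2 : ∫ z in Ω t, F z / κ z = ∫ z in Ω t, f z / κ z :=
    setIntegral_congr_fun (h.smoothFamily.isOpen t ht).measurableSet fun z hz =>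
      congrArg (· / κ z) (he' z hz)
  rwa [e1, e2] at this

theorem mul_le_setIntegral (h : IsInjectionFlow κ Ω b) {t : ℝ} (ht : t ∈ Ioo 0 b) {O : Set ℂ}
    (hO : IsOpen O) (htO : closure (Ω t) ⊆ O) {f : ℂ → ℝ} (hf : ContDiffOn ℝ ∞ f O)
    (hΔ : ∀ z ∈ Ω t, 0 ≤ Δ f z) : t * f 0 ≤ ∫ z in Ω t, f z / κ z := by
  obtain ⟨F, hF, hFs, he⟩ := h.exists_testFunction ht hO htO hf
  have he' : ∀ z ∈ Ω t, F z = f z := fun z hz => (he z (subset_closure hz)).self_of_nhds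
  have := h.mul_le_setIntegral_of_hasCompactSupport ht hF hFs (fun z hz => by
    rw [(InnerProductSpace.laplacian_congr_nhds (he z (subset_closure hz))).self_of_nhds]
    exact hΔ z hz)
  have e2 : ∫ z in Ω t, F z / κ z = ∫ z in Ω t, f z / κ z :=
    setIntegral_congr_fun (h.smoothFamily.isOpen t ht).measurableSet fun z hz =>
      congrArg (· / κ z) (he' z hz)
  rwa [he' 0 (h.zero_mem t ht), e2] at this

/-- The quadrature identity for harmonic functions. -/
theorem setIntegral_eq_of_harmonicOnNhd (h : IsInjectionFlow κ Ω b) {t : ℝ} (ht : t ∈ Ioo 0 b)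
    {O : Set ℂ} (hO : IsOpen O) (htO : closure (Ω t) ⊆ O) {f : ℂ → ℝ}
    (hf : InnerProductSpace.HarmonicOnNhd f O) : ∫ z in Ω t, f z / κ z = t * f 0 := by
  have hc : ContDiffOn ℝ ∞ f O := fun z hz =>
    (HarmonicAt.analyticAt (hf z hz)).contDiffAt.contDiffWithinAt
  have h0 : ∀ z ∈ Ω t, Δ f z = 0 := fun z hz => (hf z (htO (subset_closure hz))).2.self_of_nhds
  refine le_antisymm ?_ (h.mul_le_setIntegral ht hO htO hc fun z hz => (h0 z hz).ge)
  -- For harmonic `f` the inequality also applies to `-f`.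
  have := h.mul_le_setIntegral ht hO htO hc.neg fun z hz => by
    have e := InnerProductSpace.laplacian_neg (f := f)
    have e' : (fun x => -f x) = -f := rfl
    rw [e', e, Pi.neg_apply, h0 z hz, neg_zero]
  simp only [neg_div, integral_neg] at this
  linarith

/-- The difference `Q_t` between the logarithmic potential of `1 / κ` on `Ω_t` and that of the point
mass `t δ₀`. -/
noncomputable def excess (κ : ℂ → ℝ) (Ω : ℝ → Set ℂ) (t : ℝ) (z : ℂ) : ℝ :=
  logPotential ((Ω t).indicator fun z => (κ z)⁻¹) z - t * Real.log (‖z‖ ^ 2)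

/-! ### Monotonicity, support and sign of the excess -/

theorem logPotential_indicator_eq (h : IsInjectionFlow κ Ω b) {t : ℝ} (ht : t ∈ Ioo 0 b) (z : ℂ) :
    logPotential ((Ω t).indicator fun z => (κ z)⁻¹) z =
      ∫ ζ in Ω t, Real.log (‖z - ζ‖ ^ 2) / κ ζ := by
  rw [logPotential, ← integral_indicator (h.smoothFamily.isOpen t ht).measurableSet]
  congr 1
  ext ζ
  by_cases hζ : ζ ∈ Ω t <;> simp [hζ, div_eq_mul_inv]

theorem continuousAt_excess (h : IsInjectionFlow κ Ω b) {t : ℝ} (ht : t ∈ Ioo 0 b) {z : ℂ}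
    (hz : z ≠ 0) : ContinuousAt (excess κ Ω t) z :=
  (h.isLogDensity_indicator ht).continuous_logPotential.continuousAt.sub
    (continuousAt_const.mul (continuousAt_log_norm_sq hz))

theorem tendsto_setIntegral_log_add (h : IsInjectionFlow κ Ω b) {t : ℝ} (ht : t ∈ Ioo 0 b) (z : ℂ) :
    Tendsto (fun c : ℝ => ∫ ζ in Ω t, Real.log (‖z - ζ‖ ^ 2 + (c ^ 2)⁻¹) / κ ζ) atTop
      (𝓝 (∫ ζ in Ω t, Real.log (‖z - ζ‖ ^ 2) / κ ζ)) := by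
  refine tendsto_integral_filter_of_dominated_convergence
    (fun ζ => |Real.log (‖z - ζ‖ ^ 2) / κ ζ| + Real.log (1 + ‖z - ζ‖ ^ 2) / κ ζ) ?_ ?_ ?_ ?_
  · filter_upwards with c
    exact ((by fun_prop : Measurable fun ζ : ℂ => Real.log (‖z - ζ‖ ^ 2 + (c ^ 2)⁻¹)).div
      h.contDiff.continuous.measurable).aestronglyMeasurable
  · filter_upwards [eventually_ge_atTop (1 : ℝ)] with c hc
    filter_upwards [ae_restrict_of_ae (ae_norm_sub_sq_pos z)] with ζ hζ
    rw [norm_div, abs_div, Real.norm_eq_abs, Real.norm_eq_abs, abs_of_pos (h.pos ζ), ← add_div]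
    have := h.pos ζ
    gcongr
    exact abs_log_add_le hζ (by positivity) (inv_le_one_of_one_le₀ (one_le_pow₀ hc))
  · refine (h.integrable z).integrableOn.abs.add ?_
    have hc : Continuous fun ζ : ℂ => Real.log (1 + ‖z - ζ‖ ^ 2) / κ ζ :=
      (Continuous.log (by fun_prop) fun ζ => by positivity).div h.contDiff.continuous
        fun ζ => (h.pos ζ).ne'
    exact (hc.continuousOn.integrableOn_compact
      (h.smoothFamily.isBounded t ht).isCompact_closure).mono_set subset_closure
  · filter_upwards [ae_restrict_of_ae (ae_norm_sub_sq_pos z)] with ζ hζ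
    exact (tendsto_log_add_inv_sq _ hζ).div_const _

/-- The monotone quantity for the subharmonic function `ζ ↦ log (|z - ζ|² + ε)` converges to the
excess at `z` as `ε → 0`. -/
theorem excess_mono (h : IsInjectionFlow κ Ω b) {t : ℝ} (ht : t ∈ Ioo 0 b) {s : ℝ}
    (hs : s ∈ Ioc 0 t) {z : ℂ} (hz : z ≠ 0) : excess κ Ω s z ≤ excess κ Ω t z := by
  have hs' : s ∈ Ioo 0 b := ⟨hs.1, hs.2.trans_lt ht.2⟩
  have hlog : ∀ r : ℝ, Tendsto (fun c : ℝ => r * Real.log (‖z - 0‖ ^ 2 + (c ^ 2)⁻¹)) atTop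
      (𝓝 (r * Real.log (‖z‖ ^ 2))) := fun r => by
    rw [sub_zero]
    exact (tendsto_log_add_inv_sq _ (pow_pos (norm_pos_iff.2 hz) 2)).const_mul r
  rw [excess, excess, h.logPotential_indicator_eq ht, h.logPotential_indicator_eq hs']
  refine le_of_tendsto_of_tendsto ((h.tendsto_setIntegral_log_add hs' z).sub (hlog s))
    ((h.tendsto_setIntegral_log_add ht z).sub (hlog t)) ?_
  filter_upwards [eventually_gt_atTop (0 : ℝ)] with c hc
  refine h.setIntegral_sub_le ht isOpen_univ (subset_univ _)
    (f := fun ζ => Real.log (‖z - ζ‖ ^ 2 + (c ^ 2)⁻¹))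
    (contDiff_log_norm_sub_sq_add z (by positivity) (n := ⊤)).contDiffOn (fun ζ _ => ?_) hs
  rw [laplacian_log_norm_sub_sq_add z (by positivity)]
  positivity

/-- For `z` outside the closure, `log |z - ζ|²` is harmonic in `ζ` near the closure, and the claim
is the quadrature identity; boundary points are limits of exterior ones. -/
theorem excess_eq_zero (h : IsInjectionFlow κ Ω b) {t : ℝ} (ht : t ∈ Ioo 0 b) {z : ℂ}
    (hz : z ∉ Ω t) : excess κ Ω t z = 0 := by
  have hext : ∀ z ∉ closure (Ω t), excess κ Ω t z = 0 := by
    intro z hz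
    rw [excess, h.logPotential_indicator_eq ht,
      h.setIntegral_eq_of_harmonicOnNhd ht (O := {z}ᶜ) isOpen_compl_singleton
        (fun w hw hwz => hz (hwz ▸ hw)) (f := fun ζ => Real.log (‖z - ζ‖ ^ 2)) fun w hw => by
          simp_rw [norm_sub_rev z]
          exact harmonicAt_log_norm_sub_sq hw]
    simp
  by_cases hzc : z ∈ closure (Ω t)
  swap
  · exact hext z hzc
  have hz0 : z ≠ 0 := by rintro rfl; exact hz (h.zero_mem t ht)
  have hzf : z ∈ frontier (Ω t) := by
    rw [(h.smoothFamily.isOpen t ht).frontier_eq]; exact ⟨hzc, hz⟩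
  have hcl := h.smoothFamily.frontier_subset_closure_compl_closure ht hzf
  have h1 := (h.continuousAt_excess ht hz0).continuousWithinAt (s := (closure (Ω t))ᶜ)
  have h2 := h1.mem_closure (t := {0}) hcl fun w hw => hext w hw
  simpa using h2

/-- At a sufficiently early time `s` the point `z` has not yet been reached, so the excess is `0`
there and can only grow. -/
theorem excess_nonneg (h : IsInjectionFlow κ Ω b) {t : ℝ} (ht : t ∈ Ioo 0 b) {z : ℂ}
    (hz : z ≠ 0) : 0 ≤ excess κ Ω t z := by
  obtain ⟨s, hs, hst⟩ := ((h.shrinks {z}ᶜ (isOpen_compl_singleton.mem_nhds hz.symm)).and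
    (Ioc_mem_nhdsGT ht.1)).exists
  rw [← h.excess_eq_zero (t := s) ⟨hst.1, hst.2.trans_lt ht.2⟩ fun hzs => hs hzs rfl]
  exact h.excess_mono ht hst hz

end IsInjectionFlow

/-- A non-negative harmonic function on a punctured domain with a positive pole is positive. -/
theorem pos_of_harmonicAt_of_tendsto_atTop {U : Set ℂ} (hU : IsOpen U) (hc : IsPreconnected U)
    (h0 : (0 : ℂ) ∈ U) {v : ℂ → ℝ}
    (hv : ∀ z ∈ U, z ≠ 0 → InnerProductSpace.HarmonicAt v z) (hnn : ∀ z ∈ U, z ≠ 0 → 0 ≤ v z)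
    (hlim : Tendsto v (𝓝[≠] 0) atTop) {z : ℂ} (hz : z ∈ U) (hz0 : z ≠ 0) : 0 < v z := by
  by_contra! hcon
  have hvz : v z = 0 := le_antisymm hcon (hnn z hz hz0)
  have hlim' := hlim.eventually_gt_atTop 0
  -- The zero set is open by the mean value property and relatively closed in `U`, since `v > 0`
  -- near the pole; if nonempty it would be all of `U`, including `0`.
  set E : Set ℂ := {w | w ∈ U ∧ w ≠ 0 ∧ v w = 0} with hE
  have hEo : IsOpen E := by
    rw [isOpen_iff_mem_nhds]
    rintro w ⟨hwU, hw0, hvw⟩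
    have hmean := circleAverage_eq_of_harmonicAt (hv w hwU hw0)
    rw [eventually_nhdsWithin_iff, Metric.eventually_nhds_iff] at hmean
    obtain ⟨r₁, hr₁, hmean⟩ := hmean
    obtain ⟨r₂, hr₂, hball⟩ := Metric.isOpen_iff.1 (hU.inter (isOpen_compl_singleton (x := (0 : ℂ))))
      w ⟨hwU, hw0⟩
    refine Metric.mem_nhds_iff.2 ⟨min r₁ r₂, lt_min hr₁ hr₂, fun x hx => ?_⟩
    rcases eq_or_ne x w with rfl | hxw
    · exact ⟨hwU, hw0, hvw⟩
    have hx1 : dist x w < r₁ := hx.trans_le (min_le_left _ _)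
    have hx2 : dist x w < r₂ := hx.trans_le (min_le_right _ _)
    refine ⟨(hball hx2).1, (hball hx2).2, ?_⟩
    by_contra hvx
    have hsph : ∀ y ∈ Metric.sphere w (dist x w), y ∈ U ∧ y ≠ 0 := fun y hy =>
      hball (show dist y w < r₂ by rw [Metric.mem_sphere.1 hy]; exact hx2)
    have hd : 0 < dist x w := dist_pos.2 hxw
    have := circleAverage_lt_of_le_of_exists_lt (v := fun y => -v y) (M := 0) hd
      (fun y hy => (hv y (hsph y hy).1 (hsph y hy).2).1.continuousAt.neg.continuousWithinAt)
      (fun y hy => neg_nonpos.2 (hnn y (hsph y hy).1 (hsph y hy).2))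
      ⟨x, rfl, neg_neg_of_pos (lt_of_le_of_ne (hnn x (hball hx2).1 (hball hx2).2) (Ne.symm hvx))⟩
    have e := hmean (y := dist x w) (by rw [Real.dist_eq, sub_zero, abs_of_pos hd]; exact hx1) hd
    have e2 : Real.circleAverage (fun y => -v y) w (dist x w) =
        -Real.circleAverage v w (dist x w) := by
      simp [Real.circleAverage, intervalIntegral.integral_neg]
    rw [e2, e, hvw, neg_zero] at this
    exact lt_irrefl _ this
  have hsub := hc.subset_of_closure_inter_subset hEo ⟨z, hz, hz, hz0, hvz⟩ (by
    rintro w ⟨hwE, hwU⟩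
    have hw0 : w ≠ 0 := by
      rintro rfl
      rw [eventually_nhdsWithin_iff] at hlim'
      obtain ⟨x, hx, hxE⟩ := mem_closure_iff_frequently.1 hwE |>.and_eventually hlim' |>.exists
      exact (hxE hx.2.1).ne' hx.2.2
    refine ⟨hwU, hw0, ?_⟩
    have := ((hv w hwU hw0).1.continuousAt.continuousWithinAt (s := E)).mem_closure (t := {0}) hwE
      fun x hx => hx.2.2
    simpa using this)
  exact (hsub h0).2.1 rfl

/-! ### Subharmonicity across a logarithmic pole -/

theorem IsLogDensity.logPotential_sub {m m' : ℂ → ℝ} (hm : IsLogDensity m) (hm' : IsLogDensity m')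
    (z : ℂ) : logPotential (m - m') z = logPotential m z - logPotential m' z := by
  rw [logPotential, logPotential, logPotential,
    ← integral_sub (hm.integrable_log z) (hm'.integrable_log z)]
  simp [mul_sub]

theorem upperSemicontinuous_of_tendsto_atBot {w : ℂ → ℝ} (hw : ∀ z ≠ 0, ContinuousAt w z)
    (hlim : Tendsto w (𝓝[≠] 0) atBot) :
    UpperSemicontinuous fun z => if z = 0 then ⊥ else (w z : EReal) := by
  intro z
  rcases eq_or_ne z 0 with rfl | hz
  · intro y hy
    simp only [if_true] at hy
    obtain ⟨c, -, hcy⟩ := EReal.lt_iff_exists_real_btwn.1 hy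
    have := hlim.eventually_lt_atBot c
    rw [eventually_nhdsWithin_iff] at this
    filter_upwards [this] with x hx
    split_ifs with hx0
    · exact hy
    · exact (EReal.coe_lt_coe_iff.2 (hx hx0)).trans hcy
  · refine ContinuousAt.upperSemicontinuousAt ?_
    refine ((continuous_coe_real_ereal.continuousAt.comp (hw z hz))).congr ?_
    filter_upwards [isOpen_ne.mem_nhds hz] with x hx
    rw [if_neg hx]; rfl

/-- A function with a pole `-∞` at the origin which is continuous and satisfies the submean
inequality elsewhere is subharmonic. -/
theorem isSubharmonic_of_submean {w : ℂ → ℝ} (hw : ∀ z ≠ 0, ContinuousAt w z)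
    (hlim : Tendsto w (𝓝[≠] 0) atBot)
    (hsub : ∀ z ≠ 0, ∀ᶠ r in 𝓝[>] (0 : ℝ), w z ≤ Real.circleAverage w z r) :
    IsSubharmonic fun z => if z = 0 then ⊥ else (w z : EReal) where
  usc := upperSemicontinuous_of_tendsto_atBot hw hlim
  lt_top z := by
    split_ifs
    · exact bot_lt_top
    · exact EReal.coe_lt_top _
  le_of_le_frontier K h hK hh hharm hfr := by
    -- The truncated difference is continuous even at the pole, where `w → -∞` makes it vanish
    -- nearby, so the maximum principle for continuous functions applies.
    have hsp : ∀ z ∈ K, (if z = 0 then 0 else max (w z - h z) 0) ≤ 0 := by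
      refine nonpos_of_submean hK (v := fun z => if z = 0 then 0 else max (w z - h z) 0) ?_ ?_ ?_
      · intro z hz
        rcases eq_or_ne z 0 with rfl | hz0
        · refine (continuousWithinAt_const (b := (0 : ℝ))).congr_of_eventuallyEq ?_ (by simp)
          have h1 : ∀ᶠ x in 𝓝[K] 0, h 0 - 1 < h x :=
            (hh 0 hz).eventually (lt_mem_nhds (by linarith))
          have h2 := hlim.eventually_lt_atBot (h 0 - 1)
          rw [eventually_nhdsWithin_iff] at h2
          filter_upwards [h1, nhdsWithin_le_nhds h2] with x hx1 hx2
          split_ifs with hx0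
          · rfl
          · exact max_eq_right (by linarith [hx2 hx0])
        · have : ContinuousWithinAt (fun y => max (w y - h y) 0) K z :=
            ((hw z hz0).continuousWithinAt.sub (hh z hz)).sup continuousWithinAt_const
          refine this.congr_of_eventuallyEq ?_ (if_neg hz0)
          filter_upwards [nhdsWithin_le_nhds (isOpen_ne.mem_nhds hz0)] with x hx
          rw [if_neg hx]
      · intro z hz hpos
        have hz0 : z ≠ 0 := by rintro rfl; simp at hpos
        simp only [if_neg hz0] at hpos ⊢
        have hpos' : 0 < w z - h z := by simpa using hpos
        obtain ⟨ρ, hρ, hball⟩ := Metric.isOpen_iff.1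
          (isOpen_interior.inter (isOpen_compl_singleton (x := (0 : ℂ)))) z ⟨hz, hz0⟩
        filter_upwards [hsub z hz0, circleAverage_eq_of_harmonicAt (hharm z hz),
          Ioo_mem_nhdsGT hρ] with r hr1 hr2 hr
        have hsph : ∀ y ∈ Metric.sphere z |r|, y ∈ interior K ∧ y ≠ 0 := fun y hy =>
          hball (show dist y z < ρ by rw [Metric.mem_sphere.1 hy, abs_of_pos hr.1]; exact hr.2)
        have hcw : ContinuousOn w (Metric.sphere z |r|) := fun y hy =>
          (hw y (hsph y hy).2).continuousWithinAt
        have hch : ContinuousOn h (Metric.sphere z |r|) := fun y hy =>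
          (hharm y (hsph y hy).1).1.continuousAt.continuousWithinAt
        rw [max_eq_left hpos'.le]
        calc w z - h z ≤ Real.circleAverage w z r - Real.circleAverage h z r := by
              rw [hr2]; linarith
          _ = Real.circleAverage (w - h) z r := (Real.circleAverage_sub
              hcw.circleIntegrable' hch.circleIntegrable').symm
          _ ≤ _ := by
              refine Real.circleAverage_mono (hcw.sub hch).circleIntegrable' ?_ ?_
              · refine ContinuousOn.circleIntegrable' ?_
                have : ContinuousOn (fun y => max (w y - h y) 0) (Metric.sphere z |r|) :=
                  (hcw.sub hch).sup continuousOn_const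
                exact this.congr fun y hy => if_neg (hsph y hy).2
              · intro y hy
                rw [if_neg (hsph y hy).2]
                exact le_max_left _ _
      · intro z hz
        split_ifs with hz0
        · exact le_rfl
        · have := hfr z hz
          rw [if_neg hz0, EReal.coe_le_coe_iff] at this
          exact max_le (by linarith) le_rfl
    intro z hz
    split_ifs with hz0
    · exact bot_le
    · have := hsp z hz
      rw [if_neg hz0] at this
      rw [EReal.coe_le_coe_iff]
      linarith [le_max_left (w z - h z) 0]

namespace IsInjectionFlow

variable {κ : ℂ → ℝ} {Ω : ℝ → Set ℂ} {b : ℝ}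

/-- For `s < t` close enough to `t` the point still lies in `Ω_s`. There `Q_t - Q_s` is the
potential of the mass in `Ω_t \ Ω_s` minus `(t - s) log |w|²`: nonnegative, harmonic off `0`, with a
positive pole, hence positive. -/
theorem excess_pos (h : IsInjectionFlow κ Ω b) {t : ℝ} (ht : t ∈ Ioo 0 b) {z : ℂ}
    (hz : z ∈ Ω t) (hz0 : z ≠ 0) : 0 < excess κ Ω t z := by
  have hzf : z ∉ frontier (Ω t) := by
    rw [(h.smoothFamily.isOpen t ht).frontier_eq]; exact fun h => h.2 hz
  obtain ⟨K, hK, hKt⟩ := h.smoothFamily.eventually_subset_or_disjoint ht ⟨z, hz⟩ hzf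
  obtain ⟨s, hs, hst⟩ := ((hKt.filter_mono (nhdsWithin_le_nhds (s := Iio t))).and
    (Ioo_mem_nhdsLT ht.1)).exists
  have hzs : z ∈ Ω s := hs.1 hz (mem_of_mem_nhds hK)
  have hs' : s ∈ Ioo 0 b := ⟨hst.1, hst.2.trans ht.2⟩
  have hsub : Ω s ⊆ Ω t := h.monotoneOn hs' ht hst.2.le
  have hm := h.isLogDensity_indicator ht
  have hm' := h.isLogDensity_indicator hs'
  have hso := h.smoothFamily.isOpen s hs'
  have hdiff : ((Ω t).indicator fun z => (κ z)⁻¹) - (Ω s).indicator (fun z => (κ z)⁻¹) =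
      (Ω t \ Ω s).indicator fun z => (κ z)⁻¹ := by
    ext w
    by_cases hw : w ∈ Ω s
    · simp [hw, hsub hw]
    · by_cases hw' : w ∈ Ω t <;> simp [hw, hw']
  have hmd : IsLogDensity ((Ω t \ Ω s).indicator fun z => (κ z)⁻¹) :=
    h.isLogDensity.indicator ((h.smoothFamily.isOpen t ht).measurableSet.diff hso.measurableSet)
  have e : ∀ w, excess κ Ω t w - excess κ Ω s w =
      logPotential ((Ω t \ Ω s).indicator fun z => (κ z)⁻¹) w +
        (-(t - s)) * Real.log (‖w‖ ^ 2) := by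
    intro w
    rw [← hdiff, hm.logPotential_sub hm', excess, excess]
    ring
  have hpos := pos_of_harmonicAt_of_tendsto_atTop hso (h.preconnected s hs') (h.zero_mem s hs')
    (v := fun w => excess κ Ω t w - excess κ Ω s w) ?_ ?_ ?_ hzs hz0
  · linarith [h.excess_nonneg hs' hz0]
  · intro w hw hw0
    simp_rw [e]
    exact (hmd.harmonicOnNhd_logPotential hso (fun y hy => indicator_of_notMem (fun h => h.2 hy) _)
      w hw).add ((harmonicAt_log_norm_sq hw0).const_smul (c := -(t - s)))
  · intro w _ hw0
    exact sub_nonneg.2 (h.excess_mono ht ⟨hst.1, hst.2.le⟩ hw0)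
  · simp_rw [e]
    refine Tendsto.add_atTop
      (hmd.continuous_logPotential.continuousAt.tendsto.mono_left nhdsWithin_le_nhds) ?_
    exact tendsto_log_norm_sq_nhdsNE_zero.const_mul_atBot_of_neg (by linarith [hst.2])

end IsInjectionFlow

/-! ### The envelope -/

theorem contDiff_fsPotential : ContDiff ℝ ∞ fsPotential :=
  (contDiff_const.add (contDiff_norm_sq ℝ)).log fun z => by positivity

theorem potential_eq (κ : ℂ → ℝ) (z : ℂ) :
    potential κ z = logPotential (fun z => (κ z)⁻¹) z - fsPotential z := by
  simp only [potential, logPotential, fsPotential, div_eq_mul_inv]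

theorem LelongGE.exists_fsPotential_add_le {t : ℝ} {ψ : ℂ → EReal}
    (hψ : LelongGE ψ t) : ∃ C : ℝ, ∀ᶠ z in 𝓝[≠] (0 : ℂ),
      (fsPotential z : EReal) + ψ z ≤ ((t * Real.log (‖z‖ ^ 2) + C : ℝ) : EReal) := by
  obtain ⟨C, hC⟩ := hψ
  refine ⟨fsPotential 0 + 1 + C, ?_⟩
  filter_upwards [hC, nhdsWithin_le_nhds ((contDiff_fsPotential.continuous.tendsto
    0).eventually_lt_const (lt_add_one _))] with z hz hz1
  refine (add_le_add (EReal.coe_le_coe_iff.2 hz1.le) hz).trans ?_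
  rw [← EReal.coe_add, EReal.coe_le_coe_iff]
  linarith

/-- The growth condition concerns only punctured neighbourhoods of `0`. The value at `0` is forced
down to `-∞` by comparison with an arbitrary constant `c` on a small disc. -/
theorem IsCandidate.fsPotential_add_le_at_zero {φ : ℂ → ℝ} {t : ℝ} (ht : 0 < t)
    {ψ : ℂ → EReal} (hψ : IsCandidate fsPotential φ t ψ) (c : ℝ) :
    (fsPotential 0 : EReal) + ψ 0 ≤ c := by
  obtain ⟨C, hC⟩ := hψ.lelong.exists_fsPotential_add_le
  have h2 : ∀ᶠ w in 𝓝[≠] (0 : ℂ), (fsPotential w : EReal) + ψ w ≤ c := by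
    filter_upwards [hC, tendsto_log_norm_sq_nhdsNE_zero.eventually_lt_atBot ((c - C) / t)]
      with w hw hw2
    refine hw.trans (EReal.coe_le_coe_iff.2 ?_)
    rw [lt_div_iff₀' ht] at hw2
    linarith
  rw [eventually_nhdsWithin_iff, Metric.eventually_nhds_iff] at h2
  obtain ⟨ρ, hρ, hball⟩ := h2
  refine hψ.subharmonic.le_of_le_frontier (Metric.closedBall 0 (ρ / 2)) (fun _ => c)
    (isCompact_closedBall _ _) continuousOn_const (InnerProductSpace.harmonicOnNhd_const c) ?_ 0
    (Metric.mem_closedBall_self (half_pos hρ).le)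
  intro w hw
  rw [frontier_closedBall _ (half_pos hρ).ne', Metric.mem_sphere] at hw
  refine hball (by linarith) ?_
  rintro rfl
  rw [dist_self] at hw
  linarith

namespace IsInjectionFlow

variable {κ : ℂ → ℝ} {Ω : ℝ → Set ℂ} {b : ℝ}

theorem contDiff_inv (h : IsInjectionFlow κ Ω b) : ContDiff ℝ ∞ fun z => (κ z)⁻¹ :=
  h.contDiff.inv fun z => (h.pos z).ne'

theorem contDiff_potential (h : IsInjectionFlow κ Ω b) : ContDiff ℝ ∞ (potential κ) := by
  have e : potential κ = fun z => logPotential (fun z => (κ z)⁻¹) z - fsPotential z :=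
    funext (potential_eq κ)
  rw [e]
  exact (contDiff_iff_contDiffAt.2 fun z =>
    (h.isLogDensity.contDiffAt_logPotential_and_laplacian h.contDiff_inv z).1).sub
      contDiff_fsPotential

theorem ddcDensity_eq (h : IsInjectionFlow κ Ω b) (z : ℂ) :
    ddcDensity (fun w => fsPotential w + potential κ w) z = (κ z)⁻¹ := by
  have e : (fun w => fsPotential w + potential κ w) = logPotential fun z => (κ z)⁻¹ := by
    ext w
    rw [potential_eq]
    ring
  rw [ddcDensity, e, (h.isLogDensity.contDiffAt_logPotential_and_laplacian h.contDiff_inv z).2]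
  have := Real.pi_ne_zero
  field_simp

theorem le_integral_inv (h : IsInjectionFlow κ Ω b) {t : ℝ} (ht : t ∈ Ioo 0 b) :
    t ≤ ∫ z, (κ z)⁻¹ := by
  -- The quadrature identity for constants says that `Ω_t` has mass exactly `t`.
  have e := h.setIntegral_eq_of_harmonicOnNhd ht isOpen_univ (subset_univ _) (f := fun _ => 1)
    (InnerProductSpace.harmonicOnNhd_const 1)
  simp only [one_div, mul_one] at e
  rw [← e]
  exact setIntegral_le_integral h.isLogDensity.integrable
    (Eventually.of_forall h.isLogDensity.nonneg)

theorem ofReal_le_lintegral (h : IsInjectionFlow κ Ω b) :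
    ENNReal.ofReal b ≤
      ∫⁻ z : ℂ, ENNReal.ofReal (ddcDensity (fun w => fsPotential w + potential κ w) z) := by
  simp_rw [h.ddcDensity_eq]
  rw [← ofReal_integral_eq_lintegral_ofReal h.isLogDensity.integrable
    (Eventually.of_forall h.isLogDensity.nonneg)]
  refine ENNReal.ofReal_le_ofReal_iff' |>.2 ?_
  by_cases hb : b ≤ 0
  · exact Or.inr hb
  · left
    push Not at hb
    refine le_of_forall_lt_imp_le_of_dense fun t ht => ?_
    by_cases ht0 : 0 < t
    · exact h.le_integral_inv ⟨ht0, ht⟩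
    · exact (not_lt.1 ht0).trans (integral_nonneg h.isLogDensity.nonneg)

theorem isLogDensity_indicator_compl (h : IsInjectionFlow κ Ω b) {t : ℝ} (ht : t ∈ Ioo 0 b) :
    IsLogDensity ((Ω t)ᶜ.indicator fun z => (κ z)⁻¹) :=
  h.isLogDensity.indicator (h.smoothFamily.isOpen t ht).measurableSet.compl

/-- In this form the extremal function is visibly subharmonic, harmonic in `Ω_t` off `0`, and has a
pole of weight `t`. -/
theorem logPotential_sub_excess (h : IsInjectionFlow κ Ω b) {t : ℝ} (ht : t ∈ Ioo 0 b) (z : ℂ) :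
    logPotential (fun z => (κ z)⁻¹) z - excess κ Ω t z =
      logPotential ((Ω t)ᶜ.indicator fun z => (κ z)⁻¹) z + t * Real.log (‖z‖ ^ 2) := by
  rw [indicator_compl, h.isLogDensity.logPotential_sub (h.isLogDensity_indicator ht), excess]
  ring

theorem isSubharmonic_logPotential_sub_excess (h : IsInjectionFlow κ Ω b) {t : ℝ}
    (ht : t ∈ Ioo 0 b) : IsSubharmonic fun z => if z = 0 then ⊥ else
      ((logPotential (fun z => (κ z)⁻¹) z - excess κ Ω t z : ℝ) : EReal) := by
  have hm := h.isLogDensity_indicator_compl ht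
  simp_rw [h.logPotential_sub_excess ht]
  refine isSubharmonic_of_submean ?_ ?_ ?_
  · intro z hz
    exact hm.continuous_logPotential.continuousAt.add
      (continuousAt_const.mul (continuousAt_log_norm_sq hz))
  · refine Tendsto.add_atBot
      (hm.continuous_logPotential.continuousAt.tendsto.mono_left nhdsWithin_le_nhds) ?_
    exact tendsto_log_norm_sq_nhdsNE_zero.const_mul_atBot ht.1
  · intro z hz
    have hlog : InnerProductSpace.HarmonicAt (fun z : ℂ => t * Real.log (‖z‖ ^ 2)) z :=
      (harmonicAt_log_norm_sq hz).const_smul (c := t)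
    filter_upwards [circleAverage_eq_of_harmonicAt hlog, Ioo_mem_nhdsGT (norm_pos_iff.2 hz)]
      with r hr hrz
    have hne : ∀ y ∈ Metric.sphere z |r|, y ≠ 0 := by
      rintro y hy rfl
      rw [mem_sphere_iff_norm, zero_sub, norm_neg, abs_of_pos hrz.1] at hy
      exact hrz.2.ne' hy
    have hc : ContinuousOn (fun z : ℂ => t * Real.log (‖z‖ ^ 2)) (Metric.sphere z |r|) := fun y hy =>
      (continuousAt_const.mul (continuousAt_log_norm_sq (hne y hy))).continuousWithinAt
    have := Real.circleAverage_add (c := z) (R := r)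
      hm.continuous_logPotential.continuousOn.circleIntegrable' hc.circleIntegrable'
    rw [hr] at this
    have h2 := hm.logPotential_le_circleAverage z hrz.1
    have e : Real.circleAverage (fun z => logPotential ((Ω t)ᶜ.indicator fun z => (κ z)⁻¹) z +
        t * Real.log (‖z‖ ^ 2)) z r = _ := this
    rw [e]
    linarith

/-- The extremal competitor in the envelope. -/
theorem isCandidate (h : IsInjectionFlow κ Ω b) {t : ℝ} (ht : t ∈ Ioo 0 b) :
    IsCandidate fsPotential (potential κ) t fun z => if z = 0 then ⊥ else
      ((potential κ z - excess κ Ω t z : ℝ) : EReal) := by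
  have hs := h.isSubharmonic_logPotential_sub_excess ht
  have hadd : (fun z => (fsPotential z : EReal) + if z = 0 then ⊥ else
      ((potential κ z - excess κ Ω t z : ℝ) : EReal)) = fun z => if z = 0 then ⊥ else
      ((logPotential (fun z => (κ z)⁻¹) z - excess κ Ω t z : ℝ) : EReal) := by
    ext z
    split_ifs
    · simp
    · rw [← EReal.coe_add, potential_eq]
      congr 1
      ring
  have hc : Continuous fun z => logPotential ((Ω t)ᶜ.indicator fun z => (κ z)⁻¹) z -
      fsPotential z :=
    (h.isLogDensity_indicator_compl ht).continuous_logPotential.sub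
      contDiff_fsPotential.continuous
  refine ⟨?_, ?_, ?_, ?_⟩
  · refine upperSemicontinuous_of_tendsto_atBot (w := fun z => potential κ z - excess κ Ω t z)
      (fun z hz => h.contDiff_potential.continuous.continuousAt.sub
        (h.continuousAt_excess ht hz)) ?_
    have e : ∀ z, potential κ z - excess κ Ω t z =
        (logPotential ((Ω t)ᶜ.indicator fun z => (κ z)⁻¹) z - fsPotential z) +
          t * Real.log (‖z‖ ^ 2) := fun z => by
      have := h.logPotential_sub_excess ht z
      rw [potential_eq]
      linarith
    simp_rw [e]
    exact Tendsto.add_atBot ((hc.tendsto 0).mono_left nhdsWithin_le_nhds)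
      (tendsto_log_norm_sq_nhdsNE_zero.const_mul_atBot ht.1)
  · intro z
    split_ifs with hz
    · exact bot_le
    · rw [EReal.coe_le_coe_iff]
      linarith [h.excess_nonneg ht hz]
  · rwa [hadd]
  · refine ⟨logPotential ((Ω t)ᶜ.indicator fun z => (κ z)⁻¹) 0 - fsPotential 0 + 1, ?_⟩
    filter_upwards [nhdsWithin_le_nhds ((hc.tendsto 0).eventually_lt_const (lt_add_one _)),
      self_mem_nhdsWithin] with z hz hz0
    rw [if_neg (mem_compl_singleton_iff.1 hz0), EReal.coe_le_coe_iff]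
    have := h.logPotential_sub_excess ht z
    rw [potential_eq]
    linarith

/-- Maximum principle on `Ω_t` minus a small disc. The two poles have comparable strength only up to
`O(1)`, so the majorant is increased by `η (log R² - log |w|²)`, which wins near `0`, is nonnegative
on the closure of `Ω_t` off `0`, and disappears as `η → 0`. -/
theorem add_le_of_isCandidate (h : IsInjectionFlow κ Ω b) {t : ℝ} (ht : t ∈ Ioo 0 b)
    {ψ : ℂ → EReal} (hψ : IsCandidate fsPotential (potential κ) t ψ) {z : ℂ} (hz : z ∈ Ω t)
    (hz0 : z ≠ 0) : (fsPotential z : EReal) + ψ z ≤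
      ((logPotential (fun z => (κ z)⁻¹) z - excess κ Ω t z : ℝ) : EReal) := by
  obtain ⟨C, hC⟩ := hψ.lelong.exists_fsPotential_add_le
  set P := logPotential ((Ω t)ᶜ.indicator fun z => (κ z)⁻¹) with hP
  have hm := h.isLogDensity_indicator_compl ht
  have hPc : Continuous P := hm.continuous_logPotential
  have hO := h.smoothFamily.isOpen t ht
  have hPh : InnerProductSpace.HarmonicOnNhd P (Ω t) :=
    hm.harmonicOnNhd_logPotential hO fun w hw => by simp [hw]
  have hW : ∀ w, (fsPotential w : EReal) + ψ w ≤ (logPotential (fun z => (κ z)⁻¹) w : EReal) := by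
    intro w
    refine (add_le_add le_rfl (hψ.le w)).trans ?_
    rw [← EReal.coe_add, potential_eq]
    simp
  obtain ⟨R, hR⟩ := (h.smoothFamily.isBounded t ht).closure.subset_closedBall (0 : ℂ)
  have hR' : ∀ w ∈ closure (Ω t), Real.log (‖w‖ ^ 2) ≤ Real.log (R ^ 2) ∨ w = 0 := by
    intro w hw
    rcases eq_or_ne w 0 with rfl | hw0
    · exact Or.inr rfl
    · left
      have h1 : ‖w‖ ≤ R := by simpa using hR hw
      have h2 : 0 < ‖w‖ := norm_pos_iff.2 hw0
      exact Real.log_le_log (by positivity) (by gcongr)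
  have key : ∀ η : ℝ, 0 < η → (fsPotential z : EReal) + ψ z ≤
      ((P z + t * Real.log (‖z‖ ^ 2) + η * (Real.log (R ^ 2) - Real.log (‖z‖ ^ 2)) : ℝ) : EReal) := by
    intro η hη
    set H : ℂ → ℝ := fun w =>
      P w + t * Real.log (‖w‖ ^ 2) + η * (Real.log (R ^ 2) - Real.log (‖w‖ ^ 2)) with hH
    have hHc : ∀ w ≠ 0, ContinuousAt H w := fun w hw =>
      (hPc.continuousAt.add (continuousAt_const.mul (continuousAt_log_norm_sq hw))).add
        (continuousAt_const.mul (continuousAt_const.sub (continuousAt_log_norm_sq hw)))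
    have hHh : ∀ w ∈ Ω t, w ≠ 0 → InnerProductSpace.HarmonicAt H w := fun w hw hw0 =>
      ((hPh w hw).add ((harmonicAt_log_norm_sq hw0).const_smul (c := t))).add
        (((InnerProductSpace.harmonicAt_const (Real.log (R ^ 2))).sub
          (harmonicAt_log_norm_sq hw0)).const_smul (c := η))
    have hev : ∀ᶠ w in 𝓝[≠] (0 : ℂ), (fsPotential w : EReal) + ψ w ≤ (H w : EReal) := by
      have h1 : ∀ᶠ w in 𝓝[≠] (0 : ℂ), P 0 - 1 < P w := nhdsWithin_le_nhds
        ((hPc.tendsto 0).eventually_const_lt (by linarith))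
      have h2 := tendsto_log_norm_sq_nhdsNE_zero.eventually_lt_atBot
        (Real.log (R ^ 2) - (C - (P 0 - 1)) / η)
      filter_upwards [hC, h1, h2] with w hw hw1 hw2
      refine hw.trans (EReal.coe_le_coe_iff.2 ?_)
      have h3 : (C - (P 0 - 1)) / η < Real.log (R ^ 2) - Real.log (‖w‖ ^ 2) := by linarith
      rw [div_lt_iff₀' hη] at h3
      simp only [hH]
      linarith
    rw [eventually_nhdsWithin_iff, Metric.eventually_nhds_iff] at hev
    obtain ⟨ρ, hρ, hball⟩ := hev
    have hzn : 0 < ‖z‖ := norm_pos_iff.2 hz0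
    -- `r ≤ |z|` keeps `z` in the compact set; `r < ρ` places the inner circle where the pole
    -- comparison holds.
    set r := min (ρ / 2) ‖z‖ with hr
    have hr0 : 0 < r := lt_min (half_pos hρ) hzn
    have hK : IsCompact (closure (Ω t) \ Metric.ball 0 r) :=
      (h.smoothFamily.isBounded t ht).isCompact_closure.diff Metric.isOpen_ball
    have hne : ∀ w ∈ closure (Ω t) \ Metric.ball 0 r, w ≠ 0 := by
      rintro w hw rfl
      exact hw.2 (Metric.mem_ball_self hr0)
    refine hψ.subharmonic.le_of_le_frontier _ H hK
      (fun w hw => (hHc w (hne w hw)).continuousWithinAt)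
      (fun w hw => hHh w (h.smoothFamily.interior_closure_subset ht
        (interior_mono sdiff_subset hw)) (hne w (interior_subset hw))) ?_ z
      ⟨subset_closure hz, fun hb => ?_⟩
    · intro w hw
      have hwK := hK.isClosed.frontier_subset hw
      have hw0 := hne w hwK
      by_cases hwΩ : w ∈ Ω t
      · have hwr : dist w 0 ≤ r := by
          by_contra! hcon
          apply hw.2
          rw [mem_interior_iff_mem_nhds]
          filter_upwards [hO.mem_nhds hwΩ, Metric.isClosed_closedBall.isOpen_compl.mem_nhds
            (show w ∈ (Metric.closedBall 0 r)ᶜ by simpa using hcon)] with v hv hv2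
          exact ⟨subset_closure hv, fun h => hv2 (Metric.ball_subset_closedBall h)⟩
        exact hball (by linarith [min_le_left (ρ / 2) ‖z‖]) hw0
      -- On the outer boundary the excess vanishes, so the majorant is the full potential plus a
      -- nonnegative term.
      · refine (hW w).trans (EReal.coe_le_coe_iff.2 ?_)
        have e := h.logPotential_sub_excess ht w
        rw [h.excess_eq_zero ht hwΩ, sub_zero] at e
        rw [e]
        simp only [hH]
        have := mul_nonneg hη.le (sub_nonneg.2 ((hR' w hwK.1).resolve_right hw0))
        linarith
    · rw [mem_ball_zero_iff] at hb
      exact absurd (hb.trans_le (min_le_right _ _)) (lt_irrefl _)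
  rw [h.logPotential_sub_excess ht]
  have hlim : Tendsto (fun η : ℝ => ((P z + t * Real.log (‖z‖ ^ 2) +
      η * (Real.log (R ^ 2) - Real.log (‖z‖ ^ 2)) : ℝ) : EReal)) (𝓝[>] 0)
      (𝓝 ((P z + t * Real.log (‖z‖ ^ 2) : ℝ) : EReal)) := by
    refine (continuous_coe_real_ereal.tendsto _).comp ?_
    have : Tendsto (fun η : ℝ => P z + t * Real.log (‖z‖ ^ 2) +
      η * (Real.log (R ^ 2) - Real.log (‖z‖ ^ 2))) (𝓝 0) (𝓝 (P z + t * Real.log (‖z‖ ^ 2) +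
      0 * (Real.log (R ^ 2) - Real.log (‖z‖ ^ 2)))) := by
      apply Continuous.tendsto; fun_prop
    rw [zero_mul, add_zero] at this
    exact this.mono_left nhdsWithin_le_nhds
  refine ge_of_tendsto hlim ?_
  filter_upwards [self_mem_nhdsWithin] with η hη
  exact key η hη

/-- Inside `Ω_t` off `0` the envelope is at most `φ - Q_t < φ`, and at `0` the candidates are
bounded by any constant; outside, the extremal candidate already attains `φ`. -/
theorem eq_domain (h : IsInjectionFlow κ Ω b) {t : ℝ} (ht : t ∈ Ioo 0 b) :
    Ω t = domain fsPotential (potential κ) t := by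
  have hbound : ∀ z (c : ℝ), (∀ ψ, IsCandidate fsPotential (potential κ) t ψ →
      (fsPotential z : EReal) + ψ z ≤ ((fsPotential z + c : ℝ) : EReal)) →
      envelope fsPotential (potential κ) t z ≤ c := by
    intro z c hc
    refine iSup₂_le fun ψ hψ => ?_
    have h1 := hc ψ hψ
    rw [EReal.coe_add] at h1
    exact EReal.addLECancellable_coe _ h1
  ext z
  refine ⟨fun hz => ?_, fun hz => ?_⟩
  · rcases eq_or_ne z 0 with rfl | hz0
    · refine (hbound 0 (potential κ 0 - 1) fun ψ hψ =>
        hψ.fsPotential_add_le_at_zero ht.1 _).trans_lt ?_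
      exact EReal.coe_lt_coe_iff.2 (by linarith)
    · refine (hbound z (potential κ z - excess κ Ω t z) fun ψ hψ => ?_).trans_lt ?_
      · have e : fsPotential z + (potential κ z - excess κ Ω t z) =
            logPotential (fun z => (κ z)⁻¹) z - excess κ Ω t z := by
          rw [potential_eq]; ring
        rw [e]
        exact h.add_le_of_isCandidate ht hψ hz hz0
      · exact EReal.coe_lt_coe_iff.2 (by linarith [h.excess_pos ht hz hz0])
  · by_contra hzΩ
    have hz0 : z ≠ 0 := by rintro rfl; exact hzΩ (h.zero_mem t ht)
    have h1 : (if z = 0 then ⊥ else ((potential κ z - excess κ Ω t z : ℝ) : EReal)) ≤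
        envelope fsPotential (potential κ) t z :=
      le_iSup₂_of_le (f := fun (ψ : ℂ → EReal)
        (_ : IsCandidate fsPotential (potential κ) t ψ) => ψ z) _ (h.isCandidate ht) le_rfl
    rw [if_neg hz0, h.excess_eq_zero ht hzΩ, sub_zero] at h1
    exact absurd hz (not_lt.2 h1)

end IsInjectionFlow

end HeleShaw

theorem proposition2p7 (κ : ℂ → ℝ) (hκ : ContDiff ℝ ∞ κ) (hκ_pos : ∀ z, 0 < κ z)
    (hκ_int : ∀ z : ℂ, Integrable (fun ζ : ℂ => Real.log (‖z - ζ‖ ^ 2) / κ ζ))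
    (Ω : ℝ → Set ℂ) (b : ℝ)
    (hsmooth : HeleShaw.IsSmoothFamily Ω 0 b)
    (hsc : ∀ t ∈ Ioo 0 b, IsSimplyConnected (Ω t))
    (hzero : ∀ t ∈ Ioo 0 b, (0 : ℂ) ∈ Ω t)
    (hmono : StrictMonoOn Ω (Ioo 0 b))
    (hstrong : HeleShaw.IsStrongHeleShawFlow κ Ω 0 b)
    (hlim : ∀ U ∈ 𝓝 (0 : ℂ), ∀ᶠ t in 𝓝[>] (0 : ℝ), Ω t ⊆ U) :
    HeleShaw.IsHeleShawFlow HeleShaw.fsPotential (HeleShaw.potential κ) Ω b := by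
  have h : HeleShaw.IsInjectionFlow κ Ω b :=
    ⟨hκ, hκ_pos, hκ_int, hsmooth,
      fun t ht => (hsc t ht).isPathConnected.isConnected.isPreconnected, hzero,
      hmono.monotoneOn, hstrong, hlim⟩
  exact ⟨h.contDiff_potential, fun z => by rw [h.ddcDensity_eq]; exact inv_pos.2 (hκ_pos z),
    h.ofReal_le_lintegral, fun t ht => h.eq_domain ht⟩
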